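/- Let $W$ be one of the classical Weyl groups $W_{A_{n-1}}=S_n$ $(n\ge 1)$, $W_{B_n}$ $(n\ge 1)$ or $W_{D_n}$ $(n\ge 2)$, viewed as a group of signed permutations of $1,\dots,n$, with simple reflections $s_i=(i,i+1)$ for $1\le i\le n-1$ and, in types $B_n$ and $D_n$ only, one further reflection $s_n$: for $B_n$, $s_n$ is the sign change at $n$; for $D_n$, $s_n$ is the transposition $(n-1,n)$ combined with the sign changes at $n-1$ and $n$. Let $m_{ij}$ be the order of $s_is_j$, and let $s_i^*\in S_n$ be the permutation obtained from $s_i$ by forgetting signs. The spin Weyl group algebra $\mathbb{C}W^-$ is the $\mathbb{C}$-algebra generated by $t_i$ (one for each simple reflection) subject to $(t_it_j)^{m_{ij}}=(-1)^{m_{ij}+1}$. The Clifford algebra $\mathcal{C}_{\mathfrak{h}^*}$ is generated by $c_1,\dots,c_n$ with $c_i^2=1$ and $c_ic_j=-c_jc_i$ $(i\ne j)$; the skew-polynomial algebra $\mathcal{C}[\eta_1,\dots,\eta_n]$ is generated by $\eta_1,\dots,\eta_n$ with $\eta_i\eta_j=-\eta_j\eta_i$ $(i\neq j)$; and $\mathbb{C}[\mathfrak{h}^*]=\mathbb{C}[x_1,\dots,x_n]$.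 Put $t_{i\uparrow j}=t_it_{i+1}\cdots t_j$ if $i\le j$ and $1$ otherwise, and $t_{i\downarrow j}=t_it_{i-1}\cdots t_j$ if $i\ge j$ and $1$ otherwise. For $1\le i<j\le n$ put $$[i,j]=(-1)^{j-i-1}t_{j-1}\cdots t_{i+1}t_it_{i+1}\cdots t_{j-1},\qquad [j,i]=-[i,j],$$ $$\overline{[i,j]}=\overline{[j,i]}=\begin{cases}(-1)^{j-i-1}\,t_{j\uparrow n-1}\,t_{i\uparrow n-2}\,t_n\,t_{n-2\downarrow i}\,t_{n-1\downarrow j}&\text{(type }D_n),\\ (-1)^{j-i}\,t_{j\uparrow n-1}\,t_{i\uparrow n-2}\,t_nt_{n-1}t_n\,t_{n-2\downarrow i}\,t_{n-1\downarrow j}&\text{(type }B_n),\end{cases}$$ and, in type $B_n$, $\overline{[i]}=(-1)^{n-i}t_i\cdots t_{n-1}t_nt_{n-1}\cdots t_i$ for $1\le i\le n$. Let $t,u,v\in\mathbb{C}$. The spin double affine Hecke--Clifford algebra $\ddot{\mathfrak H}^-_W$ is the $\mathbb{C}$-algebra generated by $x_i,\eta_i,c_i$ $(1\le i\le n)$ and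 the $t_k$, subject to the above relations of $\mathcal{C}_{\mathfrak{h}^*}$ and $\mathbb{C}W^-$, the relations $$\eta_i\eta_j=-\eta_j\eta_i,\quad x_ix_j=x_jx_i\quad(i\ne j),\qquad c_i\eta_j=-\eta_jc_i,\quad c_ix_j=(-1)^{\delta_{ij}}x_jc_i,$$ $$t_kc_j=-c_j^{s_k}t_k,\qquad t_kx_j=x_j^{s_k}t_k,\qquad t_k\eta_j=-\eta_j^{s_k^*}t_k$$ (where $s_k$ acts by signed permutation of the indices and $s_k^*$ by permutation), and the following relations for $i\neq j$, respectively for all $i$: Type $A_{n-1}$: $[\eta_i,x_j]=u(1+c_ic_j)[i,j]$ and $[\eta_i,x_i]=tc_i+u\sum_{k\ne i}(1+c_kc_i)[k,i]$. Type $D_n$: $[\eta_i,x_j]=u\big((1+c_ic_j)[i,j]-(1-c_ic_j)\overline{[i,j]}\big)$ and $[\eta_i,x_i]=tc_i+u\sum_{k\ne i}\big((1+c_kc_i)[k,i]-(1-c_kc_i)\overline{[k,i]}\big)$. Type $B_n$: as in type $D_n$ (with $t_k$, $\overline{[i,j]}$ of type $B_n$), with the additional summand $v\overline{[i]}$ in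 $[\eta_i,x_i]$. (Here $[\eta_i,x_j]=\eta_ix_j-x_j\eta_i$.) **Theorem (PBW).** The multiplication map $$\mathcal{C}[\eta_1,\dots,\eta_n]\otimes\mathcal{C}_{\mathfrak{h}^*}\otimes\mathbb{C}W^-\otimes\mathbb{C}[\mathfrak{h}^*]\longrightarrow \ddot{\mathfrak H}^-_W,\qquad p\otimes q\otimes\sigma\otimes f\mapsto p\,q\,\sigma f,$$ is an isomorphism of vector spaces. Moreover, for every basis of $\mathbb{C}W^-$, the elements $\eta^\alpha c^\epsilon\sigma x^\gamma$, where $\sigma$ runs over that basis, $\epsilon\in\mathbb{Z}_2^n$ and $\alpha,\gamma\in\mathbb{Z}_+^n$, form a basis of $\ddot{\mathfrak H}^-_W$; here $\eta^\alpha=\eta_1^{\alpha_1}\cdots\eta_n^{\alpha_n}$, $c^\epsilon=c_1^{\epsilon_1}\cdots c_n^{\epsilon_n}$ and $x^\gamma=x_1^{\gamma_1}\cdots x_n^{\gamma_n}$. -/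

import Mathlib

open scoped TensorProduct

noncomputable section

namespace SpinDaHCa

/-- The three families of classical Weyl groups: `A` with parameter `n` stands for
`W_{A_{n-1}} = S_n`, `B` for `W_{B_n}`, and `D` for `W_{D_n}`. -/
inductive ClassicalType : Type
  | A
  | B
  | D
  deriving DecidableEq

/-- The number of simple reflections: `n - 1` for `A_{n-1}` and `n` for `B_n`, `D_n`. -/
def rank : ClassicalType → ℕ → ℕ
  | .A, n => n - 1
  | .B, n => n
  | .D, n => n

/-- The Coxeter exponent `m_{ij}`; the simple reflections are labelled by `1, 2, …, rank`.
The reflections `1, …, n-1` form a chain. In type `B_n` the node `n` is joined to `n-1` by a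
double bond, in type `D_n` it is joined to `n-2` by a simple bond. -/
def coxeterExp (ty : ClassicalType) (n i j : ℕ) : ℕ :=
  if i = j then 1
  else match ty with
    | .A => if i + 1 = j ∨ j + 1 = i then 3 else 2
    | .B => if i + 1 = j ∨ j + 1 = i then (if i = n ∨ j = n then 4 else 3) else 2
    | .D =>
        if i = n ∨ j = n then (if i + 2 = j ∨ j + 2 = i then 3 else 2)
        else (if i + 1 = j ∨ j + 1 = i then 3 else 2)

/-- The permutation `s_i^* = ρ(s_i) ∈ S_n` underlying the signed permutation `s_i`
(`i` is a label in `1, …, rank`, positions are `0`-based): the transposition `(i, i+1)` for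
`i < n`, the identity for `s_n` of type `B_n`, and `(n-1, n)` for `s_n` of type `D_n`. -/
def reflPerm (ty : ClassicalType) (n i : ℕ) : Equiv.Perm (Fin n) :=
  if h : 1 ≤ i ∧ i < n then Equiv.swap ⟨i - 1, by omega⟩ ⟨i, h.2⟩
  else if h : ty = .D ∧ i = n ∧ 2 ≤ n then Equiv.swap ⟨n - 2, by omega⟩ ⟨n - 1, by omega⟩
  else 1

/-- The sign with which the signed permutation `s_i` acts on the `j`-th coordinate vector:
`s_i e_j = reflSign i j • e_{s_i^* j}`. It is `-1` exactly for `s_n` of type `B_n` at the last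
coordinate, and for `s_n` of type `D_n` at the last two coordinates. -/
def reflSign (ty : ClassicalType) (n i : ℕ) (j : Fin n) : ℂ :=
  if i = n ∧ ((ty = .B ∧ (j : ℕ) + 1 = n) ∨ (ty = .D ∧ n ≤ (j : ℕ) + 2)) then -1 else 1

section words

variable {A : Type*}

/-- A family indexed by `0, …, r-1`, viewed as a sequence `t_1, …, t_r` with `1`-based labels. -/
def label [One A] {r : ℕ} (f : Fin r → A) (i : ℕ) : A :=
  if h : 1 ≤ i ∧ i ≤ r then f ⟨i - 1, by omega⟩ else 1

/-- `t_i t_{i+1} ⋯ t_j` if `i ≤ j`, and `1` otherwise. -/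
def upProd [Monoid A] (t : ℕ → A) (i j : ℕ) : A :=
  ((List.range' i (j + 1 - i)).map t).prod

/-- `t_i t_{i-1} ⋯ t_j` if `i ≥ j`, and `1` otherwise. -/
def downProd [Monoid A] (t : ℕ → A) (i j : ℕ) : A :=
  ((List.range' j (i + 1 - j)).reverse.map t).prod

variable [Ring A]

/-- `[i,j] = (-1)^{j-i-1} t_{j-1} ⋯ t_{i+1} t_i t_{i+1} ⋯ t_{j-1}` for `i < j`, and
`[j,i] = -[i,j]`. -/
def brk (t : ℕ → A) (i j : ℕ) : A :=
  if i < j then (-1) ^ (j - i - 1) * (downProd t (j - 1) i * upProd t (i + 1) (j - 1))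
  else -((-1) ^ (i - j - 1) * (downProd t (i - 1) j * upProd t (j + 1) (i - 1)))

/-- `\overline{[i,j]}` for `i < j` (equal to `0` in type `A`, where it does not occur). -/
def barBrkAux (ty : ClassicalType) (n : ℕ) (t : ℕ → A) (i j : ℕ) : A :=
  match ty with
  | .A => 0
  | .B => (-1) ^ (j - i) * (upProd t j (n - 1) * upProd t i (n - 2) * (t n * t (n - 1) * t n)
      * downProd t (n - 2) i * downProd t (n - 1) j)
  | .D => (-1) ^ (j - i - 1) * (upProd t j (n - 1) * upProd t i (n - 2) * t n
      * downProd t (n - 2) i * downProd t (n - 1) j)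

/-- `\overline{[i,j]}`, symmetric in `i ≠ j`. -/
def barBrk (ty : ClassicalType) (n : ℕ) (t : ℕ → A) (i j : ℕ) : A :=
  if i < j then barBrkAux ty n t i j else barBrkAux ty n t j i

/-- `\overline{[i]} = (-1)^{n-i} t_i ⋯ t_{n-1} t_n t_{n-1} ⋯ t_i` (used in type `B`). -/
def barOne (n : ℕ) (t : ℕ → A) (i : ℕ) : A :=
  (-1) ^ (n - i) * (upProd t i (n - 1) * t n * downProd t (n - 1) i)

variable [Algebra ℂ A]

/-- The right-hand side of the relation for `[η_i, x_j]`, `i ≠ j`. -/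
def offDiag (ty : ClassicalType) (n : ℕ) (u : ℂ) (c : Fin n → A) (t : ℕ → A) (i j : Fin n) : A :=
  match ty with
  | .A => u • ((1 + c i * c j) * brk t (i + 1) (j + 1))
  | .B => u • ((1 + c i * c j) * brk t (i + 1) (j + 1)
      - (1 - c i * c j) * barBrk .B n t (i + 1) (j + 1))
  | .D => u • ((1 + c i * c j) * brk t (i + 1) (j + 1)
      - (1 - c i * c j) * barBrk .D n t (i + 1) (j + 1))

/-- The right-hand side of the relation for `[η_i, x_i]`; here `a` is the parameter
called `t` in print, and `v` only matters in type `B`. -/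
def onDiag (ty : ClassicalType) (n : ℕ) (a u v : ℂ) (c : Fin n → A) (t : ℕ → A) (i : Fin n) : A :=
  match ty with
  | .A => a • c i
      + u • (∑ k ∈ Finset.univ.erase i, (1 + c k * c i) * brk t (k + 1) (i + 1))
  | .B => a • c i
      + u • (∑ k ∈ Finset.univ.erase i, ((1 + c k * c i) * brk t (k + 1) (i + 1)
        - (1 - c k * c i) * barBrk .B n t (k + 1) (i + 1)))
      + v • barOne n t (i + 1)
  | .D => a • c i
      + u • (∑ k ∈ Finset.univ.erase i, ((1 + c k * c i) * brk t (k + 1) (i + 1)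
        - (1 - c k * c i) * barBrk .D n t (k + 1) (i + 1)))

end words

/-! ### The skew-polynomial algebra -/

/-- The relations `b_i b_j = - b_j b_i` for `i ≠ j`. -/
inductive SkewRel (n : ℕ) : FreeAlgebra ℂ (Fin n) → FreeAlgebra ℂ (Fin n) → Prop
  | anticomm (i j : Fin n) (h : i ≠ j) :
      SkewRel n (FreeAlgebra.ι ℂ i * FreeAlgebra.ι ℂ j) (-(FreeAlgebra.ι ℂ j * FreeAlgebra.ι ℂ i))

/-- The skew-polynomial algebra `𝒞[b_1, …, b_n]`. -/
abbrev SkewPoly (n : ℕ) : Type := RingQuot (SkewRel n)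

namespace SkewPoly

/-- The generator `b_i`. -/
def gen (n : ℕ) (i : Fin n) : SkewPoly n := RingQuot.mkAlgHom ℂ (SkewRel n) (FreeAlgebra.ι ℂ i)

end SkewPoly

/-! ### The spin Weyl group algebra -/

/-- The relations `(t_i t_j)^{m_{ij}} = (-1)^{m_{ij}+1}`. -/
inductive SpinRel (ty : ClassicalType) (n : ℕ) :
    FreeAlgebra ℂ (Fin (rank ty n)) → FreeAlgebra ℂ (Fin (rank ty n)) → Prop
  | braid (i j : Fin (rank ty n)) :
      SpinRel ty n
        ((FreeAlgebra.ι ℂ i * FreeAlgebra.ι ℂ j) ^ coxeterExp ty n (i + 1) (j + 1))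
        ((-1) ^ (coxeterExp ty n (i + 1) (j + 1) + 1))

/-- The spin Weyl group algebra `ℂW⁻`. -/
abbrev SpinWeyl (ty : ClassicalType) (n : ℕ) : Type := RingQuot (SpinRel ty n)

namespace SpinWeyl

/-- The generator `t_{i+1}`. -/
def gen (ty : ClassicalType) (n : ℕ) (i : Fin (rank ty n)) : SpinWeyl ty n :=
  RingQuot.mkAlgHom ℂ (SpinRel ty n) (FreeAlgebra.ι ℂ i)

end SpinWeyl

/-! ### The Clifford algebra of `𝔥^*` -/

/-- The quadratic form `v ↦ ∑ v_i²` on `ℂⁿ`, so that the coordinate vectors give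
`c_i² = 1` and `c_i c_j = - c_j c_i` for `i ≠ j`. -/
def stdForm (n : ℕ) : QuadraticForm ℂ (Fin n → ℂ) :=
  QuadraticMap.weightedSumSquares ℂ (fun _ : Fin n => (1 : ℂ))

/-- The Clifford algebra `𝒞_{𝔥^*}`. -/
abbrev Cliff (n : ℕ) : Type := CliffordAlgebra (stdForm n)

/-- The generator `c_i`. -/
def Cliff.gen (n : ℕ) (i : Fin n) : Cliff n :=
  CliffordAlgebra.ι (stdForm n) (Pi.single i 1)

/-! ### The spin double affine Hecke-Clifford algebra -/

/-- The generators `x_i`, `η_i`, `c_i`, `t_k`. -/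
inductive Gen (ty : ClassicalType) (n : ℕ) : Type
  | x (i : Fin n)
  | eta (i : Fin n)
  | c (i : Fin n)
  | t (k : Fin (rank ty n))

namespace Gen

variable {ty : ClassicalType} {n : ℕ}

/-- `x_i` in the free algebra. -/
def fx (i : Fin n) : FreeAlgebra ℂ (Gen ty n) := FreeAlgebra.ι ℂ (Gen.x i)

/-- `η_i` in the free algebra. -/
def fe (i : Fin n) : FreeAlgebra ℂ (Gen ty n) := FreeAlgebra.ι ℂ (Gen.eta i)

/-- `c_i` in the free algebra. -/
def fc (i : Fin n) : FreeAlgebra ℂ (Gen ty n) := FreeAlgebra.ι ℂ (Gen.c i)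

/-- `t_{k+1}` in the free algebra. -/
def ft (k : Fin (rank ty n)) : FreeAlgebra ℂ (Gen ty n) := FreeAlgebra.ι ℂ (Gen.t k)

end Gen

open Gen in
/-- The defining relations of the algebra generated by `x_i`, `η_i` and `𝒞_{𝔥^*} ⋊₋ ℂW⁻`. -/
inductive Rel (ty : ClassicalType) (n : ℕ) (a u v : ℂ) :
    FreeAlgebra ℂ (Gen ty n) → FreeAlgebra ℂ (Gen ty n) → Prop
  /- the relations of `𝒞_{𝔥^*} ⋊₋ ℂW⁻` -/
  | c_sq (i : Fin n) : Rel ty n a u v (fc i * fc i) 1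
  | c_c (i j : Fin n) (h : i ≠ j) : Rel ty n a u v (fc i * fc j) (-(fc j * fc i))
  | t_t (i j : Fin (rank ty n)) : Rel ty n a u v
      ((ft i * ft j) ^ coxeterExp ty n (i + 1) (j + 1))
      ((-1) ^ (coxeterExp ty n (i + 1) (j + 1) + 1))
  | t_c (k : Fin (rank ty n)) (j : Fin n) : Rel ty n a u v
      (ft k * fc j)
      (-(reflSign ty n (k + 1) j • (fc (reflPerm ty n (k + 1) j) * ft k)))
  /- the common relations -/
  | e_e (i j : Fin n) (h : i ≠ j) : Rel ty n a u v (fe i * fe j) (-(fe j * fe i))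
  | x_x (i j : Fin n) (h : i ≠ j) : Rel ty n a u v (fx i * fx j) (fx j * fx i)
  | c_e (i j : Fin n) : Rel ty n a u v (fc i * fe j) (-(fe j * fc i))
  | c_x (i j : Fin n) : Rel ty n a u v
      (fc i * fx j) ((if i = j then (-1 : ℂ) else 1) • (fx j * fc i))
  | t_x (k : Fin (rank ty n)) (j : Fin n) : Rel ty n a u v
      (ft k * fx j)
      (reflSign ty n (k + 1) j • (fx (reflPerm ty n (k + 1) j) * ft k))
  | t_e (k : Fin (rank ty n)) (j : Fin n) : Rel ty n a u v
      (ft k * fe j) (-(fe (reflPerm ty n (k + 1) j) * ft k))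
  /- the relations for `[η_i, x_j]` -/
  | e_x_off (i j : Fin n) (h : i ≠ j) : Rel ty n a u v
      (fe i * fx j - fx j * fe i) (offDiag ty n u fc (label ft) i j)
  | e_x_diag (i : Fin n) : Rel ty n a u v
      (fe i * fx i - fx i * fe i) (onDiag ty n a u v fc (label ft) i)

/-- The spin double affine Hecke-Clifford algebra with parameters `a` (called `t` in print),
`u`, `v`; the parameter `v` only matters in type `B`. -/
abbrev SH (ty : ClassicalType) (n : ℕ) (a u v : ℂ) : Type := RingQuot (Rel ty n a u v)

namespace SH

variable (ty : ClassicalType) (n : ℕ) (a u v : ℂ)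

/-- The quotient map from the free algebra. -/
def mk : FreeAlgebra ℂ (Gen ty n) →ₐ[ℂ] SH ty n a u v := RingQuot.mkAlgHom ℂ (Rel ty n a u v)

/-- The generator `x_i`. -/
def x (i : Fin n) : SH ty n a u v := mk ty n a u v (Gen.fx i)

/-- The generator `η_i`. -/
def eta (i : Fin n) : SH ty n a u v := mk ty n a u v (Gen.fe i)

/-- The generator `c_i`. -/
def c (i : Fin n) : SH ty n a u v := mk ty n a u v (Gen.fc i)

/-- The generator `t_{k+1}`. -/
def t (k : Fin (rank ty n)) : SH ty n a u v := mk ty n a u v (Gen.ft k)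

variable {ty n a u v} in
theorem mk_rel {p q : FreeAlgebra ℂ (Gen ty n)} (h : Rel ty n a u v p q) :
    mk ty n a u v p = mk ty n a u v q :=
  RingQuot.mkAlgHom_rel ℂ h

theorem x_comm (i j : Fin n) : x ty n a u v i * x ty n a u v j = x ty n a u v j * x ty n a u v i := by
  by_cases h : i = j
  · rw [h]
  · simpa [x] using mk_rel (Rel.x_x (a := a) (u := u) (v := v) (ty := ty) i j h)

theorem c_mul_self (i : Fin n) : c ty n a u v i * c ty n a u v i = 1 := by
  simpa [c] using mk_rel (Rel.c_sq (a := a) (u := u) (v := v) (ty := ty) i)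

theorem c_anticomm (i j : Fin n) (h : i ≠ j) :
    c ty n a u v i * c ty n a u v j = -(c ty n a u v j * c ty n a u v i) := by
  simpa [c] using mk_rel (Rel.c_c (a := a) (u := u) (v := v) (ty := ty) i j h)

/-- The algebra homomorphism `𝒞[η_1, …, η_n] → SH` with `b_i ↦ η_i`. -/
def ofSkew : SkewPoly n →ₐ[ℂ] SH ty n a u v :=
  RingQuot.liftAlgHom ℂ ⟨FreeAlgebra.lift ℂ (eta ty n a u v), by
    rintro _ _ ⟨i, j, h⟩
    simpa [eta] using mk_rel (Rel.e_e (a := a) (u := u) (v := v) (ty := ty) i j h)⟩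

/-- The algebra homomorphism `ℂW⁻ → SH` with `t_k ↦ t_k`. -/
def ofSpin : SpinWeyl ty n →ₐ[ℂ] SH ty n a u v :=
  RingQuot.liftAlgHom ℂ ⟨FreeAlgebra.lift ℂ (t ty n a u v), by
    rintro _ _ ⟨i, j⟩
    simpa [t] using mk_rel (Rel.t_t (a := a) (u := u) (v := v) (ty := ty) i j)⟩

theorem sum_c_sq (w : Fin n → ℂ) :
    Fintype.linearCombination ℂ (c ty n a u v) w * Fintype.linearCombination ℂ (c ty n a u v) w
      = algebraMap ℂ (SH ty n a u v) (stdForm n w) := by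
  have key : ∀ i j : Fin n, (w i • c ty n a u v i) * (w j • c ty n a u v j)
      + (w j • c ty n a u v j) * (w i • c ty n a u v i)
      = if i = j then (2 * (w i * w i)) • (1 : SH ty n a u v) else 0 := by
    intro i j
    split_ifs with h
    · subst h
      rw [smul_mul_smul_comm, c_mul_self, ← two_smul ℂ, smul_smul]
    · rw [smul_mul_smul_comm, smul_mul_smul_comm, c_anticomm ty n a u v i j h, mul_comm (w j)]
      simp
  set S := Fintype.linearCombination ℂ (c ty n a u v) w with hS
  have hS' : S = ∑ i, w i • c ty n a u v i := by
    rw [hS, Fintype.linearCombination_apply]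
  have h2 : (2 : ℂ) • (S * S) = (2 : ℂ) • algebraMap ℂ (SH ty n a u v) (stdForm n w) := by
    have e1 : S * S = ∑ i, ∑ j, (w i • c ty n a u v i) * (w j • c ty n a u v j) := by
      rw [hS', Finset.sum_mul_sum]
    have e2 : S * S = ∑ i, ∑ j, (w j • c ty n a u v j) * (w i • c ty n a u v i) := by
      rw [e1, Finset.sum_comm]
    rw [two_smul]
    nth_rewrite 1 [e1]
    rw [e2, ← Finset.sum_add_distrib]
    simp_rw [← Finset.sum_add_distrib, key]
    simp [stdForm, QuadraticMap.weightedSumSquares_apply, Algebra.algebraMap_eq_smul_one,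
      Finset.smul_sum, mul_smul]
  exact smul_right_injective _ (two_ne_zero : (2 : ℂ) ≠ 0) h2

/-- The algebra homomorphism `𝒞_{𝔥^*} → SH` with `c_i ↦ c_i`. -/
def ofCliff : Cliff n →ₐ[ℂ] SH ty n a u v :=
  CliffordAlgebra.lift (stdForm n)
    ⟨Fintype.linearCombination ℂ (c ty n a u v), sum_c_sq ty n a u v⟩

open scoped IsMulCommutative in
/-- The algebra homomorphism `ℂ[𝔥^*] = ℂ[x_1, …, x_n] → SH` with `x_i ↦ x_i`: polynomials are
evaluated in the commutative subalgebra generated by the `x_i`. -/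
def ofPoly : MvPolynomial (Fin n) ℂ →ₐ[ℂ] SH ty n a u v :=
  haveI : IsMulCommutative (Algebra.adjoin ℂ (Set.range (x ty n a u v))) :=
    Algebra.isMulCommutative_adjoin ℂ (by
      rintro _ ⟨i, rfl⟩ _ ⟨j, rfl⟩
      exact x_comm ty n a u v i j)
  (Algebra.adjoin ℂ (Set.range (x ty n a u v))).val.comp
    (MvPolynomial.aeval fun i => ⟨x ty n a u v i, Algebra.subset_adjoin ⟨i, rfl⟩⟩)

theorem ofSkew_gen (i : Fin n) : ofSkew ty n a u v (SkewPoly.gen n i) = eta ty n a u v i := by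
  simp only [ofSkew, SkewPoly.gen]
  rw [RingQuot.liftAlgHom_mkAlgHom_apply]
  simp

theorem ofSpin_gen (k : Fin (rank ty n)) :
    ofSpin ty n a u v (SpinWeyl.gen ty n k) = t ty n a u v k := by
  simp only [ofSpin, SpinWeyl.gen]
  rw [RingQuot.liftAlgHom_mkAlgHom_apply]
  simp

theorem ofCliff_gen (i : Fin n) : ofCliff ty n a u v (Cliff.gen n i) = c ty n a u v i := by
  simp [ofCliff, Cliff.gen, Fintype.linearCombination_apply, Pi.single_apply]

theorem ofPoly_X (i : Fin n) :
    ofPoly ty n a u v (MvPolynomial.X i) = x ty n a u v i := by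
  simp [ofPoly]

/-- The multiplication map
`𝒞[η_1, …, η_n] ⊗ 𝒞_{𝔥^*} ⊗ ℂW⁻ ⊗ ℂ[𝔥^*] → SH`, `p ⊗ q ⊗ σ ⊗ f ↦ p q σ f`. -/
def mulMap : SkewPoly n ⊗[ℂ] (Cliff n ⊗[ℂ] (SpinWeyl ty n ⊗[ℂ] MvPolynomial (Fin n) ℂ))
    →ₗ[ℂ] SH ty n a u v :=
  LinearMap.mul' ℂ _ ∘ₗ TensorProduct.map (ofSkew ty n a u v).toLinearMap
    (LinearMap.mul' ℂ _ ∘ₗ TensorProduct.map (ofCliff ty n a u v).toLinearMap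
      (LinearMap.mul' ℂ _ ∘ₗ TensorProduct.map (ofSpin ty n a u v).toLinearMap
        (ofPoly ty n a u v).toLinearMap))

/-- The monomial `η^α = η_1^{α_1} ⋯ η_n^{α_n}`. -/
def etaPow (α : Fin n → ℕ) : SH ty n a u v := (List.ofFn fun i => eta ty n a u v i ^ α i).prod

/-- The monomial `c^ε = c_1^{ε_1} ⋯ c_n^{ε_n}`, `ε ∈ ℤ₂ⁿ`. -/
def cPow (ε : Fin n → ZMod 2) : SH ty n a u v :=
  (List.ofFn fun i => c ty n a u v i ^ (ε i).val).prod

/-- The monomial `x^γ = x_1^{γ_1} ⋯ x_n^{γ_n}`. -/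
def xPow (γ : Fin n → ℕ) : SH ty n a u v := (List.ofFn fun i => x ty n a u v i ^ γ i).prod

end SH

end SpinDaHCa

end

/-! Surjectivity is the easy half. The span of the products `p q σ f` contains `1` and is stable
under left multiplication by every generator: a generator moves to its place at the cost of a
nonzero scalar or a change of index, and for `x` past `η` at the cost of a commutator in the
subalgebra generated by the `c i` and `t k`, which preserves the span (`SH.mulMap_surjective`).

Injectivity needs a module that separates these products, and a change of variables makes one
accessible. Let the Clifford algebra commute with an ordinary, non-spin action of `W` and
anticommute with the `η_i` and with further anticommuting variables `z_i`. Put `x_i = c_i z_i` and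
`t_k = β_k s_k`, where `β_k` is the normalized simple root in the Clifford algebra. The `β_k`
themselves satisfy the spin relations (`Cliff.root_rel`). The words `[i,j]` and their barred
versions become a root times a reflection, and the factors `1 ± c_i c_j` collapse that root to a
multiple of `c_j`. All the relations then reduce to those of `IsOddRep`, the essential one being
`η_i z_j + z_j η_i = -K_ij` with `K_ij` in the group algebra of `W` (`IsOddRep.onGen_rel`).

The family `K` is symmetric, is equivariant under `W` acting on indices without signs, and satisfies
the Jacobi identity `[K_ij, y_k] + [K_kj, y_i] = 0` for `i ≠ k`, where `y` is `η` or `z`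
(`Weyl.jacobi`). So any module `N` over the Clifford algebra, `W` and the `z_i` extends to the skew
polynomials tensored with `N`: the action of `z_j` is forced by the cross relation, and the Jacobi
identity is exactly its consistency condition (`Induced.isOddRep`).

For `N` take functions on `S_n` with values in `Cliff ⊗ Cliff ⊗ ℂW⁻ ⊗ ℂ[x]`. The first factor
carries the Clifford action. The roots act on the second factor from the right and cancel the signs
of the spin relations, so that `W` acts honestly. The argument in `S_n` records how `W` permutes the
`z_i`, so that no grading of `ℂW⁻` by permutations is required. Multiplying the two Clifford factors
and summing over `S_n` recovers `p ⊗ q ⊗ σ ⊗ f` from the action of `p q σ f` on a cyclic vector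
(`Model.retract_mulMap`). No basis or dimension of `ℂW⁻` is used, and `W` enters only through its
Coxeter presentation.

The basis statement follows by tensoring the ordered monomial bases `SkewPoly.basis` and
`Cliff.basis` with the given basis of `ℂW⁻` and the monomials in the `x_i`. -/

noncomputable section

namespace SpinDaHCa

/-! ### Generation by left multiplication -/

/-- A subspace stable under the action of algebra generators is stable under the algebra. -/
theorem map_mem_of_adjoin_eq_top {ι A V : Type*} [Ring A] [Algebra ℂ A] [AddCommGroup V]
    [Module ℂ V] {g : ι → A} (hg : Algebra.adjoin ℂ (Set.range g) = ⊤)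
    (φ : A →ₐ[ℂ] Module.End ℂ V) (S : Submodule ℂ V) (hS : ∀ i, ∀ v ∈ S, φ (g i) v ∈ S)
    (a : A) {v : V} (hv : v ∈ S) : φ a v ∈ S := by
  have ha : a ∈ Algebra.adjoin ℂ (Set.range g) := hg ▸ Algebra.mem_top
  induction ha using Algebra.adjoin_induction generalizing v with
  | mem x hx =>
    obtain ⟨i, rfl⟩ := hx
    exact hS i v hv
  | algebraMap r =>
    rw [AlgHom.commutes, Module.algebraMap_end_apply]
    exact S.smul_mem r hv
  | add x y _ _ hx hy =>
    rw [map_add]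
    exact S.add_mem (hx hv) (hy hv)
  | mul x y _ _ hx hy =>
    rw [map_mul]
    exact hx (hy hv)

/-- A subspace that contains `1` and is stable under left multiplication by algebra generators
is everything. -/
theorem mem_of_adjoin_eq_top {ι A : Type*} [Ring A] [Algebra ℂ A]
    {g : ι → A} (hg : Algebra.adjoin ℂ (Set.range g) = ⊤) (S : Submodule ℂ A) (h1 : 1 ∈ S)
    (hS : ∀ i, ∀ v ∈ S, g i * v ∈ S) (a : A) : a ∈ S := by
  simpa using map_mem_of_adjoin_eq_top hg (Algebra.lmul ℂ A) S hS a h1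

theorem adjoin_ringQuot {ι : Type*} (s : FreeAlgebra ℂ ι → FreeAlgebra ℂ ι → Prop) :
    Algebra.adjoin ℂ (Set.range fun i => RingQuot.mkAlgHom ℂ s (FreeAlgebra.ι ℂ i)) = ⊤ := by
  have h := (FreeAlgebra.adjoin_range_ι (R := ℂ) (X := ι))
  have h2 := congrArg (Subalgebra.map (RingQuot.mkAlgHom ℂ s)) h
  rw [AlgHom.map_adjoin, Algebra.map_top, ← Set.range_comp] at h2
  rw [show (fun i => RingQuot.mkAlgHom ℂ s (FreeAlgebra.ι ℂ i))
    = RingQuot.mkAlgHom ℂ s ∘ FreeAlgebra.ι ℂ from rfl, h2, AlgHom.range_eq_top]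
  exact RingQuot.mkAlgHom_surjective ℂ s

theorem SkewPoly.adjoin_gen (n : ℕ) : Algebra.adjoin ℂ (Set.range (SkewPoly.gen n)) = ⊤ :=
  adjoin_ringQuot _

theorem SpinWeyl.adjoin_gen (ty : ClassicalType) (n : ℕ) :
    Algebra.adjoin ℂ (Set.range (SpinWeyl.gen ty n)) = ⊤ :=
  adjoin_ringQuot _

theorem SkewPoly.gen_anticomm {n : ℕ} {i j : Fin n} (h : i ≠ j) :
    SkewPoly.gen n i * SkewPoly.gen n j = -(SkewPoly.gen n j * SkewPoly.gen n i) := by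
  simpa [SkewPoly.gen] using RingQuot.mkAlgHom_rel ℂ (SkewRel.anticomm i j h)

theorem SpinWeyl.gen_rel {ty : ClassicalType} {n : ℕ} (i j : Fin (rank ty n)) :
    (SpinWeyl.gen ty n i * SpinWeyl.gen ty n j) ^ coxeterExp ty n (i + 1) (j + 1)
      = (-1) ^ (coxeterExp ty n (i + 1) (j + 1) + 1) := by
  simpa [SpinWeyl.gen] using RingQuot.mkAlgHom_rel ℂ (SpinRel.braid i j)

/-! ### Maps out of the skew-polynomial algebra and the Clifford algebra -/

section lifts

variable {n : ℕ} {A : Type*} [Ring A] [Algebra ℂ A]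

/-- The homomorphism determined by pairwise anticommuting elements. -/
def SkewPoly.lift (e : Fin n → A) (he : ∀ i j, i ≠ j → e i * e j = -(e j * e i)) :
    SkewPoly n →ₐ[ℂ] A :=
  RingQuot.liftAlgHom ℂ ⟨FreeAlgebra.lift ℂ e, by
    rintro _ _ ⟨i, j, h⟩
    simpa using he i j h⟩

@[simp]
theorem SkewPoly.lift_gen (e : Fin n → A) (he : ∀ i j, i ≠ j → e i * e j = -(e j * e i))
    (i : Fin n) : SkewPoly.lift e he (SkewPoly.gen n i) = e i := by
  simp only [SkewPoly.lift, SkewPoly.gen]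
  rw [RingQuot.liftAlgHom_mkAlgHom_apply]
  simp

theorem linearCombination_sq {c : Fin n → A} (hsq : ∀ i, c i * c i = 1)
    (hc : ∀ i j, i ≠ j → c i * c j = -(c j * c i)) (w : Fin n → ℂ) :
    Fintype.linearCombination ℂ c w * Fintype.linearCombination ℂ c w
      = algebraMap ℂ A (stdForm n w) := by
  have key : ∀ i j : Fin n, (w i • c i) * (w j • c j) + (w j • c j) * (w i • c i)
      = if i = j then (2 * (w i * w i)) • (1 : A) else 0 := by
    intro i j
    split_ifs with h
    · subst h
      rw [smul_mul_smul_comm, hsq, ← two_smul ℂ, smul_smul]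
    · rw [smul_mul_smul_comm, smul_mul_smul_comm, hc i j h, mul_comm (w j)]
      simp
  rw [Fintype.linearCombination_apply]
  -- Doubling the square and symmetrizing the double sum turns it into a sum of anticommutators, of
  -- which only the diagonal ones survive. The factor 2 is cancelled at the end.
  have h2 : (2 : ℂ) • ((∑ i, w i • c i) * ∑ i, w i • c i)
      = (2 : ℂ) • algebraMap ℂ A (stdForm n w) := by
    have e1 : (∑ i, w i • c i) * ∑ i, w i • c i = ∑ i, ∑ j, (w i • c i) * (w j • c j) :=
      Finset.sum_mul_sum ..
    have e2 : (∑ i, w i • c i) * ∑ i, w i • c i = ∑ i, ∑ j, (w j • c j) * (w i • c i) := by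
      rw [e1, Finset.sum_comm]
    rw [two_smul]
    nth_rewrite 1 [e1]
    rw [e2, ← Finset.sum_add_distrib]
    simp_rw [← Finset.sum_add_distrib, key]
    simp [stdForm, QuadraticMap.weightedSumSquares_apply, Algebra.algebraMap_eq_smul_one,
      Finset.smul_sum, mul_smul]
  exact smul_right_injective _ (two_ne_zero : (2 : ℂ) ≠ 0) h2

/-- The homomorphism determined by pairwise anticommuting square roots of one. -/
def Cliff.lift (c : Fin n → A) (hsq : ∀ i, c i * c i = 1)
    (hc : ∀ i j, i ≠ j → c i * c j = -(c j * c i)) : Cliff n →ₐ[ℂ] A :=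
  CliffordAlgebra.lift (stdForm n)
    ⟨Fintype.linearCombination ℂ c, linearCombination_sq hsq hc⟩

@[simp]
theorem Cliff.lift_gen (c : Fin n → A) (hsq : ∀ i, c i * c i = 1)
    (hc : ∀ i j, i ≠ j → c i * c j = -(c j * c i)) (i : Fin n) :
    Cliff.lift c hsq hc (Cliff.gen n i) = c i := by
  simp [Cliff.lift, Cliff.gen, Fintype.linearCombination_apply, Pi.single_apply]

end lifts

theorem Cliff.gen_sq {n : ℕ} (i : Fin n) : Cliff.gen n i * Cliff.gen n i = 1 := by
  rw [Cliff.gen, CliffordAlgebra.ι_sq_scalar]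
  have h : stdForm n (Pi.single i 1) = 1 := by
    simp [stdForm, QuadraticMap.weightedSumSquares_apply, Pi.single_apply]
  rw [h, map_one]

theorem Cliff.gen_anticomm {n : ℕ} {i j : Fin n} (h : i ≠ j) :
    Cliff.gen n i * Cliff.gen n j = -(Cliff.gen n j * Cliff.gen n i) := by
  rw [Cliff.gen, Cliff.gen, eq_neg_iff_add_eq_zero, CliffordAlgebra.ι_mul_ι_add_swap]
  have h0 : QuadraticMap.polar (stdForm n) (Pi.single i 1) (Pi.single j 1) = 0 := by
    simp only [QuadraticMap.polar, stdForm, QuadraticMap.weightedSumSquares_apply,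
      ← Finset.sum_sub_distrib]
    refine Finset.sum_eq_zero fun k _ => ?_
    by_cases h1 : k = i <;> by_cases h2 : k = j <;> simp_all
  rw [h0, map_zero]

theorem Cliff.adjoin_gen (n : ℕ) : Algebra.adjoin ℂ (Set.range (Cliff.gen n)) = ⊤ := by
  rw [eq_top_iff, ← CliffordAlgebra.adjoin_range_ι]
  refine Algebra.adjoin_le ?_
  rintro _ ⟨v, rfl⟩
  have hv : v = ∑ i, v i • (Pi.single i 1 : Fin n → ℂ) := by
    ext k
    simp [Pi.single_apply]
  rw [hv, map_sum]
  refine sum_mem fun i _ => ?_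
  rw [map_smul]
  exact Subalgebra.smul_mem _ (Algebra.subset_adjoin (Set.mem_range_self i)) _

theorem Cliff.algHom_ext {n : ℕ} {A : Type*} [Ring A] [Algebra ℂ A] {f g : Cliff n →ₐ[ℂ] A}
    (h : ∀ i, f (Cliff.gen n i) = g (Cliff.gen n i)) : f = g := by
  refine AlgHom.ext_of_adjoin_eq_top (Cliff.adjoin_gen n) ?_
  intro x hx
  obtain ⟨i, rfl⟩ := hx
  exact h i

/-! ### Ordered monomials in anticommuting generators -/

/-- A set of exponents with values in `ℕ` whose parity changes in each step. -/
structure Exponents (X : Type*) [AddCommMonoidWithOne X] where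
  /-- The exponent as a natural number. -/
  val : X → ℕ
  cast_val : ∀ x, (val x : X) = x
  val_zero : val 0 = 0
  sign_add_one : ∀ x, (-1 : ℂ) ^ val (x + 1) = -(-1) ^ val x

/-- Arbitrary natural exponents. -/
def Exponents.nat : Exponents ℕ where
  val := id
  cast_val _ := rfl
  val_zero := rfl
  sign_add_one x := by simp [pow_succ]

/-- Exponents modulo two. -/
def Exponents.zmodTwo : Exponents (ZMod 2) where
  val := ZMod.val
  cast_val x := ZMod.natCast_zmod_val x
  val_zero := rfl
  sign_add_one x := by
    obtain rfl | rfl : x = 0 ∨ x = 1 := by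
      revert x
      decide
    · simp [ZMod.val_one]
    · have h : (1 : ZMod 2) + 1 = 0 := by decide
      simp [h, ZMod.val_one]

namespace Exponents

variable {X : Type*} [AddCommMonoidWithOne X] (E : Exponents X) {n : ℕ}

/-- The sign obtained by moving the `i`-th generator to its place in an ordered monomial. -/
def sign (i : Fin n) (α : Fin n → X) : ℂ := ∏ j, if j < i then (-1) ^ E.val (α j) else 1

theorem sign_mul_self (i : Fin n) (α : Fin n → X) : E.sign i α * E.sign i α = 1 := by
  rw [sign, ← Finset.prod_mul_distrib]
  refine Finset.prod_eq_one fun j _ => ?_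
  split_ifs
  · rw [← mul_pow]
    simp
  · simp

theorem sign_update_of_le {i j : Fin n} (h : i ≤ j) (α : Fin n → X) (x : X) :
    E.sign i (Function.update α j x) = E.sign i α := by
  refine Finset.prod_congr rfl fun k _ => ?_
  split_ifs with hk
  · rw [Function.update_of_ne (hk.trans_le h).ne]
  · rfl

theorem sign_update_of_lt {i j : Fin n} (h : j < i) (α : Fin n → X) :
    E.sign i (Function.update α j (α j + 1)) = -E.sign i α := by
  rw [sign, sign, ← Finset.mul_prod_erase _ _ (Finset.mem_univ j),
    ← Finset.mul_prod_erase _ _ (Finset.mem_univ j), if_pos h, if_pos h, Function.update_self,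
    E.sign_add_one, neg_mul]
  congr 2
  refine Finset.prod_congr rfl fun k hk => ?_
  rw [Function.update_of_ne (Finset.ne_of_mem_erase hk)]

theorem sign_eq_one {i : Fin n} {α : Fin n → X} (h : ∀ j < i, α j = 0) : E.sign i α = 1 := by
  refine Finset.prod_eq_one fun j _ => ?_
  split_ifs with hj
  · rw [h j hj, E.val_zero, pow_zero]
  · rfl

section model

variable {V : Type*} [AddCommGroup V] [Module ℂ V] (b : Module.Basis (Fin n → X) ℂ V)

/-- Left multiplication by the `i`-th generator on ordered monomials. -/
def creation (i : Fin n) : Module.End ℂ V :=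
  b.constr ℂ fun α => E.sign i α • b (Function.update α i (α i + 1))

theorem creation_basis (i : Fin n) (α : Fin n → X) :
    E.creation b i (b α) = E.sign i α • b (Function.update α i (α i + 1)) :=
  b.constr_basis ℂ _ α

/-- The sign at an index depends only on the exponents strictly below it. For `i < j`, raising the
exponent at `i` flips the sign at `j`, while raising the one at `j` does not affect the sign at `i`.
-/
theorem creation_anticomm {i j : Fin n} (h : i ≠ j) :
    E.creation b i * E.creation b j = -(E.creation b j * E.creation b i) := by
  wlog hij : i < j generalizing i j
  · rw [this h.symm (h.lt_or_gt.resolve_left hij), neg_neg]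
  refine b.ext fun α => ?_
  simp only [Module.End.mul_apply, LinearMap.neg_apply, creation_basis, map_smul]
  rw [E.sign_update_of_le hij.le, E.sign_update_of_lt hij, Function.update_of_ne h.symm,
    Function.update_of_ne h, Function.update_comm h, smul_smul, smul_smul, mul_comm,
    ← neg_smul]
  congr 1
  ring

theorem creation_pow_basis (i : Fin n) (α : Fin n → X) (h : ∀ j < i, α j = 0) (k : ℕ) :
    (E.creation b i ^ k) (b α) = b (Function.update α i (α i + k)) := by
  induction k with
  | zero => simp
  | succ k ih =>
    rw [pow_succ', Module.End.mul_apply, ih, creation_basis, E.sign_update_of_le le_rfl,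
      E.sign_eq_one h]
    simp [add_assoc]

end model

variable {A : Type*} [Ring A] [Algebra ℂ A]

/-- The ordered monomial with exponents `α`. -/
def monomial (g : Fin n → A) (α : Fin n → X) : A := (List.ofFn fun i => g i ^ E.val (α i)).prod

section model

variable {V : Type*} [AddCommGroup V] [Module ℂ V] (b : Module.Basis (Fin n → X) ℂ V)

/-- The product acts from the right, hence with the largest index first. Each power then meets a
vector whose lower exponents are all zero, and no sign arises. -/
theorem creation_list_basis (l : List (Fin n)) (hl : l.Pairwise (· < ·)) (α : Fin n → X) :
    (l.map fun i => E.creation b i ^ E.val (α i)).prod (b 0)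
      = b (fun i => if i ∈ l then α i else 0) := by
  induction l with
  | nil =>
    simp
    rfl
  | cons i l ih =>
    rw [List.pairwise_cons] at hl
    have hi : i ∉ l := fun h => lt_irrefl _ (hl.1 i h)
    rw [List.map_cons, List.prod_cons, Module.End.mul_apply, ih hl.2, creation_pow_basis]
    · congr 1
      ext j
      by_cases hj : j = i
      · subst hj
        simp [hi, E.cast_val]
      · simp [hj]
    · intro j hj
      rw [if_neg]
      exact fun h => lt_asymm hj (hl.1 j h)

theorem creation_monomial_basis (α : Fin n → X) :
    E.monomial (E.creation b) α (b 0) = b α := by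
  rw [monomial, List.ofFn_eq_map, creation_list_basis _ _ _ (List.pairwise_lt_finRange n)]
  simp

end model

variable {g : Fin n → A} (hg : ∀ i j, i ≠ j → g i * g j = -(g j * g i))
  (hpow : ∀ i x, g i * g i ^ E.val x = g i ^ E.val (x + 1))

include hg in
theorem gen_mul_pow {i j : Fin n} (h : i ≠ j) (k : ℕ) :
    g i * g j ^ k = (-1 : ℂ) ^ k • (g j ^ k * g i) := by
  induction k with
  | zero => simp
  | succ k ih =>
    rw [pow_succ, ← mul_assoc, ih, smul_mul_assoc, mul_assoc, hg i j h, pow_succ]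
    simp [mul_assoc]

include hg hpow in
-- The generator passes the powers of smaller index, collecting their parities, and merges with its
-- own power by `hpow`; it never reaches the later ones.
theorem gen_mul_list (l : List (Fin n)) (hl : l.Pairwise (· < ·)) (α : Fin n → X) {i : Fin n}
    (hi : i ∈ l) :
    g i * (l.map fun j => g j ^ E.val (α j)).prod
      = (l.map fun j => if j < i then (-1 : ℂ) ^ E.val (α j) else 1).prod •
        (l.map fun j => g j ^ E.val (Function.update α i (α i + 1) j)).prod := by
  induction l with
  | nil => simp at hi
  | cons j l ih =>
    rw [List.pairwise_cons] at hl
    simp only [List.map_cons, List.prod_cons]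
    by_cases hij : i = j
    · subst hij
      have hil : i ∉ l := fun h => lt_irrefl _ (hl.1 i h)
      rw [← mul_assoc, hpow, if_neg (lt_irrefl _), Function.update_self, one_mul]
      have h1 : (l.map fun j => if j < i then (-1 : ℂ) ^ E.val (α j) else 1).prod = 1 := by
        refine List.prod_eq_one fun x hx => ?_
        obtain ⟨k, hk, rfl⟩ := List.mem_map.1 hx
        rw [if_neg (lt_asymm (hl.1 k hk))]
      rw [h1, one_smul]
      congr 2
      refine List.map_congr_left fun k hk => ?_
      rw [Function.update_of_ne]
      rintro rfl
      exact hil hk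
    · have hil : i ∈ l := (List.mem_cons.1 hi).resolve_left hij
      rw [← mul_assoc, gen_mul_pow hg hij, if_pos (hl.1 i hil), smul_mul_assoc, mul_assoc,
        ih hl.2 hil, mul_smul_comm, smul_smul, Function.update_of_ne (Ne.symm hij)]

include hg hpow in
theorem gen_mul_monomial (i : Fin n) (α : Fin n → X) :
    g i * E.monomial g α = E.sign i α • E.monomial g (Function.update α i (α i + 1)) := by
  rw [monomial, monomial, List.ofFn_eq_map, List.ofFn_eq_map,
    E.gen_mul_list hg hpow _ (List.pairwise_lt_finRange n) α (List.mem_finRange i), sign,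
    Fin.prod_univ_def]

omit [Algebra ℂ A] in
theorem monomial_zero : E.monomial g (0 : Fin n → X) = 1 := by
  simp [monomial, E.val_zero]

theorem map_monomial {B : Type*} [Ring B] [Algebra ℂ B] (φ : A →ₐ[ℂ] B) (α : Fin n → X) :
    φ (E.monomial g α) = E.monomial (fun i => φ (g i)) α := by
  rw [monomial, monomial, map_list_prod, List.map_ofFn]
  simp only [Function.comp_def, map_pow]

variable {V : Type*} [AddCommGroup V] [Module ℂ V] (b : Module.Basis (Fin n → X) ℂ V)

/-- The basis of ordered monomials, provided that the algebra acts on the standard model. -/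
def basis (htop : Algebra.adjoin ℂ (Set.range g) = ⊤)
    (φ : A →ₐ[ℂ] Module.End ℂ V) (hφ : ∀ i, φ (g i) = E.creation b i) :
    Module.Basis (Fin n → X) ℂ A :=
  b.map <| LinearEquiv.ofLinearMap
    (b.constr ℂ (E.monomial g))
    ((LinearMap.applyₗ (b 0)).comp φ.toLinearMap)
    (by
      -- The map to ordered monomials intertwines creation with left multiplication. Its composite
      -- with `a ↦ φ a (b 0)` therefore fixes `1` and commutes with left multiplication by the
      -- generators, so it is the identity.
      have key : ∀ i v, b.constr ℂ (E.monomial g) (E.creation b i v)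
          = g i * b.constr ℂ (E.monomial g) v := by
        intro i v
        have h : b.constr ℂ (E.monomial g) ∘ₗ E.creation b i
            = LinearMap.mulLeft ℂ (g i) ∘ₗ b.constr ℂ (E.monomial g) := by
          refine b.ext fun α => ?_
          simp [creation_basis, E.gen_mul_monomial hg hpow]
        exact LinearMap.congr_fun h v
      ext a
      refine mem_of_adjoin_eq_top htop (LinearMap.eqLocus _ LinearMap.id) ?_ ?_ a
      · simp [E.monomial_zero]
      · intro i v hv
        simp only [LinearMap.mem_eqLocus, LinearMap.comp_apply, AlgHom.toLinearMap_apply,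
          LinearMap.applyₗ_apply_apply, LinearMap.id_apply] at hv ⊢
        rw [map_mul, Module.End.mul_apply, hφ, key, hv])
    (by
      refine b.ext fun α => ?_
      have h : φ (E.monomial g α) = E.monomial (E.creation b) α := by
        rw [E.map_monomial φ, funext hφ]
      simp [h, E.creation_monomial_basis])

theorem basis_apply (htop : Algebra.adjoin ℂ (Set.range g) = ⊤)
    (φ : A →ₐ[ℂ] Module.End ℂ V) (hφ : ∀ i, φ (g i) = E.creation b i)
    (α : Fin n → X) : E.basis hg hpow b htop φ hφ α = E.monomial g α := by
  simp [basis]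

end Exponents

/-- The basis of ordered monomials of the skew-polynomial algebra. -/
def SkewPoly.basis (n : ℕ) : Module.Basis (Fin n → ℕ) ℂ (SkewPoly n) :=
  Exponents.nat.basis (g := SkewPoly.gen n) (fun _ _ h => SkewPoly.gen_anticomm h)
    (fun _ _ => (pow_succ' _ _).symm) Finsupp.basisSingleOne (SkewPoly.adjoin_gen n)
    (SkewPoly.lift _ fun _ _ h => Exponents.nat.creation_anticomm _ h)
    (SkewPoly.lift_gen _ _)

theorem SkewPoly.basis_apply (n : ℕ) (α : Fin n → ℕ) :
    SkewPoly.basis n α = (List.ofFn fun i => SkewPoly.gen n i ^ α i).prod :=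
  Exponents.basis_apply ..

theorem Cliff.gen_mul_pow_val {n : ℕ} (i : Fin n) (x : ZMod 2) :
    Cliff.gen n i * Cliff.gen n i ^ x.val = Cliff.gen n i ^ (x + 1).val := by
  obtain rfl | rfl : x = 0 ∨ x = 1 := by
    revert x
    decide
  · simp [ZMod.val_one]
  · have h : (1 : ZMod 2) + 1 = 0 := by decide
    simp [h, ZMod.val_one, Cliff.gen_sq]

theorem creation_zmodTwo_sq {n : ℕ} {V : Type*} [AddCommGroup V] [Module ℂ V]
    (b : Module.Basis (Fin n → ZMod 2) ℂ V) (i : Fin n) :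
    Exponents.zmodTwo.creation b i * Exponents.zmodTwo.creation b i = 1 := by
  refine b.ext fun α => ?_
  simp only [Module.End.mul_apply, Module.End.one_apply, Exponents.creation_basis, map_smul]
  have h : (1 : ZMod 2) + 1 = 0 := by decide
  rw [Exponents.sign_update_of_le _ le_rfl, smul_smul, Exponents.sign_mul_self]
  simp [add_assoc, h]

/-- The basis of ordered monomials of the Clifford algebra. -/
def Cliff.basis (n : ℕ) : Module.Basis (Fin n → ZMod 2) ℂ (Cliff n) :=
  Exponents.zmodTwo.basis (g := Cliff.gen n) (fun _ _ h => Cliff.gen_anticomm h)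
    Cliff.gen_mul_pow_val Finsupp.basisSingleOne (Cliff.adjoin_gen n)
    (Cliff.lift _ (creation_zmodTwo_sq _)
      fun _ _ h => Exponents.zmodTwo.creation_anticomm _ h)
    (Cliff.lift_gen _ _ _)

theorem Cliff.basis_apply (n : ℕ) (ε : Fin n → ZMod 2) :
    Cliff.basis n ε = (List.ofFn fun i => Cliff.gen n i ^ (ε i).val).prod :=
  Exponents.basis_apply ..

/-! ### Words in a sequence of generators -/

section words

variable {A : Type*} [Monoid A] (w : ℕ → A)

theorem upProd_of_lt {i j : ℕ} (h : j < i) : upProd w i j = 1 := by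
  simp [upProd, show j + 1 - i = 0 by omega]

theorem downProd_of_lt {i j : ℕ} (h : i < j) : downProd w i j = 1 := by
  simp [downProd, show i + 1 - j = 0 by omega]

theorem upProd_eq_mul {i j : ℕ} (h : i ≤ j) : upProd w i j = w i * upProd w (i + 1) j := by
  rw [upProd, show j + 1 - i = (j - i) + 1 by omega, List.range'_succ]
  simp [upProd]

theorem downProd_eq_mul {i j : ℕ} (h : j ≤ i) :
    downProd w i j = downProd w i (j + 1) * w j := by
  rw [downProd, show i + 1 - j = (i - j) + 1 by omega, List.range'_succ]
  simp [downProd]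

theorem upProd_succ {i j : ℕ} (h : i ≤ j + 1) : upProd w i (j + 1) = upProd w i j * w (j + 1) := by
  rw [upProd, show j + 1 + 1 - i = (j + 1 - i) + 1 by omega, List.range'_concat]
  simp [upProd, show i + (j + 1 - i) = j + 1 by omega]

theorem downProd_succ {i j : ℕ} (h : j ≤ i + 1) :
    downProd w (i + 1) j = w (i + 1) * downProd w i j := by
  rw [downProd, show i + 1 + 1 - j = (i + 1 - j) + 1 by omega, List.range'_concat]
  simp [downProd, show j + (i + 1 - j) = i + 1 by omega]

theorem map_upProd {B F : Type*} [Monoid B] [FunLike F A B] [MonoidHomClass F A B] (f : F)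
    (i j : ℕ) : f (upProd w i j) = upProd (fun k => f (w k)) i j := by
  simp [upProd, map_list_prod, Function.comp_def]

theorem map_downProd {B F : Type*} [Monoid B] [FunLike F A B] [MonoidHomClass F A B] (f : F)
    (i j : ℕ) : f (downProd w i j) = downProd (fun k => f (w k)) i j := by
  simp [downProd, map_list_prod, Function.comp_def]

/-- The word `t_{j-1} ⋯ t_i ⋯ t_{j-1}`. -/
def linkWord (i j : ℕ) : A := downProd w (j - 1) i * upProd w (i + 1) (j - 1)

/-- The word `t_{j↑n-1} t_{i↑n-2} b t_{n-2↓i} t_{n-1↓j}`. -/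
def pairWord (n : ℕ) (b : A) (i j : ℕ) : A :=
  upProd w j (n - 1) * upProd w i (n - 2) * b * downProd w (n - 2) i * downProd w (n - 1) j

/-- The word `t_{i↑n-1} b t_{n-1↓i}`. -/
def pointWord (n : ℕ) (b : A) (i : ℕ) : A := upProd w i (n - 1) * b * downProd w (n - 1) i

section map

variable {B F : Type*} [Monoid B] [FunLike F A B] [MonoidHomClass F A B] (f : F)

theorem map_linkWord (i j : ℕ) : f (linkWord w i j) = linkWord (fun k => f (w k)) i j := by
  simp only [linkWord, map_mul, map_upProd, map_downProd]

theorem map_pairWord (n : ℕ) (b : A) (i j : ℕ) :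
    f (pairWord w n b i j) = pairWord (fun k => f (w k)) n (f b) i j := by
  simp only [pairWord, map_mul, map_upProd, map_downProd]

theorem map_pointWord (n : ℕ) (b : A) (i : ℕ) :
    f (pointWord w n b i) = pointWord (fun k => f (w k)) n (f b) i := by
  simp only [pointWord, map_mul, map_upProd, map_downProd]

end map

theorem linkWord_base (i : ℕ) : linkWord w i (i + 1) = w i := by
  rw [linkWord, Nat.add_sub_cancel, downProd_eq_mul w le_rfl, downProd_of_lt w (Nat.lt_succ_self i),
    upProd_of_lt w (Nat.lt_succ_self i), one_mul, mul_one]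

theorem linkWord_succ {i j : ℕ} (h : i < j) :
    linkWord w i (j + 1) = w j * linkWord w i j * w j := by
  obtain ⟨j, rfl⟩ : ∃ k, j = k + 1 := ⟨j - 1, by omega⟩
  simp only [linkWord, Nat.add_sub_cancel]
  rw [downProd_succ w (by omega), upProd_succ w (by omega)]
  simp only [mul_assoc]

theorem pairWord_base (n : ℕ) (b : A) (hn : 2 ≤ n) : pairWord w n b (n - 1) n = b := by
  rw [pairWord, upProd_of_lt w (by omega), upProd_of_lt w (by omega), downProd_of_lt w (by omega),
    downProd_of_lt w (by omega)]
  simp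

theorem pairWord_left (n : ℕ) (b : A) {i : ℕ} (h : i + 1 < n) :
    pairWord w n b i n = w i * pairWord w n b (i + 1) n * w i := by
  simp only [pairWord]
  rw [upProd_of_lt w (by omega : n - 1 < n), downProd_of_lt w (by omega : n - 1 < n),
    upProd_eq_mul w (by omega : i ≤ n - 2), downProd_eq_mul w (by omega : i ≤ n - 2)]
  simp only [mul_assoc, one_mul, mul_one]

theorem pairWord_right (n : ℕ) (b : A) (i : ℕ) {j : ℕ} (h : j < n) :
    pairWord w n b i j = w j * pairWord w n b i (j + 1) * w j := by
  simp only [pairWord]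
  rw [upProd_eq_mul w (by omega : j ≤ n - 1), downProd_eq_mul w (by omega : j ≤ n - 1)]
  simp only [mul_assoc]

theorem pointWord_base (n : ℕ) (b : A) (hn : 1 ≤ n) : pointWord w n b n = b := by
  rw [pointWord, upProd_of_lt w (by omega), downProd_of_lt w (by omega), one_mul, mul_one]

theorem pointWord_succ (n : ℕ) (b : A) {i : ℕ} (h : i < n) :
    pointWord w n b i = w i * pointWord w n b (i + 1) * w i := by
  simp only [pointWord]
  rw [upProd_eq_mul w (by omega : i ≤ n - 1), downProd_eq_mul w (by omega : i ≤ n - 1)]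
  simp only [mul_assoc]

end words

/-! ### Conjugation of reflections -/

section conjugation

variable {G : Type*} [Group G]

/-- The braid relation carries `a` across `b * a` as `b`, which passes `x` and is carried back to
`a`. This is the one step in transporting a commutation relation in which neighbouring generators
interact. -/
theorem commute_braid_conj {a b x : G} (h : a * b * a = b * a * b) (hx : Commute b x) :
    Commute a (b * (a * x * a) * b) := by
  have hx' := hx.eq
  calc a * (b * (a * x * a) * b) = (a * b * a) * x * a * b := by group
    _ = b * a * (b * x) * a * b := by rw [h]; group
    _ = b * a * x * (b * a * b) := by rw [hx']; group
    _ = b * (a * x * a) * b * a := by rw [← h]; group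

theorem conj_conj_comm {a b : G} (h : Commute a b) (x : G) :
    a * (b * x * b) * a = b * (a * x * a) * b := by
  calc a * (b * x * b) * a = (a * b) * x * (b * a) := by group
    _ = (b * a) * x * (a * b) := by rw [h.eq]
    _ = b * (a * x * a) * b := by group

theorem commute_conj {a b x : G} (h : Commute a b) (hx : Commute a x) : Commute a (b * x * b) :=
  (h.mul_right hx).mul_right h

/-- Involutions `w 1, …, w (n - 1)` satisfying the braid relations of the symmetric group. -/
structure IsChain (n : ℕ) (w : ℕ → G) : Prop where
  sq : ∀ k, w k * w k = 1
  comm : ∀ k l, 1 ≤ k → k + 1 < l → l < n → Commute (w k) (w l)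
  braid : ∀ k, 1 ≤ k → k + 1 < n → w k * w (k + 1) * w k = w (k + 1) * w k * w (k + 1)

namespace IsChain

variable {n : ℕ} {w : ℕ → G} (hw : IsChain n w)

include hw

theorem comm' {k l : ℕ} (hk : 1 ≤ k) (hl : 1 ≤ l) (hk' : k < n) (hl' : l < n)
    (h : k + 1 < l ∨ l + 1 < k) : Commute (w k) (w l) :=
  h.elim (fun h => hw.comm k l hk h hl') (fun h => (hw.comm l k hl h hk').symm)

theorem conj_eq_iff (k : ℕ) (x y : G) : x = w k * y * w k ↔ w k * x * w k = y := by
  constructor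
  · rintro rfl
    rw [← mul_assoc, ← mul_assoc, hw.sq, one_mul, mul_assoc, hw.sq, mul_one]
  · rintro rfl
    rw [← mul_assoc, ← mul_assoc, hw.sq, one_mul, mul_assoc, hw.sq, mul_one]

theorem mul_eq_of_conj {k : ℕ} {x y : G} (h : x = w k * y * w k) : w k * x = y * w k := by
  rw [h, ← mul_assoc, ← mul_assoc, hw.sq, one_mul]

theorem mul_eq_of_conj' {k : ℕ} {x y : G} (h : x = w k * y * w k) : w k * y = x * w k := by
  rw [h, mul_assoc, mul_assoc, hw.sq, mul_one]

theorem mono {m : ℕ} (h : m ≤ n) : IsChain m w where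
  sq := hw.sq
  comm k l h1 h2 h3 := hw.comm k l h1 h2 (h3.trans_le h)
  braid k h1 h2 := hw.braid k h1 (h2.trans_le h)

/-- A family indexed by points that is transported by the generators. -/
theorem point_commute {x : ℕ → G} (hx : ∀ i, 1 ≤ i → i < n → x i = w i * x (i + 1) * w i)
    (hb : ∀ k, 1 ≤ k → k + 1 < n → Commute (w k) (x n)) (d : ℕ) :
    ∀ i, i + d = n → 1 ≤ i → ∀ k, 1 ≤ k → k < n → (k + 1 < i ∨ i < k) → Commute (w k) (x i) := by
  induction d using Nat.strong_induction_on with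
  | _ d ih =>
    intro i hid hi k hk hkn hki
    obtain rfl | hd := Nat.eq_zero_or_pos d
    · obtain rfl : i = n := by omega
      exact hb k hk (by omega)
    -- Among the admissible `k`, only `i + 1` fails to commute with `w i` for free. It is handled by
    -- transporting twice and using the braid relation.
    · by_cases hk1 : k = i + 1
      · subst hk1
        rw [hx i hi (by omega), hx (i + 1) (by omega) (by omega)]
        exact commute_braid_conj (hw.braid i hi hkn).symm
          (ih (d - 2) (by omega) (i + 2) (by omega) (by omega) i hi (by omega) (by omega))
      · rw [hx i hi (by omega)]
        exact commute_conj (hw.comm' hk hi hkn (by omega) (by omega))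
          (ih (d - 1) (by omega) (i + 1) (by omega) (by omega) k hk hkn (by omega))

end IsChain

/-- A family indexed by pairs `i < j` that is transported by `w 1, …, w (n - 1)`. -/
structure IsPairFamily (n : ℕ) (w : ℕ → G) (x : ℕ → ℕ → G) : Prop where
  left : ∀ i j, 1 ≤ i → i + 1 < j → j ≤ n → x i j = w i * x (i + 1) j * w i
  right : ∀ i j, 1 ≤ i → i < j → j < n → x i j = w j * x i (j + 1) * w j
  comm : ∀ i j k, 1 ≤ i → i < j → j ≤ n → 1 ≤ k → k < n →
    (k + 1 < i ∨ (i < k ∧ k + 1 < j) ∨ j < k ∨ (k = i ∧ j = i + 1)) → Commute (w k) (x i j)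

/-- The symmetric extension of a family indexed by pairs `i < j`. -/
def symPair (x : ℕ → ℕ → G) (i j : ℕ) : G := if i < j then x i j else x j i

omit [Group G] in
theorem symPair_comm (x : ℕ → ℕ → G) {i j : ℕ} (h : i ≠ j) : symPair x i j = symPair x j i := by
  unfold symPair
  split_ifs <;> first | rfl | omega

namespace IsChain

variable {n : ℕ} {w : ℕ → G} (hw : IsChain n w)

include hw

/-- A recipe for `IsPairFamily` from minimal data: transport of the first index is required only for
pairs ending in `n`, and commutation only for the pair `(n - 1, n)`. Descending induction on the
second index spreads both to all pairs. -/
theorem isPairFamily {x : ℕ → ℕ → G}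
    (hl : ∀ i, 1 ≤ i → i + 1 < n → x i n = w i * x (i + 1) n * w i)
    (hr : ∀ i j, 1 ≤ i → i < j → j < n → x i j = w j * x i (j + 1) * w j)
    (hb : ∀ k, 1 ≤ k → (k + 2 < n ∨ k + 1 = n) → Commute (w k) (x (n - 1) n)) :
    IsPairFamily n w x := by
  have key : ∀ d j, j + d = n →
      (∀ i, 1 ≤ i → i + 1 < j → x i j = w i * x (i + 1) j * w i) ∧
      (∀ i k, 1 ≤ i → i < j → 1 ≤ k → k < n →
        (k + 1 < i ∨ (i < k ∧ k + 1 < j) ∨ j < k ∨ (k = i ∧ j = i + 1)) →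
        Commute (w k) (x i j)) := by
    intro d
    induction d using Nat.strong_induction_on with
    | _ d ih =>
      intro j hj
      obtain rfl | hd := Nat.eq_zero_or_pos d
      · obtain rfl : j = n := by omega
        refine ⟨hl, fun i k hi hij hk hkj h => ?_⟩
        by_cases hki : k + 1 = j
        · obtain rfl : i = j - 1 := by omega
          exact hb k hk (Or.inr hki)
        · refine (hw.mono (Nat.sub_le j 1)).point_commute (x := fun i => x i j) ?_ ?_ (j - 1 - i)
            i (by omega) hi k hk (by omega) (by omega)
          · exact fun i h1 h2 => hl i h1 (by omega)
          · exact fun k h1 h2 => hb k h1 (Or.inl (by omega))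
      · have ih1 := ih (d - 1) (by omega) (j + 1) (by omega)
        constructor
        · intro i hi hij
          have hc := hw.comm' (k := j) (l := i) (by omega) hi (by omega) (by omega) (by omega)
          rw [hr i j hi (by omega) (by omega), ih1.1 i hi (by omega),
            hr (i + 1) j (by omega) (by omega) (by omega)]
          exact conj_conj_comm hc _
        · intro i k hi hij hk hkn h
          rw [hr i j hi hij (by omega)]
          -- The neighbour just above `j`: two transports of the second index and the braid relation
          -- of `w j` and `w (j + 1)`.
          by_cases h1 : k = j + 1
          · subst h1
            rw [hr i (j + 1) hi (by omega) hkn]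
            exact commute_braid_conj (hw.braid j (by omega) hkn).symm
              ((ih (d - 2) (by omega) (j + 2) (by omega)).2 i j hi (by omega) (by omega)
                (by omega) (by omega))
          -- Both indices of the adjacent pair are moved by `w k`. The pair is transported to `(k +
          -- 1, k + 2)`, where the inductive statement concerns `w (k + 1)`, and the braid relation
          -- brings it back.
          by_cases h2 : k = i ∧ j = i + 1
          · obtain ⟨rfl, rfl⟩ := h2
            rw [ih1.1 k hi (by omega)]
            exact commute_braid_conj (hw.braid k (by omega) (by omega))
              (ih1.2 (k + 1) (k + 1) (by omega) (by omega) (by omega) (by omega) (by omega))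
          · exact commute_conj (hw.comm' hk (by omega) hkn (by omega) (by omega))
              (ih1.2 i k hi (by omega) hk hkn (by omega))
  exact ⟨fun i j h1 h2 h3 => (key (n - j) j (by omega)).1 i h1 h2, hr,
    fun i j k h1 h2 h3 h4 h5 h6 => (key (n - j) j (by omega)).2 i k h1 h2 h4 h5 h6⟩

theorem symPair_equivariant {x : ℕ → ℕ → G} (hx : IsPairFamily n w x) {k i j : ℕ} (hk : 1 ≤ k)
    (hkn : k < n) (hi : 1 ≤ i) (hin : i ≤ n) (hj : 1 ≤ j) (hjn : j ≤ n) (hij : i ≠ j) :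
    w k * symPair x i j
      = symPair x (Equiv.swap k (k + 1) i) (Equiv.swap k (k + 1) j) * w k := by
  wlog h : i < j generalizing i j
  · rw [symPair_comm x hij, this hj hjn hi hin hij.symm (by omega), symPair_comm x]
    exact fun h => hij ((Equiv.swap k (k + 1)).injective h.symm)
  rw [symPair, if_pos h]
  by_cases h1 : k + 1 = i
  · subst h1
    rw [Equiv.swap_apply_right, Equiv.swap_apply_of_ne_of_ne (by omega) (by omega), symPair,
      if_pos (by omega)]
    exact hw.mul_eq_of_conj' (hx.left k j hk h hjn)
  by_cases h2 : k = i
  · subst h2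
    by_cases h3 : j = k + 1
    · subst h3
      rw [Equiv.swap_apply_right, Equiv.swap_apply_left, symPair, if_neg (by omega)]
      exact (hx.comm k (k + 1) k hk h hjn hk hkn (by omega)).eq
    · rw [Equiv.swap_apply_left, Equiv.swap_apply_of_ne_of_ne (by omega) (by omega), symPair,
        if_pos (by omega)]
      exact hw.mul_eq_of_conj (hx.left k j hk (by omega) hjn)
  rw [Equiv.swap_apply_of_ne_of_ne (a := k) (x := i) (by omega) (by omega)]
  by_cases h3 : k + 1 = j
  · subst h3
    rw [Equiv.swap_apply_right, symPair, if_pos (by omega)]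
    exact hw.mul_eq_of_conj' (hx.right i k hi (by omega) hkn)
  by_cases h4 : k = j
  · subst h4
    rw [Equiv.swap_apply_left, symPair, if_pos (by omega)]
    exact hw.mul_eq_of_conj (hx.right i k hi (by omega) hkn)
  rw [Equiv.swap_apply_of_ne_of_ne (by omega) (by omega), symPair, if_pos h]
  exact (hx.comm i j k hi h hjn hk hkn (by omega)).eq

theorem point_equivariant {x : ℕ → G} (hx : ∀ i, 1 ≤ i → i < n → x i = w i * x (i + 1) * w i)
    (hb : ∀ k, 1 ≤ k → k + 1 < n → Commute (w k) (x n)) {k i : ℕ} (hk : 1 ≤ k)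
    (hkn : k < n) (hi : 1 ≤ i) (hin : i ≤ n) :
    w k * x i = x (Equiv.swap k (k + 1) i) * w k := by
  by_cases h1 : k + 1 = i
  · subst h1
    rw [Equiv.swap_apply_right]
    exact hw.mul_eq_of_conj' (hx k hk hkn)
  by_cases h2 : k = i
  · subst h2
    rw [Equiv.swap_apply_left]
    exact hw.mul_eq_of_conj (hx k hk hkn)
  rw [Equiv.swap_apply_of_ne_of_ne (by omega) (by omega)]
  exact (hw.point_commute hx hb (n - i) i (by omega) hi k hk hkn (by omega)).eq

/-- The word is built by moving its larger index only. The braid relation at the shortest word shows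
that the smaller index can be moved equally well. -/
theorem linkWord_left {i j : ℕ} (hi : 1 ≤ i) (hij : i + 1 < j) (hj : j ≤ n) :
    linkWord w i j = w i * linkWord w (i + 1) j * w i := by
  induction j, (show i + 2 ≤ j by omega) using Nat.le_induction with
  | base =>
    rw [linkWord_succ w (by omega), linkWord_base, linkWord_base, hw.braid i hi (by omega)]
  | succ j hij ih =>
    have hc := hw.comm' (k := j) (l := i) (by omega) hi (by omega) (by omega) (by omega)
    rw [linkWord_succ w (by omega), linkWord_succ w (by omega), ih (by omega) (by omega)]
    exact conj_conj_comm hc _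

theorem isPairFamily_linkWord : IsPairFamily n w (linkWord w) := by
  refine hw.isPairFamily (fun i h1 h2 => hw.linkWord_left h1 h2 le_rfl) ?_ ?_
  · intro i j h1 h2 h3
    rw [hw.conj_eq_iff, linkWord_succ w h2]
  · intro k hk h
    obtain ⟨m, rfl⟩ : ∃ m, n = m + 1 := ⟨n - 1, by omega⟩
    rw [Nat.add_sub_cancel, linkWord_base]
    obtain h | h := h
    · exact hw.comm' hk (by omega) (by omega) (by omega) (by omega)
    · obtain rfl : k = m := by omega
      exact Commute.refl _

theorem isPairFamily_pairWord {b : G}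
    (hb : ∀ k, 1 ≤ k → (k + 2 < n ∨ k + 1 = n) → Commute (w k) b) :
    IsPairFamily n w (pairWord w n b) := by
  refine hw.isPairFamily (fun i h1 h2 => pairWord_left w n b h2)
    (fun i j h1 h2 h3 => pairWord_right w n b i h3) ?_
  intro k hk h
  rw [pairWord_base w n b (by omega)]
  exact hb k hk h

end IsChain

theorem commute_linkWord {w : ℕ → G} {z : G} {i j : ℕ} (hij : i < j)
    (h : ∀ k, i ≤ k → k < j → Commute z (w k)) : Commute z (linkWord w i j) := by
  induction j, (show i + 1 ≤ j by omega) using Nat.le_induction with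
  | base =>
    rw [linkWord_base]
    exact h i le_rfl (by omega)
  | succ j hij ih =>
    rw [linkWord_succ w (by omega)]
    exact commute_conj (h j (by omega) (by omega)) (ih (by omega) fun k h1 h2 => h k h1 (by omega))

/-! ### The last reflection in types `B` and `D` -/

theorem mul_eq_of_conj_of_sq {a x y : G} (ha : a * a = 1) (h : y = a * x * a) :
    a * x = y * a ∧ a * y = x * a := by
  subst h
  constructor
  · rw [mul_assoc, mul_assoc, ha, mul_one]
  · rw [← mul_assoc, ← mul_assoc, ha, one_mul]

section typeB

variable {n : ℕ} {w : ℕ → G} (hw : IsChain n w)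
  (hcomm : ∀ k, 1 ≤ k → k + 1 < n → Commute (w n) (w k))
  (hbraid : 2 ≤ n → w n * w (n - 1) * w n * w (n - 1) = w (n - 1) * w n * w (n - 1) * w n)

include hw hcomm hbraid

/-- For `k = n - 1` this is the relation of order four rewritten; the remaining `w k` commute with
each letter. -/
theorem typeB_commute_base (k : ℕ) (hk : 1 ≤ k) (h : k + 2 < n ∨ k + 1 = n) :
    Commute (w k) (w n * w (n - 1) * w n) := by
  obtain h | h := h
  · exact commute_conj (hcomm k hk (by omega)).symm
      (hw.comm' hk (by omega) (by omega) (by omega) (by omega))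
  · obtain rfl : k = n - 1 := by omega
    have := hbraid (by omega)
    simp only [Commute, SemiconjBy, mul_assoc] at this ⊢
    exact this.symm

theorem typeB_commute_point (d i : ℕ) (hid : i + d = n) (hi : 1 ≤ i) :
    Commute (w n) (pointWord w n (w n) i) := by
  induction d generalizing i with
  | zero =>
    obtain rfl : i = n := by omega
    rw [pointWord_base w i _ hi]
  | succ d ih =>
    rw [pointWord_succ w n _ (by omega)]
    obtain rfl | hd := Nat.eq_zero_or_pos d
    · obtain rfl : n = i + 1 := by omega
      rw [pointWord_base _ _ _ (by omega)]
      have := hbraid (by omega)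
      simp only [Nat.add_sub_cancel, Commute, SemiconjBy, mul_assoc] at this ⊢
      exact this
    · exact commute_conj (hcomm i hi (by omega)) (ih (i + 1) (by omega) (by omega))

/-- The sign change at `n` carries the root `e_i - e_n` to `e_i + e_n`. -/
theorem typeB_conj_link (i : ℕ) (hi : 1 ≤ i) (hin : i < n) :
    pairWord w n (w n * w (n - 1) * w n) i n = w n * linkWord w i n * w n := by
  obtain ⟨d, hd⟩ : ∃ d, i + d + 1 = n := ⟨n - 1 - i, by omega⟩
  induction d generalizing i with
  | zero =>
    obtain rfl : n = i + 1 := by omega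
    have := pairWord_base w (i + 1) (w (i + 1) * w (i + 1 - 1) * w (i + 1)) (by omega)
    rw [linkWord_base]
    simpa using this
  | succ d ih =>
    have hc := hcomm i hi (by omega)
    rw [pairWord_left w n _ (by omega), ih (i + 1) (by omega) (by omega) (by omega),
      hw.linkWord_left hi (by omega) le_rfl]
    exact conj_conj_comm hc.symm _

theorem typeB_commute_pair (d i j : ℕ) (hjd : j + d + 1 = n) (hi : 1 ≤ i) (hij : i < j) :
    Commute (w n) (pairWord w n (w n * w (n - 1) * w n) i j) := by
  induction d generalizing j with
  | zero =>
    obtain rfl : n = j + 1 := by omega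
    rw [pairWord_right w _ _ _ (by omega), typeB_conj_link hw hcomm hbraid i hi (by omega),
      linkWord_succ w hij]
    -- The word is now `g * linkWord w i j * g` with `g = w j * w (j + 1) * w j`. Both factors
    -- commute with `w (j + 1)`: the first by disjointness, the second by the relation of order
    -- four.
    have h1 : Commute (w (j + 1)) (linkWord w i j) :=
      commute_linkWord hij fun k h1 h2 => hcomm k (by omega) (by omega)
    have h2 : Commute (w (j + 1)) (w j * w (j + 1) * w j) := by
      have := hbraid (by omega)
      simp only [Nat.add_sub_cancel, Commute, SemiconjBy, mul_assoc] at this ⊢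
      exact this
    have h3 := (h2.mul_right h1).mul_right h2
    simpa only [mul_assoc] using h3
  | succ d ih =>
    rw [pairWord_right w _ _ _ (by omega)]
    exact commute_conj (hcomm j (by omega) (by omega)) (ih (j + 1) (by omega) (by omega))

/-- Conjugation by the last reflection either fixes the reflections in `e_i - e_j` and `e_i + e_j`
or exchanges them, according to whether `j = n`. Only their sum matters later, so the disjunction
suffices. -/
theorem typeB_last {i j : ℕ} (hi : 1 ≤ i) (hij : i < j) (hj : j ≤ n) :
    (w n * linkWord w i j = linkWord w i j * w n ∧
      w n * pairWord w n (w n * w (n - 1) * w n) i j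
        = pairWord w n (w n * w (n - 1) * w n) i j * w n) ∨
    (w n * linkWord w i j = pairWord w n (w n * w (n - 1) * w n) i j * w n ∧
      w n * pairWord w n (w n * w (n - 1) * w n) i j = linkWord w i j * w n) := by
  obtain rfl | hjn := eq_or_lt_of_le hj
  · exact Or.inr (mul_eq_of_conj_of_sq (hw.sq j) (typeB_conj_link hw hcomm hbraid i hi hij))
  · exact Or.inl ⟨(commute_linkWord hij fun k h1 h2 => hcomm k (by omega) (by omega)).eq,
      (typeB_commute_pair hw hcomm hbraid (n - 1 - j) i j (by omega) hi hij).eq⟩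

end typeB

section typeD

variable {n : ℕ} {w : ℕ → G} (hw : IsChain n w) (hn : 2 ≤ n)
  (hcomm : ∀ k, 1 ≤ k → (k + 2 < n ∨ k + 1 = n) → Commute (w n) (w k))
  (hbraid : 3 ≤ n → w n * w (n - 2) * w n = w (n - 2) * w n * w (n - 2))

include hw hcomm hbraid

/-- The reflection in `e_{n-1} + e_n` carries `e_i - e_{n-1}` to `e_i + e_n`. The base case is the
braid relation between the last node and its neighbour `n - 2`. -/
theorem typeD_conj_link (d i : ℕ) (hi : 1 ≤ i) (hd : i + d + 2 = n) :
    pairWord w n (w n) i n = w n * linkWord w i (n - 1) * w n := by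
  induction d generalizing i with
  | zero =>
    obtain rfl : n = i + 2 := by omega
    have hb := pairWord_base w (i + 2) (w (i + 2)) (by omega)
    have := hbraid (by omega)
    simp only [Nat.add_sub_cancel, show i + 2 - 1 = i + 1 by omega] at this hb ⊢
    rw [pairWord_left w _ _ (by omega), linkWord_base, hb, this]
  | succ d ih =>
    have hc := hcomm i hi (by omega)
    rw [pairWord_left w n _ (by omega), ih (i + 1) (by omega) (by omega),
      hw.linkWord_left (j := n - 1) hi (by omega) (by omega)]
    exact conj_conj_comm hc.symm _

/-- The companion case: `e_i - e_n` goes to `e_i + e_{n-1}`. It follows from the previous one by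
conjugating with `w (n - 1)`, which commutes with `w n`. -/
theorem typeD_conj_link' (i : ℕ) (hi : 1 ≤ i) (hd : i + 1 < n) :
    pairWord w n (w n) i (n - 1) = w n * linkWord w i n * w n := by
  obtain ⟨m, rfl⟩ : ∃ m, n = m + 1 := ⟨n - 1, by omega⟩
  have hc := hcomm m (by omega) (by omega)
  have h := typeD_conj_link hw hcomm hbraid (m - 1 - i) i hi (by omega)
  simp only [Nat.add_sub_cancel] at h ⊢
  rw [pairWord_right w _ _ _ (by omega), h, linkWord_succ w (by omega)]
  exact conj_conj_comm hc.symm _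

theorem typeD_commute_pair (d i j : ℕ) (hjd : j + d + 2 = n) (hi : 1 ≤ i) (hij : i < j) :
    Commute (w n) (pairWord w n (w n) i j) := by
  induction d generalizing j with
  | zero =>
    obtain rfl : n = j + 2 := by omega
    have h := typeD_conj_link' hw hcomm hbraid i hi (by omega)
    simp only [show j + 2 - 1 = j + 1 by omega] at h
    rw [pairWord_right w _ _ _ (by omega), h]
    refine commute_braid_conj (by simpa using hbraid (by omega)) ?_
    exact hw.isPairFamily_linkWord.comm i (j + 2) j hi (by omega) (by omega) (by omega) (by omega)
      (by omega)
  | succ d ih =>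
    rw [pairWord_right w _ _ _ (by omega)]
    exact commute_conj (hcomm j (by omega) (by omega)) (ih (j + 1) (by omega) (by omega))

include hn in
-- The last reflection permutes positions by the transposition of `n - 1` and `n`. The difference
-- and sum reflections keep their kind when both or neither index is among these two positions, and
-- change it when exactly one is.
theorem typeD_last {i j : ℕ} (hi : 1 ≤ i) (hij : i < j) (hj : j ≤ n) :
    (w n * linkWord w i j
        = symPair (linkWord w) (Equiv.swap (n - 1) n i) (Equiv.swap (n - 1) n j) * w n ∧
      w n * pairWord w n (w n) i j
        = symPair (pairWord w n (w n)) (Equiv.swap (n - 1) n i) (Equiv.swap (n - 1) n j) * w n) ∨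
    (w n * linkWord w i j
        = symPair (pairWord w n (w n)) (Equiv.swap (n - 1) n i) (Equiv.swap (n - 1) n j) * w n ∧
      w n * pairWord w n (w n) i j
        = symPair (linkWord w) (Equiv.swap (n - 1) n i) (Equiv.swap (n - 1) n j) * w n) := by
  by_cases h1 : j + 1 < n
  · left
    rw [Equiv.swap_apply_of_ne_of_ne (by omega) (by omega),
      Equiv.swap_apply_of_ne_of_ne (by omega) (by omega), symPair, symPair, if_pos hij, if_pos hij]
    exact ⟨(commute_linkWord hij fun k h1 h2 => hcomm k (by omega) (by omega)).eq,
      (typeD_commute_pair hw hcomm hbraid (n - 2 - j) i j (by omega) hi hij).eq⟩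
  by_cases h2 : i + 1 = n
  · left
    obtain rfl : j = n := by omega
    obtain rfl : i = j - 1 := by omega
    rw [Equiv.swap_apply_left, Equiv.swap_apply_right, symPair, symPair, if_neg (by omega),
      if_neg (by omega), pairWord_base w _ _ hn]
    refine ⟨?_, rfl⟩
    obtain ⟨m, rfl⟩ : ∃ m, j = m + 1 := ⟨j - 1, by omega⟩
    rw [Nat.add_sub_cancel, linkWord_base]
    exact (hcomm m (by omega) (by omega)).eq
  right
  rw [Equiv.swap_apply_of_ne_of_ne (x := i) (by omega) (by omega)]
  by_cases h3 : j = n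
  · subst h3
    rw [Equiv.swap_apply_right, symPair, symPair, if_pos (by omega), if_pos (by omega)]
    refine ⟨(mul_eq_of_conj_of_sq (hw.sq j)
      (typeD_conj_link' hw hcomm hbraid i hi (by omega))).1, (mul_eq_of_conj_of_sq (hw.sq j)
      (typeD_conj_link hw hcomm hbraid (j - 2 - i) i hi (by omega))).2⟩
  · obtain rfl : j = n - 1 := by omega
    rw [Equiv.swap_apply_left, symPair, symPair, if_pos (by omega), if_pos (by omega)]
    refine ⟨(mul_eq_of_conj_of_sq (hw.sq n)
      (typeD_conj_link hw hcomm hbraid (n - 2 - i) i hi (by omega))).1,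
      (mul_eq_of_conj_of_sq (hw.sq n) (typeD_conj_link' hw hcomm hbraid i hi (by omega))).2⟩

end typeD

end conjugation

/-! ### Anticommutators -/

section anti

variable {A : Type*} [Ring A]

/-- The anticommutator. -/
def anti (x y : A) : A := x * y + y * x

theorem anti_add_left (x y z : A) : anti (x + y) z = anti x z + anti y z := by
  simp only [anti, add_mul, mul_add]
  abel

theorem anti_add_right (x y z : A) : anti x (y + z) = anti x y + anti x z := by
  simp only [anti, add_mul, mul_add]
  abel

theorem anti_sub_left (x y z : A) : anti (x - y) z = anti x z - anti y z := by
  simp only [anti, sub_mul, mul_sub]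
  abel

theorem anti_sub_right (x y z : A) : anti x (y - z) = anti x y - anti x z := by
  simp only [anti, sub_mul, mul_sub]
  abel

variable [Algebra ℂ A]

theorem anti_smul_left (a : ℂ) (x y : A) : anti (a • x) y = a • anti x y := by
  simp [anti]

theorem anti_smul_right (a : ℂ) (x y : A) : anti x (a • y) = a • anti x y := by
  simp [anti]

variable {p q : A} {s : ℂ}

theorem mul_eq_of_anti (h : anti p q = s • 1) : p * q = s • 1 - q * p := by
  rw [← h, anti, add_sub_cancel_right]

/-- In Clifford terms, conjugation of a vector by a unit vector `p` is minus the reflection in `p`.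
This minus sign is the one in the relation between `t k` and `c j`. -/
theorem conj_of_anti (hp : p * p = 1) (h : anti p q = s • 1) : p * q * p = s • p - q := by
  rw [mul_eq_of_anti h, sub_mul, mul_assoc, hp, smul_mul_assoc, one_mul, mul_one]

/-- So `p * q` is a root of `X ^ 2 - s * X + 1`, and its powers depend on `s` alone. The values `0`,
`-1` and `s ^ 2 = 2` correspond to Coxeter exponents 2, 3 and 4. -/
theorem mul_sq_of_anti (hp : p * p = 1) (hq : q * q = 1) (h : anti p q = s • 1) :
    (p * q) ^ 2 = s • (p * q) - 1 := by
  rw [pow_two, ← mul_assoc, conj_of_anti hp h, sub_mul, hq, smul_mul_assoc]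

theorem mul_pow_two_of_anti (hp : p * p = 1) (hq : q * q = 1) (h : anti p q = 0) :
    (p * q) ^ 2 = (-1) ^ 3 := by
  rw [mul_sq_of_anti hp hq (s := 0) (by simpa using h)]
  norm_num

theorem mul_pow_three_of_anti (hp : p * p = 1) (hq : q * q = 1) (h : anti p q = (-1 : ℂ) • 1) :
    (p * q) ^ 3 = (-1) ^ 4 := by
  have h2 := mul_sq_of_anti hp hq h
  rw [pow_succ, h2, sub_mul, smul_mul_assoc, ← pow_two, h2, Even.neg_one_pow (by decide)]
  simp

theorem mul_pow_four_of_anti (hp : p * p = 1) (hq : q * q = 1) (h : anti p q = s • 1)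
    (hs : s * s = 2) : (p * q) ^ 4 = (-1) ^ 5 := by
  have h2 := mul_sq_of_anti hp hq h
  have h4 : (p * q) ^ 4 = (p * q) ^ 2 * (p * q) ^ 2 := by rw [← pow_add]
  rw [h4]
  nth_rewrite 1 [h2]
  rw [sub_mul, smul_mul_assoc, ← pow_succ', pow_succ, h2, sub_mul, smul_mul_assoc, ← pow_two, h2]
  simp only [smul_sub, smul_smul, one_mul, hs]
  have h5 : (2 : ℂ) • s • (p * q) = s • (p * q) + s • (p * q) := two_smul ℂ _
  rw [mul_comm, ← smul_smul] at *
  norm_num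
  module

end anti

/-! ### The roots in the Clifford algebra -/

/-- The scalar `1 / √2`. -/
def invSqrtTwo : ℂ := ((Real.sqrt 2)⁻¹ : ℝ)

theorem invSqrtTwo_mul_self : invSqrtTwo * invSqrtTwo = 1 / 2 := by
  rw [invSqrtTwo, ← Complex.ofReal_mul, ← mul_inv, Real.mul_self_sqrt (by norm_num)]
  norm_num

namespace Cliff

variable {ty : ClassicalType} {n : ℕ}

theorem label_succ {A : Type*} [One A] {r : ℕ} (f : Fin r → A) (i : Fin r) :
    label f (i + 1) = f i := by
  rw [label, dif_pos ⟨by omega, by omega⟩]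
  congr 1

variable (n) in
/-- The generators with labels `1, …, n`. -/
abbrev lgen (i : ℕ) : Cliff n := label (gen n) i

theorem anti_lgen {i j : ℕ} (hi : 1 ≤ i) (hin : i ≤ n) (hj : 1 ≤ j) (hjn : j ≤ n) :
    anti (lgen n i) (lgen n j) = (if i = j then 2 else 0 : ℂ) • 1 := by
  rw [lgen, label, dif_pos ⟨hi, hin⟩, lgen, label, dif_pos ⟨hj, hjn⟩, anti]
  split_ifs with h
  · subst h
    rw [gen_sq, two_smul]
  · rw [gen_anticomm, zero_smul, neg_add_cancel]
    intro h'
    rw [Fin.mk.injEq] at h'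
    omega

variable (ty n) in
/-- The normalized simple roots in the Clifford algebra (and `1` for other labels). -/
def root (k : ℕ) : Cliff n :=
  if 1 ≤ k ∧ k < n then invSqrtTwo • (lgen n k - lgen n (k + 1))
  else if k = n then
    match ty with
    | .A => 1
    | .B => lgen n n
    | .D => invSqrtTwo • (lgen n (n - 1) + lgen n n)
  else 1

theorem root_of_lt {k : ℕ} (hk : 1 ≤ k) (hkn : k < n) :
    root ty n k = invSqrtTwo • (lgen n k - lgen n (k + 1)) := if_pos ⟨hk, hkn⟩

theorem root_typeB : root .B n n = lgen n n := by
  rw [root, if_neg (by omega), if_pos rfl]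

theorem root_typeD : root .D n n = invSqrtTwo • (lgen n (n - 1) + lgen n n) := by
  rw [root, if_neg (by omega), if_pos rfl]

theorem anti_root_lgen {k j : ℕ} (hk : 1 ≤ k) (hkn : k < n) (hj : 1 ≤ j) (hjn : j ≤ n) :
    anti (root ty n k) (lgen n j)
      = (invSqrtTwo * ((if k = j then 2 else 0) - (if k + 1 = j then 2 else 0))) • 1 := by
  rw [root_of_lt hk hkn, anti_smul_left, anti_sub_left, anti_lgen hk hkn.le hj hjn,
    anti_lgen (by omega) hkn hj hjn, ← sub_smul, smul_smul]

theorem anti_root_lgen_typeD {j : ℕ} (hn : 2 ≤ n) (hj : 1 ≤ j) (hjn : j ≤ n) :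
    anti (root .D n n) (lgen n j)
      = (invSqrtTwo * ((if n - 1 = j then 2 else 0) + (if n = j then 2 else 0))) • 1 := by
  rw [root_typeD, anti_smul_left, anti_add_left, anti_lgen (by omega) (by omega) hj hjn,
    anti_lgen (by omega) le_rfl hj hjn, ← add_smul, smul_smul]

theorem mul_self_of_anti {x : Cliff n} (h : anti x x = (2 : ℂ) • 1) : x * x = 1 := by
  rw [anti, ← two_smul ℂ] at h
  exact smul_right_injective _ (two_ne_zero : (2 : ℂ) ≠ 0) h

theorem lgen_sq {i : ℕ} (hi : 1 ≤ i) (hin : i ≤ n) : lgen n i * lgen n i = 1 :=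
  mul_self_of_anti (by rw [anti_lgen hi hin hi hin, if_pos rfl])

theorem root_sq_of_lt {k : ℕ} (hk : 1 ≤ k) (hkn : k < n) : root ty n k * root ty n k = 1 := by
  apply mul_self_of_anti
  nth_rewrite 2 [root_of_lt hk hkn]
  rw [anti_smul_right, anti_sub_right, anti_root_lgen hk hkn hk hkn.le,
    anti_root_lgen hk hkn (by omega) hkn, ← sub_smul, smul_smul]
  congr 1
  simp
  linear_combination 4 * invSqrtTwo_mul_self

theorem root_sq_typeD (hn : 2 ≤ n) : root .D n n * root .D n n = 1 := by
  apply mul_self_of_anti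
  nth_rewrite 2 [root_typeD]
  rw [anti_smul_right, anti_add_right, anti_root_lgen_typeD hn (by omega) (by omega),
    anti_root_lgen_typeD hn (by omega) le_rfl, ← add_smul, smul_smul]
  congr 1
  simp [show ¬ n = n - 1 by omega, show ¬ n - 1 = n by omega]
  linear_combination 4 * invSqrtTwo_mul_self

theorem root_sq (hD : ty = .D → 2 ≤ n) {k : ℕ} (hk : 1 ≤ k) (hkr : k ≤ rank ty n) :
    root ty n k * root ty n k = 1 := by
  by_cases hkn : k < n
  · exact root_sq_of_lt hk hkn
  · cases ty with
    | A =>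
      simp only [rank] at hkr
      omega
    | B =>
      obtain rfl : k = n := le_antisymm hkr (by omega)
      rw [root_typeB, lgen_sq hk le_rfl]
    | D =>
      obtain rfl : k = n := le_antisymm hkr (by omega)
      exact root_sq_typeD (hD rfl)

theorem anti_root_root {k l : ℕ} (hk : 1 ≤ k) (hkl : k < l) (hln : l < n) :
    anti (root ty n k) (root ty n l) = (if k + 1 = l then -1 else 0 : ℂ) • 1 := by
  rw [root_of_lt (k := l) (by omega) hln]
  rw [anti_smul_right, anti_sub_right, anti_root_lgen hk (by omega) (by omega) hln.le,
    anti_root_lgen hk (by omega) (by omega) hln, ← sub_smul, smul_smul]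
  congr 1
  rw [if_neg (by omega : ¬ k = l), if_neg (by omega : ¬ k = l + 1),
    if_neg (by omega : ¬ k + 1 = l + 1)]
  split_ifs
  · linear_combination (-2) * invSqrtTwo_mul_self
  · ring

theorem anti_root_typeB {k : ℕ} (hk : 1 ≤ k) (hkn : k < n) :
    anti (root .B n k) (root .B n n) = (if k + 1 = n then -2 * invSqrtTwo else 0 : ℂ) • 1 := by
  rw [root_typeB, anti_root_lgen hk hkn (by omega) le_rfl, if_neg (by omega : ¬ k = n)]
  congr 1
  split_ifs <;> ring

theorem anti_root_typeD {k : ℕ} (hk : 1 ≤ k) (hkn : k < n) :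
    anti (root .D n k) (root .D n n) = (if k + 2 = n then -1 else 0 : ℂ) • 1 := by
  rw [root_typeD]
  rw [anti_smul_right, anti_add_right, anti_root_lgen hk hkn (by omega) (by omega),
    anti_root_lgen hk hkn (by omega) le_rfl, ← add_smul, smul_smul]
  congr 1
  rw [if_neg (by omega : ¬ k = n)]
  by_cases h1 : k + 2 = n
  · rw [if_neg (by omega), if_pos (by omega), if_neg (by omega), if_pos h1]
    linear_combination (-2) * invSqrtTwo_mul_self
  · by_cases h2 : k + 1 = n
    · rw [if_pos (by omega), if_neg (by omega), if_pos h2, if_neg h1]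
      ring
    · rw [if_neg (by omega), if_neg (by omega), if_neg h2, if_neg h1]
      ring

theorem coxeterExp_comm (i j : ℕ) : coxeterExp ty n i j = coxeterExp ty n j i := by
  cases ty <;> simp only [coxeterExp, eq_comm, or_comm]

/-- The simple roots satisfy the spin relations. -/
theorem root_rel (hD : ty = .D → 2 ≤ n) {i j : ℕ} (hi : 1 ≤ i) (hir : i ≤ rank ty n)
    (hj : 1 ≤ j) (hjr : j ≤ rank ty n) :
    (root ty n i * root ty n j) ^ coxeterExp ty n i j = (-1) ^ (coxeterExp ty n i j + 1) := by
  have hsi := root_sq hD hi hir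
  have hsj := root_sq hD hj hjr
  by_cases hij : i = j
  · subst hij
    simp [hsi, coxeterExp]
  wlog hlt : i < j generalizing i j
  -- The products in the two orders are mutually inverse, and a sign is its own inverse, so the
  -- relation for `(j, i)` gives the one for `(i, j)`.
  · have h := this hj hjr hi hir hsj hsi (Ne.symm hij) (by omega)
    rw [coxeterExp_comm] at h
    have h1 : (root ty n i * root ty n j) * (root ty n j * root ty n i) = 1 := by
      rw [mul_assoc, ← mul_assoc (root ty n j), hsj, one_mul, hsi]
    have h2 : (root ty n j * root ty n i) * (root ty n i * root ty n j) = 1 := by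
      rw [mul_assoc, ← mul_assoc (root ty n i), hsi, one_mul, hsj]
    have h3 := (Commute.mul_pow (h1.trans h2.symm) (coxeterExp ty n i j)).symm
    rw [h1, one_pow, h] at h3
    have h4 : ((-1 : Cliff n) ^ (coxeterExp ty n i j + 1)) * (-1) ^ (coxeterExp ty n i j + 1) = 1 := by
      rw [← pow_add, Even.neg_one_pow ⟨_, rfl⟩]
    have h5 := congrArg (· * (-1 : Cliff n) ^ (coxeterExp ty n i j + 1)) h3
    simpa only [mul_assoc, h4, mul_one, one_mul] using h5
  by_cases hjn : j < n
  · have ha := anti_root_root (ty := ty) hi hlt hjn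
    by_cases hadj : i + 1 = j
    · have hm : coxeterExp ty n i j = 3 := by
        cases ty <;> simp only [coxeterExp] <;> split_ifs <;> omega
      rw [if_pos hadj] at ha
      rw [hm]
      exact mul_pow_three_of_anti hsi hsj ha
    · have hm : coxeterExp ty n i j = 2 := by
        cases ty <;> simp only [coxeterExp] <;> split_ifs <;> omega
      rw [if_neg hadj, zero_smul] at ha
      rw [hm]
      exact mul_pow_two_of_anti hsi hsj ha
  · cases ty with
    | A =>
      simp only [rank] at hjr
      omega
    | B =>
      obtain rfl : j = n := le_antisymm hjr (by omega)
      have ha := anti_root_typeB hi hlt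
      by_cases hadj : i + 1 = j
      · have hm : coxeterExp .B j i j = 4 := by
          simp only [coxeterExp, if_neg hij]
          rw [if_pos (Or.inl hadj), if_pos (Or.inr trivial)]
        rw [if_pos hadj] at ha
        rw [hm]
        exact mul_pow_four_of_anti hsi hsj ha (by linear_combination 4 * invSqrtTwo_mul_self)
      · have hm : coxeterExp .B j i j = 2 := by
          simp only [coxeterExp, if_neg hij]
          rw [if_neg (by omega)]
        rw [if_neg hadj, zero_smul] at ha
        rw [hm]
        exact mul_pow_two_of_anti hsi hsj ha
    | D =>
      obtain rfl : j = n := le_antisymm hjr (by omega)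
      have ha := anti_root_typeD hi hlt
      by_cases hadj : i + 2 = j
      · have hm : coxeterExp .D j i j = 3 := by
          simp only [coxeterExp, if_neg hij]
          rw [if_pos (Or.inr trivial), if_pos (Or.inl hadj)]
        rw [if_pos hadj] at ha
        rw [hm]
        exact mul_pow_three_of_anti hsi hsj ha
      · have hm : coxeterExp .D j i j = 2 := by
          simp only [coxeterExp, if_neg hij]
          rw [if_pos (Or.inr trivial), if_neg (by omega)]
        rw [if_neg hadj, zero_smul] at ha
        rw [hm]
        exact mul_pow_two_of_anti hsi hsj ha

/-! ### Conjugation by simple roots -/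

theorem root_conj_lgen {k j : ℕ} (hk : 1 ≤ k) (hkn : k < n) (hj : 1 ≤ j) (hjn : j ≤ n) :
    root ty n k * lgen n j * root ty n k = -lgen n (Equiv.swap k (k + 1) j) := by
  rw [conj_of_anti (root_sq_of_lt hk hkn) (anti_root_lgen hk hkn hj hjn)]
  rw [root_of_lt hk hkn, smul_smul]
  have h : (2 : ℂ) * (invSqrtTwo * invSqrtTwo) = 1 := by
    rw [invSqrtTwo_mul_self]
    norm_num
  by_cases h1 : k = j
  · subst h1
    rw [if_pos rfl, if_neg (by omega), Equiv.swap_apply_left,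
      show invSqrtTwo * (2 - 0) * invSqrtTwo = 1 by linear_combination h, one_smul]
    abel
  by_cases h2 : k + 1 = j
  · subst h2
    rw [if_neg (by omega), if_pos rfl, Equiv.swap_apply_right,
      show invSqrtTwo * (0 - 2) * invSqrtTwo = -1 by linear_combination -h, neg_one_smul]
    abel
  rw [if_neg h1, if_neg h2, Equiv.swap_apply_of_ne_of_ne (Ne.symm h1) (Ne.symm h2)]
  simp

theorem root_conj_lgen_typeB {j : ℕ} (hj : 1 ≤ j) (hjn : j ≤ n) :
    root .B n n * lgen n j * root .B n n = if j = n then lgen n j else -lgen n j := by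
  rw [root_typeB, conj_of_anti (lgen_sq (by omega) le_rfl) (anti_lgen (by omega) le_rfl hj hjn)]
  split_ifs with h1 h2 h2
  · rw [h1, two_smul, add_sub_cancel_right]
  · omega
  · omega
  · simp

theorem root_conj_lgen_typeD {j : ℕ} (hn : 2 ≤ n) (hj : 1 ≤ j) (hjn : j ≤ n) :
    root .D n n * lgen n j * root .D n n
      = if n ≤ j + 1 then lgen n (Equiv.swap (n - 1) n j) else -lgen n j := by
  rw [conj_of_anti (root_sq_typeD hn) (anti_root_lgen_typeD hn hj hjn), root_typeD, smul_smul]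
  have h : (2 : ℂ) * (invSqrtTwo * invSqrtTwo) = 1 := by
    rw [invSqrtTwo_mul_self]
    norm_num
  by_cases h1 : n - 1 = j
  · rw [if_pos h1, if_neg (by omega), if_pos (by omega), ← h1, Equiv.swap_apply_left,
      show invSqrtTwo * (2 + 0) * invSqrtTwo = 1 by linear_combination h, one_smul]
    abel
  by_cases h2 : n = j
  · rw [if_neg h1, if_pos h2, if_pos (by omega), ← h2, Equiv.swap_apply_right,
      show invSqrtTwo * (0 + 2) * invSqrtTwo = 1 by linear_combination h, one_smul]
    abel
  rw [if_neg h1, if_neg h2, if_neg (by omega)]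
  simp

end Cliff

/-! ### The action of simple reflections on positions -/

section refl

variable {ty : ClassicalType} {n : ℕ}

theorem reflPerm_of_lt {k : ℕ} (hk : 1 ≤ k) (hkn : k < n) (j : Fin n) :
    ((reflPerm ty n k j : Fin n) : ℕ) + 1 = Equiv.swap k (k + 1) (j + 1) := by
  rw [reflPerm, dif_pos ⟨hk, hkn⟩]
  simp only [Equiv.swap_apply_def, Fin.ext_iff]
  split_ifs <;> (try simp) <;> omega

theorem reflPerm_typeD (hn : 2 ≤ n) (j : Fin n) :
    ((reflPerm .D n n j : Fin n) : ℕ) + 1 = Equiv.swap (n - 1) n (j + 1) := by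
  rw [reflPerm, dif_neg (by omega), dif_pos ⟨rfl, rfl, hn⟩]
  simp only [Equiv.swap_apply_def, Fin.ext_iff]
  split_ifs <;> (try simp) <;> omega

theorem reflPerm_typeB : reflPerm .B n n = 1 := by
  rw [reflPerm, dif_neg (by omega), dif_neg (by simp)]

theorem Cliff.root_mul_gen (hD : ty = .D → 2 ≤ n) {k : ℕ} (hk : 1 ≤ k) (hkr : k ≤ rank ty n)
    (j : Fin n) :
    Cliff.root ty n k * Cliff.gen n j
      = -(reflSign ty n k j • (Cliff.gen n (reflPerm ty n k j) * Cliff.root ty n k)) := by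
  suffices h : Cliff.root ty n k * Cliff.gen n j * Cliff.root ty n k
      = -(reflSign ty n k j • Cliff.gen n (reflPerm ty n k j)) by
    rw [← smul_mul_assoc, ← neg_mul, ← h, mul_assoc, Cliff.root_sq hD hk hkr, mul_one]
  rw [← Cliff.label_succ (Cliff.gen n) j, ← Cliff.label_succ (Cliff.gen n) (reflPerm ty n k j)]
  by_cases hkn : k < n
  · rw [Cliff.root_conj_lgen hk hkn (by omega) (by omega), reflPerm_of_lt hk hkn, reflSign,
      if_neg (by omega), one_smul]
  · cases ty with
    | A =>
      simp only [rank] at hkr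
      omega
    | B =>
      obtain rfl : k = n := le_antisymm hkr (by omega)
      rw [Cliff.root_conj_lgen_typeB (by omega) (by omega), reflPerm_typeB, reflSign]
      by_cases h : (j : ℕ) + 1 = k <;> simp [h]
    | D =>
      obtain rfl : k = n := le_antisymm hkr (by omega)
      rw [Cliff.root_conj_lgen_typeD (hD rfl) (by omega) (by omega), reflPerm_typeD (hD rfl),
        reflSign]
      by_cases h : k ≤ (j : ℕ) + 2
      · rw [if_pos h, if_pos ⟨rfl, Or.inr ⟨rfl, h⟩⟩]
        simp
      · rw [if_neg h, if_neg (by simp; omega), Equiv.swap_apply_of_ne_of_ne (by omega) (by omega)]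
        simp

end refl

/-! ### Words in the simple roots -/

namespace Cliff

variable {ty : ClassicalType} {n : ℕ}

/-- Each conjugation by a simple root reflects and contributes a factor `-1`. The total sign is
exactly the one built into `[i,j]`, which is thereby cancelled. -/
theorem linkWord_root {i j : ℕ} (hi : 1 ≤ i) (hij : i < j) (hj : j ≤ n) :
    linkWord (root ty n) i j
      = (-1 : ℂ) ^ (j - i - 1) • invSqrtTwo • (lgen n i - lgen n j) := by
  induction j, (show i + 1 ≤ j by omega) using Nat.le_induction with
  | base =>
    rw [linkWord_base, root_of_lt hi (by omega)]
    simp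
  | succ j hij ih =>
    rw [linkWord_succ _ (by omega), ih (by omega) (by omega)]
    simp only [mul_smul_comm, smul_mul_assoc, mul_sub, sub_mul]
    rw [root_conj_lgen (by omega) (by omega) hi (by omega),
      root_conj_lgen (by omega) (by omega) (by omega) (by omega), Equiv.swap_apply_left,
      Equiv.swap_apply_of_ne_of_ne (by omega) (by omega),
      show j + 1 - i - 1 = (j - i - 1) + 1 by omega, pow_succ]
    module

/-- The scalar `a` is left free because the middle letter carries opposite signs in the two types:
`1 / √2` in type `D` and `-1 / √2` in type `B`. -/
theorem pairWord_root {b : Cliff n} {a : ℂ} (hb : b = a • (lgen n (n - 1) + lgen n n)) {i j : ℕ}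
    (hi : 1 ≤ i) (hij : i < j) (hj : j ≤ n) :
    pairWord (root ty n) n b i j
      = (-1 : ℂ) ^ (j - i - 1) • a • (lgen n i + lgen n j) := by
  have h1 : ∀ d i, i + d + 1 = n → 1 ≤ i →
      pairWord (root ty n) n b i n = (-1 : ℂ) ^ d • a • (lgen n i + lgen n n) := by
    intro d
    induction d with
    | zero =>
      intro i hid hi
      obtain rfl : n = i + 1 := by omega
      have h := pairWord_base (root ty (i + 1)) (i + 1) b (by omega)
      rw [Nat.add_sub_cancel] at h hb
      rw [h, hb]
      simp
    | succ d ih =>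
      intro i hid hi
      rw [pairWord_left _ _ _ (by omega), ih (i + 1) (by omega) (by omega)]
      simp only [mul_smul_comm, smul_mul_assoc, mul_add, add_mul]
      rw [root_conj_lgen hi (by omega) (by omega) (by omega),
        root_conj_lgen hi (by omega) (by omega) (by omega), Equiv.swap_apply_right,
        Equiv.swap_apply_of_ne_of_ne (by omega) (by omega), pow_succ]
      module
  have h2 : ∀ d j, j + d = n → i < j → pairWord (root ty n) n b i j
      = (-1 : ℂ) ^ (d + (n - 1 - i)) • a • (lgen n i + lgen n j) := by
    intro d
    induction d with
    | zero =>
      intro j hjd hij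
      obtain rfl : j = n := by omega
      rw [h1 (j - 1 - i) i (by omega) hi, zero_add]
    | succ d ih =>
      intro j hjd hij
      rw [pairWord_right _ _ _ _ (by omega), ih (j + 1) (by omega) (by omega)]
      simp only [mul_smul_comm, smul_mul_assoc, mul_add, add_mul]
      rw [root_conj_lgen (by omega) (by omega) (by omega) (by omega),
        root_conj_lgen (by omega) (by omega) (by omega) (by omega), Equiv.swap_apply_right,
        Equiv.swap_apply_of_ne_of_ne (by omega) (by omega), add_right_comm, pow_succ]
      module
  -- The second index takes `n - j` steps and the first `n - 1 - i`. Their total has the parity of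
  -- `j - i - 1`.
  rw [h2 (n - j) j (by omega) hij, show n - j + (n - 1 - i) = (n - j) + (n - j) + (j - i - 1) by omega,
    pow_add, ← two_mul, pow_mul]
  simp

theorem pointWord_root {i : ℕ} (hi : 1 ≤ i) (hin : i ≤ n) :
    pointWord (root ty n) n (lgen n n) i = (-1 : ℂ) ^ (n - i) • lgen n i := by
  obtain ⟨d, hd⟩ : ∃ d, i + d = n := ⟨n - i, by omega⟩
  rw [show n - i = d by omega]
  induction d generalizing i with
  | zero =>
    obtain rfl : i = n := by omega
    rw [pointWord_base _ _ _ hi]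
    simp
  | succ d ih =>
    rw [pointWord_succ _ _ _ (by omega), ih (by omega) (by omega) (by omega), mul_smul_comm,
      smul_mul_assoc, root_conj_lgen hi (by omega) (by omega) (by omega), Equiv.swap_apply_right,
      pow_succ]
    module

end Cliff

/-! ### Relations between involutions -/

section involutions

variable {G : Type*} [Group G] {a b : G}

theorem commute_of_pow_two (ha : a * a = 1) (hb : b * b = 1) (h : (a * b) ^ 2 = 1) :
    Commute a b := by
  have ha' : a⁻¹ = a := inv_eq_of_mul_eq_one_left ha
  have hb' : b⁻¹ = b := inv_eq_of_mul_eq_one_left hb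
  rw [pow_two] at h
  have := eq_inv_of_mul_eq_one_left h
  rwa [mul_inv_rev, ha', hb'] at this

theorem pow_two_of_commute (ha : a * a = 1) (hb : b * b = 1) (h : Commute a b) :
    (a * b) ^ 2 = 1 := by
  rw [h.mul_pow, pow_two, pow_two, ha, hb, one_mul]

theorem braid_of_pow_three (ha : a * a = 1) (hb : b * b = 1) (h : (a * b) ^ 3 = 1) :
    a * b * a = b * a * b := by
  have ha' : a⁻¹ = a := inv_eq_of_mul_eq_one_left ha
  have hb' : b⁻¹ = b := inv_eq_of_mul_eq_one_left hb
  have h' : (a * b * a) * (b * a * b) = 1 := by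
    rw [← h]
    simp only [pow_succ, pow_zero, one_mul, mul_assoc]
  have := eq_inv_of_mul_eq_one_left h'
  rwa [mul_inv_rev, mul_inv_rev, ha', hb', ← mul_assoc] at this

theorem pow_three_of_braid (ha : a * a = 1) (hb : b * b = 1) (h : a * b * a = b * a * b) :
    (a * b) ^ 3 = 1 := by
  calc (a * b) ^ 3 = (a * b * a) * (b * a * b) := by
        simp only [pow_succ, pow_zero, one_mul, mul_assoc]
    _ = (b * a) * (b * b) * (a * b) := by rw [h]; group
    _ = b * (a * a) * b := by rw [hb]; group
    _ = 1 := by rw [ha, mul_one, hb]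

theorem braid_of_pow_four (ha : a * a = 1) (hb : b * b = 1) (h : (a * b) ^ 4 = 1) :
    a * b * a * b = b * a * b * a := by
  have ha' : a⁻¹ = a := inv_eq_of_mul_eq_one_left ha
  have hb' : b⁻¹ = b := inv_eq_of_mul_eq_one_left hb
  have h' : (a * b * a * b) * (a * b * a * b) = 1 := by
    rw [← h]
    simp only [pow_succ, pow_zero, one_mul, mul_assoc]
  have := eq_inv_of_mul_eq_one_left h'
  simpa only [mul_inv_rev, ha', hb', mul_assoc] using this

theorem mul_pow_eq_one_comm (m : ℕ) (h : (a * b) ^ m = 1) : (b * a) ^ m = 1 := by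
  have h1 : b * a = b * (a * b) * b⁻¹ := by group
  rw [h1, conj_pow, h]
  group

end involutions

/-! ### Permutations of positions -/

section positions

variable {n : ℕ}

/-- A permutation of `Fin n` is given by a permutation of the labels `1, …, n`. -/
def IsShift (p : Equiv.Perm (Fin n)) (q : Equiv.Perm ℕ) : Prop :=
  ∀ x : Fin n, ((p x : Fin n) : ℕ) + 1 = q (x + 1)

namespace IsShift

variable {p p' : Equiv.Perm (Fin n)} {q q' : Equiv.Perm ℕ}

theorem mul (h : IsShift p q) (h' : IsShift p' q') : IsShift (p * p') (q * q') := fun x => by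
  rw [Equiv.Perm.mul_apply, h, h', Equiv.Perm.mul_apply]

theorem unique (h : IsShift p q) (h' : IsShift p' q) : p = p' := by
  ext x
  have := (h x).trans (h' x).symm
  omega

theorem of_eq (h : IsShift p q) (hq : q = q') : IsShift p q' := hq ▸ h

theorem eq_swap {i j : Fin n} (h : IsShift p (Equiv.swap (i + 1 : ℕ) (j + 1))) :
    p = Equiv.swap i j := by
  refine h.unique fun x => ?_
  simp only [Equiv.swap_apply_def, Fin.ext_iff]
  split_ifs <;> (try simp) <;> omega

end IsShift

theorem swap_conj_left {i j k : ℕ} (hij : i ≠ k) (hik : i ≠ j) :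
    Equiv.swap k j * Equiv.swap i k * Equiv.swap k j = Equiv.swap i j := by
  have h := Equiv.swap_mul_swap_mul_swap (x := i) (y := k) (z := j) hij hik
  rw [h, Equiv.swap_comm]

variable {ty : ClassicalType}

theorem isShift_reflPerm {k : ℕ} (hk : 1 ≤ k) (hkn : k < n) :
    IsShift (reflPerm ty n k) (Equiv.swap k (k + 1)) :=
  fun x => reflPerm_of_lt hk hkn x

theorem isShift_reflPerm_typeD (hn : 2 ≤ n) :
    IsShift (reflPerm .D n n) (Equiv.swap (n - 1) n) :=
  fun x => reflPerm_typeD hn x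

/-- Without signs the last two simple reflections coincide, which reduces the Coxeter relations at
the last node to those of the symmetric group. -/
theorem reflPerm_typeD_eq (hn : 2 ≤ n) : reflPerm .D n n = reflPerm .D n (n - 1) := by
  refine (isShift_reflPerm_typeD hn).unique ?_
  have h := isShift_reflPerm (ty := .D) (n := n) (k := n - 1) (by omega) (by omega)
  rwa [Nat.sub_add_cancel (by omega)] at h

theorem reflPerm_sq (k : ℕ) : reflPerm ty n k * reflPerm ty n k = 1 := by
  unfold reflPerm
  split_ifs <;> simp

theorem reflPerm_rel_of_lt {i j : ℕ} (hi : 1 ≤ i) (hij : i < j) (hjn : j < n) :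
    (i + 1 = j → (reflPerm ty n i * reflPerm ty n j) ^ 3 = 1) ∧
    (i + 1 ≠ j → (reflPerm ty n i * reflPerm ty n j) ^ 2 = 1) := by
  have h1 := isShift_reflPerm (ty := ty) hi (hij.trans hjn)
  have h2 := isShift_reflPerm (ty := ty) (hi.trans hij.le) hjn
  constructor
  · rintro rfl
    refine pow_three_of_braid (reflPerm_sq _) (reflPerm_sq _) ?_
    refine ((h1.mul h2).mul h1).unique (((h2.mul h1).mul h2).of_eq ?_)
    ext x
    simp only [Equiv.Perm.mul_apply, Equiv.swap_apply_def]
    split_ifs <;> omega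
  · intro h
    refine pow_two_of_commute (reflPerm_sq _) (reflPerm_sq _) ?_
    refine (h1.mul h2).unique ((h2.mul h1).of_eq ?_)
    ext x
    simp only [Equiv.Perm.mul_apply, Equiv.swap_apply_def]
    split_ifs <;> omega

theorem coxeterExp_of_lt {i j : ℕ} (hij : i < j) (hjn : j < n) :
    coxeterExp ty n i j = if i + 1 = j then 3 else 2 := by
  cases ty <;> simp only [coxeterExp] <;> split_ifs <;> omega

theorem coxeterExp_typeB {i : ℕ} (hi : i < n) :
    coxeterExp .B n i n = if i + 1 = n then 4 else 2 := by
  simp only [coxeterExp, if_neg hi.ne]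
  by_cases h : i + 1 = n
  · rw [if_pos (Or.inl h), if_pos (Or.inr trivial), if_pos h]
  · rw [if_neg (by omega), if_neg h]

theorem coxeterExp_typeD {i : ℕ} (hi : i < n) :
    coxeterExp .D n i n = if i + 2 = n then 3 else 2 := by
  simp only [coxeterExp, if_neg hi.ne]
  rw [if_pos (Or.inr trivial)]
  by_cases h : i + 2 = n
  · rw [if_pos (Or.inl h), if_pos h]
  · rw [if_neg (by omega), if_neg h]

theorem reflPerm_rel {i j : ℕ} (hD : ty = .D → 2 ≤ n) (hi : 1 ≤ i) (hir : i ≤ rank ty n)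
    (hj : 1 ≤ j) (hjr : j ≤ rank ty n) :
    (reflPerm ty n i * reflPerm ty n j) ^ coxeterExp ty n i j = 1 := by
  by_cases hij : i = j
  · subst hij
    rw [reflPerm_sq, one_pow]
  wlog hlt : i < j generalizing i j
  · have h := mul_pow_eq_one_comm _ (this hj hjr hi hir (Ne.symm hij) (by omega))
    rwa [Cliff.coxeterExp_comm] at h
  by_cases hjn : j < n
  · rw [coxeterExp_of_lt hlt hjn]
    have h := reflPerm_rel_of_lt (ty := ty) hi hlt hjn
    split_ifs with h1
    · exact h.1 h1
    · exact h.2 h1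
  · cases ty with
    | A =>
      simp only [rank] at hjr
      omega
    | B =>
      obtain rfl : j = n := le_antisymm hjr (by omega)
      rw [coxeterExp_typeB hlt, reflPerm_typeB, mul_one]
      have h : reflPerm .B j i ^ 2 = 1 := by rw [pow_two, reflPerm_sq]
      split_ifs
      · rw [show 4 = 2 * 2 by rfl, pow_mul, h, one_pow]
      · exact h
    | D =>
      obtain rfl : j = n := le_antisymm hjr (by omega)
      rw [coxeterExp_typeD hlt, reflPerm_typeD_eq (hD rfl)]
      by_cases h1 : i = j - 1
      · rw [if_neg (by omega), h1, reflPerm_sq, one_pow]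
      · have h := reflPerm_rel_of_lt (ty := .D) (n := j) (i := i) (j := j - 1) hi (by omega)
          (by omega)
        split_ifs with h2
        · exact h.1 (by omega)
        · exact h.2 (by omega)

end positions

/-! ### The Weyl group -/

/-- The Coxeter relators. -/
def coxeterRels (ty : ClassicalType) (n : ℕ) : Set (FreeGroup (Fin (rank ty n))) :=
  Set.range fun p : Fin (rank ty n) × Fin (rank ty n) =>
    (FreeGroup.of p.1 * FreeGroup.of p.2) ^ coxeterExp ty n (p.1 + 1) (p.2 + 1)

/-- The Weyl group, given by its Coxeter presentation. -/
abbrev Weyl (ty : ClassicalType) (n : ℕ) : Type := PresentedGroup (coxeterRels ty n)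

namespace Weyl

variable {ty : ClassicalType} {n : ℕ}

variable (ty n) in
/-- The simple reflections, with labels `1, …, rank`. -/
def refl : ℕ → Weyl ty n := label fun i => PresentedGroup.of i

/-- The homomorphism determined by elements satisfying the Coxeter relations. -/
def lift {H : Type*} [Group H] (f : ℕ → H)
    (hf : ∀ i j, 1 ≤ i → i ≤ rank ty n → 1 ≤ j → j ≤ rank ty n →
      (f i * f j) ^ coxeterExp ty n i j = 1) : Weyl ty n →* H :=
  PresentedGroup.toGroup (rels := coxeterRels ty n)
    (f := fun i : Fin (rank ty n) => f (i + 1)) (by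
    rintro _ ⟨⟨i, j⟩, rfl⟩
    simpa using hf (i + 1) (j + 1) (by omega) (by omega) (by omega) (by omega))

theorem lift_refl {H : Type*} [Group H] (f : ℕ → H)
    (hf : ∀ i j, 1 ≤ i → i ≤ rank ty n → 1 ≤ j → j ≤ rank ty n →
      (f i * f j) ^ coxeterExp ty n i j = 1) {k : ℕ} (hk : 1 ≤ k) (hkr : k ≤ rank ty n) :
    lift f hf (refl ty n k) = f k := by
  rw [refl, label, dif_pos ⟨hk, hkr⟩, lift, PresentedGroup.toGroup.of]
  simp [Nat.sub_add_cancel hk]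

theorem refl_rel {i j : ℕ} (hi : 1 ≤ i) (hir : i ≤ rank ty n) (hj : 1 ≤ j)
    (hjr : j ≤ rank ty n) : (refl ty n i * refl ty n j) ^ coxeterExp ty n i j = 1 := by
  have h : PresentedGroup.mk (coxeterRels ty n)
      ((FreeGroup.of (⟨i - 1, by omega⟩ : Fin (rank ty n)) * FreeGroup.of ⟨j - 1, by omega⟩)
        ^ coxeterExp ty n (i - 1 + 1) (j - 1 + 1)) = 1 :=
    PresentedGroup.one_of_mem ⟨(⟨i - 1, by omega⟩, ⟨j - 1, by omega⟩), rfl⟩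
  rw [refl, label, dif_pos ⟨hi, hir⟩, label, dif_pos ⟨hj, hjr⟩]
  rw [Nat.sub_add_cancel hi, Nat.sub_add_cancel hj, map_pow, map_mul] at h
  exact h

theorem refl_sq (k : ℕ) : refl ty n k * refl ty n k = 1 := by
  by_cases h : 1 ≤ k ∧ k ≤ rank ty n
  · simpa [coxeterExp] using refl_rel (ty := ty) (n := n) h.1 h.2 h.1 h.2
  · rw [refl, label, dif_neg h, one_mul]

theorem le_rank_of_lt {k : ℕ} (h : k < n) : k ≤ rank ty n := by
  cases ty <;> simp only [rank] <;> omega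

theorem isChain : IsChain n (refl ty n) where
  sq := refl_sq
  comm k l hk hkl hln := by
    refine commute_of_pow_two (refl_sq _) (refl_sq _) ?_
    have h := refl_rel (ty := ty) (n := n) hk (le_rank_of_lt (by omega)) (by omega)
      (le_rank_of_lt hln)
    rwa [coxeterExp_of_lt (by omega) hln, if_neg (by omega)] at h
  braid k hk hkn := by
    refine braid_of_pow_three (refl_sq _) (refl_sq _) ?_
    have h := refl_rel (ty := ty) (n := n) hk (le_rank_of_lt (by omega)) (by omega)
      (le_rank_of_lt hkn)
    rwa [coxeterExp_of_lt (by omega) hkn, if_pos rfl] at h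

theorem typeB_comm {k : ℕ} (hk : 1 ≤ k) (hkn : k + 1 < n) :
    Commute (refl .B n n) (refl .B n k) := by
  refine (commute_of_pow_two (refl_sq _) (refl_sq _) ?_).symm
  have h := refl_rel (ty := .B) (n := n) (j := n) hk (le_rank_of_lt (by omega)) (by omega) le_rfl
  rwa [coxeterExp_typeB (by omega), if_neg (by omega)] at h

theorem typeB_braid (hn : 2 ≤ n) :
    refl .B n n * refl .B n (n - 1) * refl .B n n * refl .B n (n - 1)
      = refl .B n (n - 1) * refl .B n n * refl .B n (n - 1) * refl .B n n := by
  refine (braid_of_pow_four (refl_sq _) (refl_sq _) ?_).symm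
  have h := refl_rel (ty := .B) (n := n) (i := n - 1) (j := n) (by omega) (le_rank_of_lt (by omega))
    (by omega) le_rfl
  rwa [coxeterExp_typeB (by omega), if_pos (by omega)] at h

theorem typeD_comm {k : ℕ} (hk : 1 ≤ k) (hkn : k + 2 < n ∨ k + 1 = n) :
    Commute (refl .D n n) (refl .D n k) := by
  refine (commute_of_pow_two (refl_sq _) (refl_sq _) ?_).symm
  have h := refl_rel (ty := .D) (n := n) (j := n) hk (le_rank_of_lt (by omega)) (by omega) le_rfl
  rwa [coxeterExp_typeD (by omega), if_neg (by omega)] at h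

theorem typeD_braid (hn : 3 ≤ n) :
    refl .D n n * refl .D n (n - 2) * refl .D n n
      = refl .D n (n - 2) * refl .D n n * refl .D n (n - 2) := by
  refine (braid_of_pow_three (refl_sq _) (refl_sq _) ?_).symm
  have h := refl_rel (ty := .D) (n := n) (i := n - 2) (j := n) (by omega) (le_rank_of_lt (by omega))
    (by omega) le_rfl
  rwa [coxeterExp_typeD (by omega), if_pos (by omega)] at h

/-- Induction over words in the simple reflections. -/
theorem induction {p : Weyl ty n → Prop} (h1 : p 1)
    (hmul : ∀ k, 1 ≤ k → k ≤ rank ty n → ∀ g, p g → p (refl ty n k * g)) (g : Weyl ty n) :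
    p g := by
  have hg : g ∈ Subgroup.closure (Set.range PresentedGroup.of) := by
    rw [PresentedGroup.closure_range_of]
    trivial
  have hr : ∀ i : Fin (rank ty n),
      refl ty n (i + 1) = PresentedGroup.of i := fun i => Cliff.label_succ _ i
  induction hg using Subgroup.closure_induction_left with
  | one => exact h1
  | mul_left x hx y _ hy =>
    obtain ⟨i, rfl⟩ := hx
    rw [← hr]
    exact hmul _ (by omega) (by omega) y hy
  | inv_mul_cancel x hx y _ hy =>
    obtain ⟨i, rfl⟩ := hx
    rw [← hr, inv_eq_of_mul_eq_one_left (refl_sq _)]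
    exact hmul _ (by omega) (by omega) y hy

/-- The action of the Weyl group on positions, forgetting signs. -/
def toPerm (hD : ty = .D → 2 ≤ n) : Weyl ty n →* Equiv.Perm (Fin n) :=
  lift (reflPerm ty n) fun _ _ => reflPerm_rel hD

theorem toPerm_refl (hD : ty = .D → 2 ≤ n) {k : ℕ} (hk : 1 ≤ k) (hkr : k ≤ rank ty n) :
    toPerm hD (refl ty n k) = reflPerm ty n k := lift_refl _ _ hk hkr

/-! ### Reflections -/

variable (ty n) in
/-- The reflection in the root `e_{n-1} + e_n`. -/
def plusRefl : Weyl ty n :=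
  match ty with
  | .A => 1
  | .B => refl .B n n * refl .B n (n - 1) * refl .B n n
  | .D => refl .D n n

variable (ty n) in
/-- The reflection in the root `e_i - e_j`. -/
def minus (i j : ℕ) : Weyl ty n := symPair (linkWord (refl ty n)) i j

variable (ty n) in
/-- The reflection in the root `e_i + e_j` (types `B` and `D`). -/
def plus (i j : ℕ) : Weyl ty n := symPair (pairWord (refl ty n) n (plusRefl ty n)) i j

variable (n) in
/-- The reflection in the root `e_i` (type `B`). -/
def short (i : ℕ) : Weyl .B n := pointWord (refl .B n) n (refl .B n n) i

theorem minus_equivariant {k i j : ℕ} (hk : 1 ≤ k) (hkn : k < n) (hi : 1 ≤ i) (hin : i ≤ n)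
    (hj : 1 ≤ j) (hjn : j ≤ n) (hij : i ≠ j) :
    refl ty n k * minus ty n i j
      = minus ty n (Equiv.swap k (k + 1) i) (Equiv.swap k (k + 1) j) * refl ty n k :=
  isChain.symPair_equivariant isChain.isPairFamily_linkWord hk hkn hi hin hj hjn hij

theorem isPairFamily_plus (hty : ty ≠ .A) :
    IsPairFamily n (refl ty n) (pairWord (refl ty n) n (plusRefl ty n)) := by
  refine isChain.isPairFamily_pairWord ?_
  intro k hk h
  cases ty with
  | A => exact absurd rfl hty
  | B =>
    exact typeB_commute_base isChain (fun k => typeB_comm) typeB_braid k hk h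
  | D => exact (typeD_comm hk h).symm

theorem plus_equivariant (hty : ty ≠ .A) {k i j : ℕ} (hk : 1 ≤ k) (hkn : k < n) (hi : 1 ≤ i)
    (hin : i ≤ n) (hj : 1 ≤ j) (hjn : j ≤ n) (hij : i ≠ j) :
    refl ty n k * plus ty n i j
      = plus ty n (Equiv.swap k (k + 1) i) (Equiv.swap k (k + 1) j) * refl ty n k :=
  isChain.symPair_equivariant (isPairFamily_plus hty) hk hkn hi hin hj hjn hij

theorem short_equivariant {k i : ℕ} (hk : 1 ≤ k) (hkn : k ≤ n) (hi : 1 ≤ i) (hin : i ≤ n) :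
    refl .B n k * short n i
      = short n (if k = n then i else Equiv.swap k (k + 1) i) * refl .B n k := by
  split_ifs with h
  · subst h
    exact (typeB_commute_point isChain (fun k => typeB_comm) typeB_braid (k - i) i
      (by omega) hi).eq
  · refine isChain.point_equivariant (fun i _ h => pointWord_succ _ _ _ h) ?_ hk (by omega) hi hin
    intro k hk hkn
    rw [pointWord_base _ _ _ (by omega)]
    exact (typeB_comm hk hkn).symm

theorem last_equivariant_typeB {i j : ℕ} (hi : 1 ≤ i) (hin : i ≤ n) (hj : 1 ≤ j) (hjn : j ≤ n)
    (hij : i ≠ j) :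
    (refl .B n n * minus .B n i j = minus .B n i j * refl .B n n ∧
      refl .B n n * plus .B n i j = plus .B n i j * refl .B n n) ∨
    (refl .B n n * minus .B n i j = plus .B n i j * refl .B n n ∧
      refl .B n n * plus .B n i j = minus .B n i j * refl .B n n) := by
  wlog h : i < j generalizing i j
  · rw [minus, plus, symPair_comm _ hij, symPair_comm _ hij]
    exact this hj hjn hi hin hij.symm (by omega)
  rw [minus, plus, symPair, symPair, if_pos h, if_pos h]
  exact typeB_last isChain (fun k => typeB_comm) typeB_braid hi h hjn

theorem last_equivariant_typeD (hn : 2 ≤ n) {i j : ℕ} (hi : 1 ≤ i) (hin : i ≤ n) (hj : 1 ≤ j)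
    (hjn : j ≤ n) (hij : i ≠ j) :
    (refl .D n n * minus .D n i j
        = minus .D n (Equiv.swap (n - 1) n i) (Equiv.swap (n - 1) n j) * refl .D n n ∧
      refl .D n n * plus .D n i j
        = plus .D n (Equiv.swap (n - 1) n i) (Equiv.swap (n - 1) n j) * refl .D n n) ∨
    (refl .D n n * minus .D n i j
        = plus .D n (Equiv.swap (n - 1) n i) (Equiv.swap (n - 1) n j) * refl .D n n ∧
      refl .D n n * plus .D n i j
        = minus .D n (Equiv.swap (n - 1) n i) (Equiv.swap (n - 1) n j) * refl .D n n) := by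
  wlog h : i < j generalizing i j
  · have hs := (Equiv.swap (n - 1) n).injective.ne hij
    rw [minus, plus, minus, plus, symPair_comm _ hij, symPair_comm _ hij, symPair_comm _ hs,
      symPair_comm _ hs]
    exact this hj hjn hi hin hij.symm (by omega)
  have h1 : minus .D n i j = linkWord (refl .D n) i j := if_pos h
  have h2 : plus .D n i j = pairWord (refl .D n) n (refl .D n n) i j := if_pos h
  rw [h1, h2]
  exact typeD_last isChain hn (fun k => typeD_comm) typeD_braid hi h hjn

/-! ### Reflections as permutations of positions -/

theorem isShift_linkWord (hD : ty = .D → 2 ≤ n) {i j : ℕ} (hi : 1 ≤ i) (hij : i < j)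
    (hj : j ≤ n) : IsShift (toPerm hD (linkWord (refl ty n) i j)) (Equiv.swap i j) := by
  induction j, (show i + 1 ≤ j by omega) using Nat.le_induction with
  | base =>
    rw [linkWord_base, toPerm_refl hD hi (le_rank_of_lt (by omega))]
    exact isShift_reflPerm hi (by omega)
  | succ j hij ih =>
    have h := isShift_reflPerm (ty := ty) (n := n) (k := j) (by omega) (by omega)
    rw [linkWord_succ _ (by omega), map_mul, map_mul,
      toPerm_refl hD (by omega) (le_rank_of_lt (by omega))]
    exact ((h.mul (ih (by omega) (by omega))).mul h).of_eq
      (swap_conj_left (by omega) (by omega))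

theorem isShift_pairWord (hD : ty = .D → 2 ≤ n) {b : Weyl ty n}
    (hb : IsShift (toPerm hD b) (Equiv.swap (n - 1) n)) {i j : ℕ}
    (hi : 1 ≤ i) (hij : i < j) (hj : j ≤ n) :
    IsShift (toPerm hD (pairWord (refl ty n) n b i j)) (Equiv.swap i j) := by
  have h1 : ∀ d i, i + d + 1 = n → 1 ≤ i →
      IsShift (toPerm hD (pairWord (refl ty n) n b i n)) (Equiv.swap i n) := by
    intro d
    induction d with
    | zero =>
      intro i hid hi
      obtain rfl : i = n - 1 := by omega
      rwa [pairWord_base _ _ _ (by omega)]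
    | succ d ih =>
      intro i hid hi
      have h := isShift_reflPerm (ty := ty) (n := n) (k := i) (by omega) (by omega)
      rw [pairWord_left _ _ _ (by omega), map_mul, map_mul,
        toPerm_refl hD (by omega) (le_rank_of_lt (by omega))]
      refine ((h.mul (ih (i + 1) (by omega) (by omega))).mul h).of_eq ?_
      rw [Equiv.swap_comm i, Equiv.swap_comm (i + 1) n, Equiv.swap_comm i n]
      exact swap_conj_left (by omega) (by omega)
  have h2 : ∀ d j, j + d = n → i < j →
      IsShift (toPerm hD (pairWord (refl ty n) n b i j)) (Equiv.swap i j) := by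
    intro d
    induction d with
    | zero =>
      intro j hjd hij
      obtain rfl : j = n := by omega
      exact h1 (j - 1 - i) i (by omega) hi
    | succ d ih =>
      intro j hjd hij
      have h := isShift_reflPerm (ty := ty) (n := n) (k := j) (by omega) (by omega)
      rw [pairWord_right _ _ _ _ (by omega), map_mul, map_mul,
        toPerm_refl hD (by omega) (le_rank_of_lt (by omega))]
      refine ((h.mul (ih (j + 1) (by omega) (by omega))).mul h).of_eq ?_
      rw [Equiv.swap_comm j (j + 1)]
      exact swap_conj_left (by omega) (by omega)
  exact h2 (n - j) j (by omega) hij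

theorem toPerm_minus (hD : ty = .D → 2 ≤ n) {i j : Fin n} (hij : i ≠ j) :
    toPerm hD (minus ty n (i + 1) (j + 1)) = Equiv.swap i j := by
  wlog h : i < j generalizing i j
  · rw [minus, symPair_comm _ (by omega), Equiv.swap_comm]
    exact this hij.symm (by omega)
  rw [minus, symPair, if_pos (by omega)]
  exact (isShift_linkWord hD (by omega) (by omega) (by omega)).eq_swap

theorem toPerm_plus (hD : ty = .D → 2 ≤ n) (hty : ty ≠ .A) {i j : Fin n} (hij : i ≠ j) :
    toPerm hD (plus ty n (i + 1) (j + 1)) = Equiv.swap i j := by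
  wlog h : i < j generalizing i j
  · rw [plus, symPair_comm _ (by omega), Equiv.swap_comm]
    exact this hij.symm (by omega)
  rw [plus, symPair, if_pos (by omega)]
  refine (isShift_pairWord hD ?_ (by omega) (by omega) (by omega)).eq_swap
  cases ty with
  | A => exact absurd rfl hty
  | B =>
    have h' := isShift_reflPerm (ty := .B) (n := n) (k := n - 1) (by omega) (by omega)
    rw [Nat.sub_add_cancel (by omega)] at h'
    rw [plusRefl, map_mul, map_mul, toPerm_refl hD (k := n) (by omega) le_rfl,
      toPerm_refl hD (by omega) (le_rank_of_lt (by omega)), reflPerm_typeB]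
    simpa using h'
  | D =>
    rw [plusRefl, toPerm_refl hD (k := n) (by omega) le_rfl]
    exact isShift_reflPerm_typeD (hD rfl)

theorem toPerm_short (hD : ClassicalType.B = .D → 2 ≤ n) {i : ℕ} (hi : 1 ≤ i) (hin : i ≤ n) :
    toPerm hD (short n i) = 1 := by
  obtain ⟨d, hd⟩ : ∃ d, i + d = n := ⟨n - i, by omega⟩
  induction d generalizing i with
  | zero =>
    obtain rfl : i = n := by omega
    rw [short, pointWord_base _ _ _ hi, toPerm_refl hD hi le_rfl, reflPerm_typeB]
  | succ d ih =>
    have h := ih (i := i + 1) (by omega) (by omega) (by omega)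
    rw [short] at h ⊢
    rw [pointWord_succ _ _ _ (by omega), map_mul, map_mul, h,
      toPerm_refl hD hi (le_rank_of_lt (by omega)), mul_one, reflPerm_sq]

end Weyl

namespace Weyl

variable (ty : ClassicalType) (n : ℕ)

/-! ### The structure constants in the group algebra -/

/-- The sum of the reflections in the roots `e_i - e_j` and, except in type `A`, `e_i + e_j`. -/
def pairSum (i j : ℕ) : MonoidAlgebra ℂ (Weyl ty n) :=
  MonoidAlgebra.of ℂ _ (minus ty n i j) +
    if ty = .A then 0 else MonoidAlgebra.of ℂ _ (plus ty n i j)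

/-- The reflection in the root `e_i` in type `B`, and `0` in the other types. -/
def shortSum (i : ℕ) : MonoidAlgebra ℂ (Weyl ty n) :=
  match ty with
  | .A => 0
  | .B => MonoidAlgebra.of ℂ _ (short n i)
  | .D => 0

/-- The elements `K i j` with `[η_i, x_j] = c_j K i j`. -/
def structureConst (a u v : ℂ) (i j : Fin n) : MonoidAlgebra ℂ (Weyl ty n) :=
  if i = j then
    a • 1 + (-2 * invSqrtTwo * u) • (∑ k ∈ Finset.univ.erase i, pairSum ty n (k + 1) (i + 1))
      + v • shortSum ty n (i + 1)
  else (-2 * invSqrtTwo * u) • pairSum ty n (i + 1) (j + 1)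

variable {ty n}

theorem pairSum_comm {i j : ℕ} (hij : i ≠ j) : pairSum ty n i j = pairSum ty n j i := by
  rw [pairSum, pairSum, minus, plus, symPair_comm _ hij, symPair_comm _ hij]
  rfl

theorem structureConst_comm (a u v : ℂ) (i j : Fin n) :
    structureConst ty n a u v i j = structureConst ty n a u v j i := by
  by_cases h : i = j
  · rw [h]
  · rw [structureConst, structureConst, if_neg h, if_neg (Ne.symm h), pairSum_comm (by omega)]

/-- The last simple reflection may exchange the reflections in `e_i - e_j` and `e_i + e_j`, but
their sum sees only the permutation of the indices. This is why `K` is equivariant for the action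
without signs. -/
theorem pairSum_equivariant (hD : ty = .D → 2 ≤ n) {k : ℕ} (hk : 1 ≤ k) (hkr : k ≤ rank ty n)
    {i j : Fin n} (hij : i ≠ j) :
    MonoidAlgebra.of ℂ _ (refl ty n k) * pairSum ty n (i + 1) (j + 1)
      = pairSum ty n (reflPerm ty n k i + 1) (reflPerm ty n k j + 1) *
        MonoidAlgebra.of ℂ _ (refl ty n k) := by
  by_cases hkn : k < n
  · rw [reflPerm_of_lt hk hkn, reflPerm_of_lt hk hkn, pairSum, pairSum, mul_add, add_mul,
      ← map_mul, ← map_mul, minus_equivariant hk hkn (by omega) (by omega) (by omega) (by omega)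
        (by omega)]
    congr 1
    split_ifs with h
    · simp
    · rw [← map_mul, ← map_mul, plus_equivariant h hk hkn (by omega) (by omega) (by omega)
        (by omega) (by omega)]
  · cases ty with
    | A =>
      simp only [rank] at hkr
      omega
    | B =>
      obtain rfl : k = n := le_antisymm hkr (by omega)
      rw [reflPerm_typeB, Equiv.Perm.one_apply, Equiv.Perm.one_apply, pairSum, if_neg (by simp),
        mul_add, add_mul, ← map_mul, ← map_mul, ← map_mul, ← map_mul]
      obtain ⟨h1, h2⟩ | ⟨h1, h2⟩ := last_equivariant_typeB (n := k) (i := i + 1) (j := j + 1)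
        (by omega) (by omega) (by omega) (by omega) (by omega)
      · rw [h1, h2]
      · rw [h1, h2, add_comm]
    | D =>
      obtain rfl : k = n := le_antisymm hkr (by omega)
      rw [reflPerm_typeD (hD rfl), reflPerm_typeD (hD rfl), pairSum, pairSum, if_neg (by simp),
        if_neg (by simp), mul_add, add_mul, ← map_mul, ← map_mul, ← map_mul, ← map_mul]
      obtain ⟨h1, h2⟩ | ⟨h1, h2⟩ := last_equivariant_typeD (n := k) (hD rfl) (i := i + 1)
        (j := j + 1) (by omega) (by omega) (by omega) (by omega) (by omega)
      · rw [h1, h2]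
      · rw [h1, h2, add_comm]

theorem shortSum_equivariant {k : ℕ} (hk : 1 ≤ k) (hkr : k ≤ rank ty n) (i : Fin n) :
    MonoidAlgebra.of ℂ _ (refl ty n k) * shortSum ty n (i + 1)
      = shortSum ty n (reflPerm ty n k i + 1) * MonoidAlgebra.of ℂ _ (refl ty n k) := by
  cases ty with
  | A => simp [shortSum]
  | D => simp [shortSum]
  | B =>
    have hkn : k ≤ n := hkr
    simp only [shortSum]
    rw [← map_mul, ← map_mul, short_equivariant hk hkn (by omega) (by omega)]
    split_ifs with h
    · subst h
      rw [reflPerm_typeB, Equiv.Perm.one_apply]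
    · rw [reflPerm_of_lt hk (by omega)]

theorem structureConst_equivariant_refl (hD : ty = .D → 2 ≤ n) (a u v : ℂ) {k : ℕ} (hk : 1 ≤ k)
    (hkr : k ≤ rank ty n) (i j : Fin n) :
    MonoidAlgebra.of ℂ _ (refl ty n k) * structureConst ty n a u v i j
      = structureConst ty n a u v (reflPerm ty n k i) (reflPerm ty n k j) *
        MonoidAlgebra.of ℂ _ (refl ty n k) := by
  by_cases hij : i = j
  · subst hij
    rw [structureConst, structureConst, if_pos rfl, if_pos rfl, mul_add, mul_add, add_mul, add_mul,
      mul_smul_comm, mul_smul_comm, mul_smul_comm, smul_mul_assoc, smul_mul_assoc, smul_mul_assoc,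
      one_mul, mul_one, shortSum_equivariant hk hkr, Finset.mul_sum, Finset.sum_mul]
    congr 3
    -- The sum over `l ≠ i` is reindexed by the permutation, which carries it to the sum over all
    -- indices different from the image of `i`.
    refine Finset.sum_equiv (reflPerm ty n k) (by simp) fun l hl => ?_
    exact pairSum_equivariant hD hk hkr (Finset.ne_of_mem_erase hl)
  · rw [structureConst, structureConst, if_neg hij,
      if_neg ((reflPerm ty n k).injective.ne hij), mul_smul_comm, smul_mul_assoc,
      pairSum_equivariant hD hk hkr hij]

theorem structureConst_equivariant (hD : ty = .D → 2 ≤ n) (a u v : ℂ) (g : Weyl ty n)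
    (i j : Fin n) :
    MonoidAlgebra.of ℂ _ g * structureConst ty n a u v i j
      = structureConst ty n a u v (toPerm hD g i) (toPerm hD g j) * MonoidAlgebra.of ℂ _ g := by
  induction g using Weyl.induction with
  | h1 => rw [map_one, map_one, one_mul, mul_one, Equiv.Perm.one_apply, Equiv.Perm.one_apply]
  | hmul k hk hkr g hg =>
    rw [map_mul, mul_assoc, hg, ← mul_assoc, structureConst_equivariant_refl hD a u v hk hkr,
      map_mul, toPerm_refl hD hk hkr, mul_assoc]
    rfl

/-! ### The Jacobi identity -/

section jacobi

variable {B : Type*} [Ring B] [Algebra ℂ B] (φ : MonoidAlgebra ℂ (Weyl ty n) →ₐ[ℂ] B)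
  (hD : ty = .D → 2 ≤ n) {y : Fin n → B}
  (hy : ∀ g i, φ (MonoidAlgebra.of ℂ _ g) * y i = y (toPerm hD g i) * φ (MonoidAlgebra.of ℂ _ g))

include hy

theorem pairSum_mul {i j : Fin n} (hij : i ≠ j) (k : Fin n) :
    φ (pairSum ty n (i + 1) (j + 1)) * y k
      = y (Equiv.swap i j k) * φ (pairSum ty n (i + 1) (j + 1)) := by
  rw [pairSum, map_add, add_mul, mul_add, hy, toPerm_minus hD hij]
  congr 1
  split_ifs with h
  · simp
  · rw [hy, toPerm_plus hD h hij]

theorem shortSum_mul (i k : Fin n) :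
    φ (shortSum ty n (i + 1)) * y k = y k * φ (shortSum ty n (i + 1)) := by
  cases ty with
  | A => simp [shortSum]
  | D => simp [shortSum]
  | B =>
    simp only [shortSum]
    rw [hy, toPerm_short hD (by omega) (by omega), Equiv.Perm.one_apply]

/-- The summands of `K_ii` that do not involve `k` commute with `y k`, as do the scalar and the
short reflection. The one remaining pair sum exchanges `y i` and `y k`, so its commutator with `y k`
cancels the commutator of `K_ki` with `y i`. -/
theorem jacobi_diag (a u v : ℂ) {i k : Fin n} (hik : i ≠ k) :
    φ (structureConst ty n a u v i i) * y k + φ (structureConst ty n a u v k i) * y i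
      = y k * φ (structureConst ty n a u v i i) + y i * φ (structureConst ty n a u v k i) := by
  have hk : k ∈ Finset.univ.erase i := Finset.mem_erase.2 ⟨hik.symm, Finset.mem_univ _⟩
  have hrest : ∀ l ∈ (Finset.univ.erase i).erase k,
      φ (pairSum ty n (l + 1) (i + 1)) * y k = y k * φ (pairSum ty n (l + 1) (i + 1)) := by
    intro l hl
    rw [Finset.mem_erase, Finset.mem_erase] at hl
    rw [pairSum_mul φ hD hy hl.2.1, Equiv.swap_apply_of_ne_of_ne (Ne.symm hl.1) hik.symm]
  rw [structureConst, if_pos rfl, structureConst, if_neg hik.symm, ← Finset.add_sum_erase _ _ hk]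
  simp only [map_add, map_smul, map_one, map_sum, add_mul, mul_add, smul_mul_assoc,
    mul_smul_comm, smul_add, one_mul, mul_one, shortSum_mul φ hD hy, Finset.sum_mul,
    Finset.mul_sum, Finset.sum_congr rfl hrest, pairSum_mul φ hD hy hik.symm,
    Equiv.swap_apply_left, Equiv.swap_apply_right]
  abel

/-- When `j` differs from `i` and `k`, the transposition of `i` and `j` fixes `k` and that of `k`
and `j` fixes `i`, so each commutator vanishes separately. The other cases are `jacobi_diag`. -/
theorem jacobi (a u v : ℂ) {i k : Fin n} (j : Fin n) (hik : i ≠ k) :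
    φ (structureConst ty n a u v i j) * y k + φ (structureConst ty n a u v k j) * y i
      = y k * φ (structureConst ty n a u v i j) + y i * φ (structureConst ty n a u v k j) := by
  by_cases h1 : j = i
  · subst h1
    exact jacobi_diag φ hD hy a u v hik
  by_cases h2 : j = k
  · subst h2
    have := jacobi_diag φ hD hy a u v hik.symm
    rw [add_comm, this, add_comm]
  rw [structureConst, if_neg (Ne.symm h1), structureConst, if_neg (Ne.symm h2)]
  simp only [map_smul, smul_mul_assoc, mul_smul_comm]
  rw [pairSum_mul φ hD hy (Ne.symm h1), pairSum_mul φ hD hy (Ne.symm h2),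
    Equiv.swap_apply_of_ne_of_ne hik.symm (Ne.symm h2),
    Equiv.swap_apply_of_ne_of_ne hik (Ne.symm h1)]

end jacobi

end Weyl

/-! ### Naturality of the words and structure constants -/

section naturality

variable {A B : Type*} [Ring A] [Ring B] [Algebra ℂ A] [Algebra ℂ B] (f : A →ₐ[ℂ] B)
  (ty : ClassicalType) (n : ℕ) (t : ℕ → A)

theorem map_brk (i j : ℕ) : f (brk t i j) = brk (fun k => f (t k)) i j := by
  simp only [brk]
  split_ifs <;> simp [map_upProd, map_downProd]

theorem map_barBrk (i j : ℕ) : f (barBrk ty n t i j) = barBrk ty n (fun k => f (t k)) i j := by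
  cases ty <;> simp only [barBrk, barBrkAux] <;> split_ifs <;> simp [map_upProd, map_downProd]

theorem map_barOne (i : ℕ) : f (barOne n t i) = barOne n (fun k => f (t k)) i := by
  simp [barOne, map_upProd, map_downProd]

/-- Needed twice: to evaluate the defining relations in a representation, and, for the inclusion of
a subalgebra, to see that the commutators lie in it. -/
theorem map_offDiag (u : ℂ) (c : Fin n → A) (i j : Fin n) :
    f (offDiag ty n u c t i j) = offDiag ty n u (fun k => f (c k)) (fun k => f (t k)) i j := by
  cases ty <;> simp [offDiag, map_brk, map_barBrk]

theorem map_onDiag (a u v : ℂ) (c : Fin n → A) (i : Fin n) :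
    f (onDiag ty n a u v c t i) = onDiag ty n a u v (fun k => f (c k)) (fun k => f (t k)) i := by
  cases ty <;> simp [onDiag, map_brk, map_barBrk, map_barOne]

theorem map_label {r : ℕ} (g : Fin r → A) (k : ℕ) :
    f (label g k) = label (fun i => f (g i)) k := by
  simp only [label]
  split_ifs <;> simp

end naturality

/-! ### Representations of the decoupled algebra -/

/-- Operators `η_i`, `z_i` together with actions of the Clifford algebra and the Weyl group
such that the Clifford algebra commutes with the Weyl group and anticommutes with the `η_i` and
the `z_i`. -/
structure IsOddRep {ty : ClassicalType} {n : ℕ} (hD : ty = .D → 2 ≤ n) (a u v : ℂ) {E : Type*}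
    [Ring E] [Algebra ℂ E] (C : Cliff n →ₐ[ℂ] E) (ω : Weyl ty n →* E) (η z : Fin n → E) :
    Prop where
  comm : ∀ q g, Commute (C q) (ω g)
  eta_eta : ∀ i j, i ≠ j → η i * η j = -(η j * η i)
  z_z : ∀ i j, i ≠ j → z i * z j = -(z j * z i)
  c_eta : ∀ i j, C (Cliff.gen n i) * η j = -(η j * C (Cliff.gen n i))
  c_z : ∀ i j, C (Cliff.gen n i) * z j = -(z j * C (Cliff.gen n i))
  weyl_eta : ∀ g i, ω g * η i = η (Weyl.toPerm hD g i) * ω g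
  weyl_z : ∀ g i, ω g * z i = z (Weyl.toPerm hD g i) * ω g
  eta_z : ∀ i j, η i * z j + z j * η i
    = -MonoidAlgebra.lift ℂ E (Weyl ty n) ω (Weyl.structureConst ty n a u v i j)

namespace Cliff

variable {ty : ClassicalType} {n : ℕ}

theorem lgen_succ (i : Fin n) : lgen n (i + 1) = gen n i := label_succ _ i

/-- The hypothesis `1 ≤ n` excludes the label `0 = n`, which in type `D` would be caught by the
branch for the last root and give a scalar other than `1`. -/
theorem root_eq_one (hn : 1 ≤ n) {k : ℕ} (hk : ¬(1 ≤ k ∧ k ≤ rank ty n)) : root ty n k = 1 := by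
  unfold root
  rw [if_neg]
  · split_ifs with h
    · subst h
      cases ty with
      | A => rfl
      | B => exact absurd ⟨hn, le_rfl⟩ hk
      | D => exact absurd ⟨hn, le_rfl⟩ hk
    · rfl
  · exact fun h => hk ⟨h.1, Weyl.le_rank_of_lt h.2⟩

theorem lgen_mem_span {i : ℕ} (hi : 1 ≤ i) (hin : i ≤ n) :
    lgen n i ∈ Submodule.span ℂ (Set.range (gen n)) := by
  rw [lgen, label, dif_pos ⟨hi, hin⟩]
  exact Submodule.subset_span (Set.mem_range_self _)

theorem root_mem_span (hD : ty = .D → 2 ≤ n) {k : ℕ} (hk : 1 ≤ k) (hkr : k ≤ rank ty n) :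
    root ty n k ∈ Submodule.span ℂ (Set.range (gen n)) := by
  by_cases hkn : k < n
  · rw [root_of_lt hk hkn]
    exact Submodule.smul_mem _ _
      (Submodule.sub_mem _ (lgen_mem_span hk hkn.le) (lgen_mem_span (by omega) hkn))
  · cases ty with
    | A =>
      simp only [rank] at hkr
      omega
    | B =>
      obtain rfl : k = n := le_antisymm hkr (by omega)
      rw [root_typeB]
      exact lgen_mem_span hk le_rfl
    | D =>
      obtain rfl : k = n := le_antisymm hkr (by omega)
      rw [root_typeD]
      have := hD rfl
      exact Submodule.smul_mem _ _
        (Submodule.add_mem _ (lgen_mem_span (by omega) (by omega)) (lgen_mem_span hk le_rfl))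

theorem mul_eq_neg_of_mem_span {E : Type*} [Ring E] [Algebra ℂ E] (C : Cliff n →ₐ[ℂ] E) {y : E}
    (hy : ∀ i, C (gen n i) * y = -(y * C (gen n i))) {q : Cliff n}
    (hq : q ∈ Submodule.span ℂ (Set.range (gen n))) : C q * y = -(y * C q) := by
  induction hq using Submodule.span_induction with
  | mem x hx =>
    obtain ⟨i, rfl⟩ := hx
    exact hy i
  | zero => simp
  | add x y _ _ hx hy =>
    rw [map_add, add_mul, mul_add, hx, hy]
    abel
  | smul r x _ hx => rw [map_smul, smul_mul_assoc, mul_smul_comm, hx, smul_neg]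

/-- This collapse, with its companion for `1 - c_i c_j`, is what the factors in the commutator
`[η_i, x_j]` are made for: the Clifford part of the whole right-hand side reduces to `c_j`, common
to all terms. -/
theorem one_add_mul_sub {i j : Fin n} (hij : i ≠ j) :
    (1 + gen n i * gen n j) * (gen n i - gen n j) = (-2 : ℂ) • gen n j := by
  have h1 : gen n i * gen n j * gen n i = -gen n j := by
    rw [gen_anticomm hij, neg_mul, mul_assoc, gen_sq, mul_one]
  rw [add_mul, one_mul, mul_sub, h1, mul_assoc, gen_sq, mul_one]
  module

theorem one_sub_mul_add {i j : Fin n} (hij : i ≠ j) :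
    (1 - gen n i * gen n j) * (gen n i + gen n j) = (2 : ℂ) • gen n j := by
  have h1 : gen n i * gen n j * gen n i = -gen n j := by
    rw [gen_anticomm hij, neg_mul, mul_assoc, gen_sq, mul_one]
  rw [sub_mul, one_mul, mul_add, h1, mul_assoc, gen_sq, mul_one]
  module

end Cliff

/-! ### From a decoupled representation back to the defining relations -/

namespace IsOddRep

variable {ty : ClassicalType} {n : ℕ} {hD : ty = .D → 2 ≤ n} {a u v : ℂ} {E : Type*}
  [Ring E] [Algebra ℂ E] {C : Cliff n →ₐ[ℂ] E} {ω : Weyl ty n →* E} {η z : Fin n → E}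
  (h : IsOddRep hD a u v C ω η z)

/-- The product of the actions of the Clifford algebra and the Weyl group. -/
def prodHom (h : IsOddRep hD a u v C ω η z) : Cliff n × Weyl ty n →* E :=
  MonoidHom.noncommCoprod (C : Cliff n →* E) ω h.comm

theorem prodHom_apply (p : Cliff n × Weyl ty n) : h.prodHom p = C p.1 * ω p.2 := rfl

variable (ty n) in
/-- The pair of a simple root and a simple reflection. -/
def rootRefl (k : ℕ) : Cliff n × Weyl ty n := (Cliff.root ty n k, Weyl.refl ty n k)

/-- The action of the spin generators. -/
def spinGen (h : IsOddRep hD a u v C ω η z) (k : ℕ) : E := h.prodHom (rootRefl ty n k)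

theorem label_spinGen (hn : 1 ≤ n) (k : ℕ) :
    label (fun i : Fin (rank ty n) => h.spinGen (i + 1)) k = h.spinGen k := by
  rw [label]
  split_ifs with hk
  · simp [Nat.sub_add_cancel hk.1]
  · rw [spinGen, rootRefl, Cliff.root_eq_one hn hk, Weyl.refl, label, dif_neg hk]
    exact (map_one h.prodHom).symm

/-- The action of the spin generators is a homomorphic image of pairs (root, reflection), so every
word splits into the word in the roots and the word in the reflections. -/
theorem spinGen_linkWord (i j : ℕ) :
    linkWord h.spinGen i j
      = C (linkWord (Cliff.root ty n) i j) * ω (linkWord (Weyl.refl ty n) i j) := by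
  have h1 := map_linkWord (rootRefl ty n) h.prodHom i j
  have h2 := map_linkWord (rootRefl ty n) (MonoidHom.fst _ _) i j
  have h3 := map_linkWord (rootRefl ty n) (MonoidHom.snd _ _) i j
  rw [prodHom_apply] at h1
  exact h1.symm.trans (congrArg₂ (fun q g => C q * ω g) h2 h3)

theorem spinGen_pairWord (b : Cliff n × Weyl ty n) (i j : ℕ) :
    pairWord h.spinGen n (h.prodHom b) i j
      = C (pairWord (Cliff.root ty n) n b.1 i j) * ω (pairWord (Weyl.refl ty n) n b.2 i j) := by
  have h1 := map_pairWord (rootRefl ty n) h.prodHom n b i j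
  have h2 := map_pairWord (rootRefl ty n) (MonoidHom.fst _ _) n b i j
  have h3 := map_pairWord (rootRefl ty n) (MonoidHom.snd _ _) n b i j
  rw [prodHom_apply] at h1
  exact h1.symm.trans (congrArg₂ (fun q g => C q * ω g) h2 h3)

theorem spinGen_pointWord (b : Cliff n × Weyl ty n) (i : ℕ) :
    pointWord h.spinGen n (h.prodHom b) i
      = C (pointWord (Cliff.root ty n) n b.1 i) * ω (pointWord (Weyl.refl ty n) n b.2 i) := by
  have h1 := map_pointWord (rootRefl ty n) h.prodHom n b i
  have h2 := map_pointWord (rootRefl ty n) (MonoidHom.fst _ _) n b i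
  have h3 := map_pointWord (rootRefl ty n) (MonoidHom.snd _ _) n b i
  rw [prodHom_apply] at h1
  exact h1.symm.trans (congrArg₂ (fun q g => C q * ω g) h2 h3)

theorem neg_one_pow_mul_smul {R : Type*} [Ring R] [Algebra ℂ R] (m : ℕ) (x : R) :
    (-1) ^ m * ((-1 : ℂ) ^ m • x) = x := by
  obtain hm | hm := Nat.even_or_odd m <;> simp [hm.neg_one_pow]

/-- The antisymmetry of `[i,j]` is carried by `c_i - c_j`, since the reflection itself is symmetric
in the two indices. -/
theorem brk_spinGen {i j : Fin n} (hij : i ≠ j) :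
    brk h.spinGen (i + 1) (j + 1)
      = invSqrtTwo • (C (Cliff.gen n i - Cliff.gen n j) * ω (Weyl.minus ty n (i + 1) (j + 1))) := by
  have key : ∀ i j : Fin n, i < j →
      (-1) ^ ((j + 1 : ℕ) - (i + 1) - 1) * linkWord h.spinGen (i + 1) (j + 1)
        = invSqrtTwo •
          (C (Cliff.gen n i - Cliff.gen n j) * ω (linkWord (Weyl.refl ty n) (i + 1) (j + 1))) := by
    intro i j hij
    rw [spinGen_linkWord, Cliff.linkWord_root (by omega) (by omega) (by omega), map_smul,
      smul_mul_assoc, neg_one_pow_mul_smul, map_smul, smul_mul_assoc, Cliff.lgen_succ,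
      Cliff.lgen_succ]
  rw [brk, Weyl.minus, symPair]
  split_ifs with h1
  · exact key i j (by omega)
  · have := key j i (by omega)
    rw [linkWord] at this
    rw [this, ← neg_sub (Cliff.gen n i), map_neg, neg_mul, smul_neg, neg_neg]

theorem barBrk_spinGen (hty : ty ≠ .A) {i j : Fin n} (hij : i ≠ j) :
    barBrk ty n h.spinGen (i + 1) (j + 1)
      = invSqrtTwo • (C (Cliff.gen n i + Cliff.gen n j) * ω (Weyl.plus ty n (i + 1) (j + 1))) := by
  have key : ∀ i j : Fin n, i < j →
      barBrkAux ty n h.spinGen (i + 1) (j + 1)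
        = invSqrtTwo • (C (Cliff.gen n i + Cliff.gen n j) *
          ω (pairWord (Weyl.refl ty n) n (Weyl.plusRefl ty n) (i + 1) (j + 1))) := by
    intro i j hij
    cases ty with
    | A => exact absurd rfl hty
    | B =>
      have hb : h.spinGen n * h.spinGen (n - 1) * h.spinGen n
          = h.prodHom (rootRefl .B n n * rootRefl .B n (n - 1) * rootRefl .B n n) := by
        simp only [map_mul, spinGen]
      -- Conjugation by `c_n` sends `c_{n-1} - c_n` to `-(c_{n-1} + c_n)`. The resulting minus sign
      -- accounts for the exponent `j - i`, rather than `j - i - 1`, in type `B`.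
      have hr : (rootRefl .B n n * rootRefl .B n (n - 1) * rootRefl .B n n).1
          = (-invSqrtTwo) • (Cliff.lgen n (n - 1) + Cliff.lgen n n) := by
        simp only [Prod.fst_mul, rootRefl]
        rw [Cliff.root_of_lt (k := n - 1) (by omega) (by omega), mul_smul_comm, smul_mul_assoc,
          mul_sub, sub_mul, Cliff.root_conj_lgen_typeB (by omega) (by omega), if_neg (by omega),
          Nat.sub_add_cancel (by omega), Cliff.root_conj_lgen_typeB (by omega) (by omega),
          if_pos rfl]
        module
      have h1 := h.spinGen_pairWord (rootRefl .B n n * rootRefl .B n (n - 1) * rootRefl .B n n)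
        (i + 1) (j + 1)
      rw [← hb, Cliff.pairWord_root hr (by omega) (by omega) (by omega)] at h1
      simp only [barBrkAux]
      rw [pairWord] at h1
      rw [h1, map_smul, smul_mul_assoc,
        show (j + 1 : ℕ) - (i + 1) = ((j + 1 : ℕ) - (i + 1) - 1) + 1 by omega, pow_succ',
        Nat.add_sub_cancel, mul_assoc, neg_one_pow_mul_smul, map_smul, smul_mul_assoc, neg_smul,
        mul_neg, neg_one_mul, neg_neg, Cliff.lgen_succ, Cliff.lgen_succ]
      rfl
    | D =>
      have h1 := h.spinGen_pairWord (rootRefl .D n n) (i + 1) (j + 1)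
      have h2 : (rootRefl .D n n).1
          = invSqrtTwo • (Cliff.lgen n (n - 1) + Cliff.lgen n n) := Cliff.root_typeD
      rw [Cliff.pairWord_root h2 (by omega) (by omega) (by omega)] at h1
      simp only [barBrkAux]
      rw [pairWord] at h1
      rw [spinGen, h1, map_smul, smul_mul_assoc, neg_one_pow_mul_smul, map_smul, smul_mul_assoc,
        Cliff.lgen_succ, Cliff.lgen_succ]
      rfl
  rw [barBrk, Weyl.plus, symPair]
  split_ifs with h1
  · exact key i j (by omega)
  · rw [key j i (by omega), add_comm]

theorem one_add_mul_brk {i j : Fin n} (hij : i ≠ j) :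
    (1 + C (Cliff.gen n i) * C (Cliff.gen n j)) * brk h.spinGen (i + 1) (j + 1)
      = (-2 * invSqrtTwo) • (C (Cliff.gen n j) * ω (Weyl.minus ty n (i + 1) (j + 1))) := by
  rw [brk_spinGen h hij, mul_smul_comm, ← mul_assoc, ← map_mul, ← map_one C, ← map_add, ← map_mul,
    Cliff.one_add_mul_sub hij, map_smul, smul_mul_assoc, smul_smul, mul_comm]

theorem one_sub_mul_barBrk (hty : ty ≠ .A) {i j : Fin n} (hij : i ≠ j) :
    (1 - C (Cliff.gen n i) * C (Cliff.gen n j)) * barBrk ty n h.spinGen (i + 1) (j + 1)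
      = (2 * invSqrtTwo) • (C (Cliff.gen n j) * ω (Weyl.plus ty n (i + 1) (j + 1))) := by
  rw [barBrk_spinGen h hty hij, mul_smul_comm, ← mul_assoc, ← map_mul, ← map_one C, ← map_sub,
    ← map_mul, Cliff.one_sub_mul_add hij, map_smul, smul_mul_assoc, smul_smul, mul_comm]

theorem pairTerm (hty : ty ≠ .A) {i j : Fin n} (hij : i ≠ j) :
    (1 + C (Cliff.gen n i) * C (Cliff.gen n j)) * brk h.spinGen (i + 1) (j + 1)
      - (1 - C (Cliff.gen n i) * C (Cliff.gen n j)) * barBrk ty n h.spinGen (i + 1) (j + 1)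
      = (-2 * invSqrtTwo) • (C (Cliff.gen n j) *
          MonoidAlgebra.lift ℂ E _ ω (Weyl.pairSum ty n (i + 1) (j + 1))) := by
  rw [one_add_mul_brk h hij, one_sub_mul_barBrk h hty hij, Weyl.pairSum, if_neg hty, map_add,
    MonoidAlgebra.lift_of, MonoidAlgebra.lift_of, mul_add]
  module

theorem pairTerm_typeA (hty : ty = .A) {i j : Fin n} (hij : i ≠ j) :
    (1 + C (Cliff.gen n i) * C (Cliff.gen n j)) * brk h.spinGen (i + 1) (j + 1)
      = (-2 * invSqrtTwo) • (C (Cliff.gen n j) *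
          MonoidAlgebra.lift ℂ E _ ω (Weyl.pairSum ty n (i + 1) (j + 1))) := by
  rw [one_add_mul_brk h hij, Weyl.pairSum, if_pos hty, add_zero, MonoidAlgebra.lift_of]

theorem barOne_spinGen {h' : ClassicalType.B = .D → 2 ≤ n} {C : Cliff n →ₐ[ℂ] E}
    {ω : Weyl .B n →* E} (h : IsOddRep h' a u v C ω η z) (i : Fin n) :
    barOne n h.spinGen (i + 1) = C (Cliff.gen n i) * ω (Weyl.short n (i + 1)) := by
  have h1 : pointWord h.spinGen n (h.spinGen n) (i + 1) = _ :=
    h.spinGen_pointWord (rootRefl .B n n) (i + 1)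
  have h2 : (rootRefl .B n n).1 = Cliff.lgen n n := Cliff.root_typeB
  rw [h2, Cliff.pointWord_root (by omega) (by omega), pointWord] at h1
  rw [barOne, h1, map_smul, smul_mul_assoc, neg_one_pow_mul_smul, Cliff.lgen_succ]
  rfl

theorem offDiag_spinGen {i j : Fin n} (hij : i ≠ j) :
    offDiag ty n u (fun k => C (Cliff.gen n k)) h.spinGen i j
      = C (Cliff.gen n j) *
        MonoidAlgebra.lift ℂ E _ ω (Weyl.structureConst ty n a u v i j) := by
  rw [Weyl.structureConst, if_neg hij, map_smul, mul_smul_comm]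
  cases ty with
  | A =>
    simp only [offDiag]
    rw [pairTerm_typeA h rfl hij, smul_smul, mul_comm]
  | B =>
    simp only [offDiag]
    rw [pairTerm h (by simp) hij, smul_smul, mul_comm]
  | D =>
    simp only [offDiag]
    rw [pairTerm h (by simp) hij, smul_smul, mul_comm]

theorem onDiag_spinGen (i : Fin n) :
    onDiag ty n a u v (fun k => C (Cliff.gen n k)) h.spinGen i
      = C (Cliff.gen n i) *
        MonoidAlgebra.lift ℂ E _ ω (Weyl.structureConst ty n a u v i i) := by
  rw [Weyl.structureConst, if_pos rfl]
  simp only [map_add, map_smul, map_one, map_sum, mul_add, mul_smul_comm, mul_one, Finset.mul_sum]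
  cases ty with
  | A =>
    simp only [onDiag, Weyl.shortSum]
    rw [Finset.sum_congr rfl fun k hk => pairTerm_typeA h rfl (Finset.ne_of_mem_erase hk),
      ← Finset.smul_sum, smul_smul, mul_comm u]
    simp
  | B =>
    simp only [onDiag, Weyl.shortSum]
    rw [Finset.sum_congr rfl fun k hk => pairTerm h (by simp) (Finset.ne_of_mem_erase hk),
      ← Finset.smul_sum, smul_smul, mul_comm u, barOne_spinGen, MonoidAlgebra.lift_of]
  | D =>
    simp only [onDiag, Weyl.shortSum]
    rw [Finset.sum_congr rfl fun k hk => pairTerm h (by simp) (Finset.ne_of_mem_erase hk),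
      ← Finset.smul_sum, smul_smul, mul_comm u]
    simp

theorem spinGen_eq (k : ℕ) :
    h.spinGen k = C (Cliff.root ty n k) * ω (Weyl.refl ty n k) := rfl

theorem spinGen_rel {i j : ℕ} (hi : 1 ≤ i) (hir : i ≤ rank ty n) (hj : 1 ≤ j)
    (hjr : j ≤ rank ty n) :
    (h.spinGen i * h.spinGen j) ^ coxeterExp ty n i j = (-1) ^ (coxeterExp ty n i j + 1) := by
  rw [spinGen, spinGen, ← map_mul, ← map_pow, prodHom_apply, rootRefl, rootRefl, Prod.mk_mul_mk,
    Prod.pow_mk, Cliff.root_rel hD hi hir hj hjr, Weyl.refl_rel hi hir hj hjr]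
  simp

theorem spinGen_mul_c {k : ℕ} (hk : 1 ≤ k) (hkr : k ≤ rank ty n) (j : Fin n) :
    h.spinGen k * C (Cliff.gen n j)
      = -(reflSign ty n k j • (C (Cliff.gen n (reflPerm ty n k j)) * h.spinGen k)) := by
  rw [spinGen_eq, mul_assoc, ← (h.comm _ _).eq, ← mul_assoc, ← map_mul,
    Cliff.root_mul_gen hD hk hkr, map_neg, map_smul, map_mul]
  simp only [neg_mul, smul_mul_assoc, mul_assoc]

/-- A simple root is a linear combination of the `c i`, hence of odd degree, and contributes a
single minus sign; the permutation of the index comes from the Weyl group factor. -/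
theorem spinGen_mul_odd {y : Fin n → E} (hc : ∀ i j, C (Cliff.gen n i) * y j
      = -(y j * C (Cliff.gen n i)))
    (hw : ∀ g i, ω g * y i = y (Weyl.toPerm hD g i) * ω g)
    {k : ℕ} (hk : 1 ≤ k) (hkr : k ≤ rank ty n) (j : Fin n) :
    h.spinGen k * y j = -(y (reflPerm ty n k j) * h.spinGen k) := by
  rw [spinGen_eq, mul_assoc, hw, Weyl.toPerm_refl hD hk hkr, ← mul_assoc,
    Cliff.mul_eq_neg_of_mem_span C (fun i => hc i _) (Cliff.root_mem_span hD hk hkr), neg_mul,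
    mul_assoc]

/-- The generators of the spin double affine Hecke-Clifford algebra in terms of `η`, `z`, the
Clifford algebra and the Weyl group. -/
def onGen (h : IsOddRep hD a u v C ω η z) : Gen ty n → E
  | .x i => C (Cliff.gen n i) * z i
  | .eta i => η i
  | .c i => C (Cliff.gen n i)
  | .t k => h.spinGen (k + 1)

include h in
-- Since `η_i` anticommutes with `c_j`, the commutator with `c_j z_j` is `-c_j` times the
-- anticommutator of `η_i` and `z_j`.
theorem eta_x (i j : Fin n) :
    η i * (C (Cliff.gen n j) * z j) - C (Cliff.gen n j) * z j * η i
      = C (Cliff.gen n j) *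
        MonoidAlgebra.lift ℂ E _ ω (Weyl.structureConst ty n a u v i j) := by
  have h1 : η i * C (Cliff.gen n j) = -(C (Cliff.gen n j) * η i) := by
    rw [h.c_eta, neg_neg]
  rw [← neg_neg (MonoidAlgebra.lift ℂ E _ ω _), ← h.eta_z, ← mul_assoc, h1]
  simp only [neg_mul, mul_neg, mul_add, mul_assoc]
  abel

theorem onGen_rel (hn : 1 ≤ n) {p q : FreeAlgebra ℂ (Gen ty n)} (hpq : Rel ty n a u v p q) :
    FreeAlgebra.lift ℂ h.onGen p = FreeAlgebra.lift ℂ h.onGen q := by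
  have hc : ∀ i j, i ≠ j → C (Cliff.gen n i) * C (Cliff.gen n j)
      = -(C (Cliff.gen n j) * C (Cliff.gen n i)) := by
    intro i j hij
    rw [← map_mul, Cliff.gen_anticomm hij, map_neg, map_mul]
  have hzc : ∀ i j, z i * C (Cliff.gen n j) = -(C (Cliff.gen n j) * z i) := by
    intro i j
    rw [h.c_z, neg_neg]
  have hlab : (fun k => FreeAlgebra.lift ℂ h.onGen (label Gen.ft k)) = h.spinGen := by
    funext k
    rw [map_label, ← h.label_spinGen hn]
    simp only [Gen.ft, FreeAlgebra.lift_ι_apply, onGen]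
  induction hpq with
  | c_sq i =>
    simp only [Gen.fc, map_mul, map_one, FreeAlgebra.lift_ι_apply, onGen]
    rw [← map_mul, Cliff.gen_sq, map_one]
  | c_c i j hij =>
    simp only [Gen.fc, map_mul, map_neg, FreeAlgebra.lift_ι_apply, onGen]
    exact hc i j hij
  | t_t i j =>
    simp only [Gen.ft, map_mul, map_neg, map_pow, map_one, FreeAlgebra.lift_ι_apply, onGen]
    exact h.spinGen_rel (by omega) (by omega) (by omega) (by omega)
  | t_c k j =>
    simp only [Gen.ft, Gen.fc, map_mul, map_neg, map_smul, FreeAlgebra.lift_ι_apply, onGen]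
    exact h.spinGen_mul_c (by omega) (by omega) j
  | e_e i j hij =>
    simp only [Gen.fe, map_mul, map_neg, FreeAlgebra.lift_ι_apply, onGen]
    exact h.eta_eta i j hij
  | x_x i j hij =>
    simp only [Gen.fx, map_mul, FreeAlgebra.lift_ι_apply, onGen]
    -- Interchanging `i` and `j` flips the sign of both the Clifford part and the `z` part, so the
    -- products commute.
    have key : ∀ i j, C (Cliff.gen n i) * z i * (C (Cliff.gen n j) * z j)
        = -(C (Cliff.gen n i) * C (Cliff.gen n j) * (z i * z j)) := by
      intro i j
      rw [mul_assoc, ← mul_assoc (z i), hzc]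
      simp only [neg_mul, mul_neg, mul_assoc]
    rw [key, key, hc i j hij, h.z_z i j hij, neg_mul_neg]
  | c_e i j =>
    simp only [Gen.fc, Gen.fe, map_mul, map_neg, FreeAlgebra.lift_ι_apply, onGen]
    exact h.c_eta i j
  | c_x i j =>
    simp only [Gen.fc, Gen.fx, map_mul, map_smul, FreeAlgebra.lift_ι_apply, onGen]
    rw [mul_assoc _ (z j), hzc]
    split_ifs with hij
    · subst hij
      simp
    · rw [← mul_assoc, hc i j hij]
      simp [mul_assoc]
  | t_x k j =>
    simp only [Gen.ft, Gen.fx, map_mul, map_smul, FreeAlgebra.lift_ι_apply, onGen]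
    -- The minus signs from `c_j` and from `z_j` cancel. Only the sign of the signed permutation,
    -- contributed by `c_j`, remains.
    rw [← mul_assoc, h.spinGen_mul_c (by omega) (by omega), neg_mul, smul_mul_assoc, mul_assoc,
      h.spinGen_mul_odd h.c_z h.weyl_z (by omega) (by omega)]
    simp [mul_assoc]
  | t_e k j =>
    simp only [Gen.ft, Gen.fe, map_mul, map_neg, FreeAlgebra.lift_ι_apply, onGen]
    exact h.spinGen_mul_odd h.c_eta h.weyl_eta (by omega) (by omega) j
  | e_x_off i j hij =>
    rw [map_offDiag, hlab]
    simp only [Gen.fe, Gen.fx, Gen.fc, map_mul, map_sub, FreeAlgebra.lift_ι_apply, onGen]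
    rw [h.eta_x, h.offDiag_spinGen hij]
  | e_x_diag i =>
    rw [map_onDiag, hlab]
    simp only [Gen.fe, Gen.fx, Gen.fc, map_mul, map_sub, FreeAlgebra.lift_ι_apply, onGen]
    rw [h.eta_x, h.onDiag_spinGen]

/-- The action of the spin double affine Hecke-Clifford algebra. -/
def toAlgHom (hn : 1 ≤ n) : SH ty n a u v →ₐ[ℂ] E :=
  RingQuot.liftAlgHom ℂ ⟨FreeAlgebra.lift ℂ h.onGen, fun _ _ => h.onGen_rel hn⟩

theorem toAlgHom_mk (hn : 1 ≤ n) (g : Gen ty n) :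
    h.toAlgHom hn (SH.mk ty n a u v (FreeAlgebra.ι ℂ g)) = h.onGen g := by
  rw [toAlgHom, SH.mk, RingQuot.liftAlgHom_mkAlgHom_apply, FreeAlgebra.lift_ι_apply]

end IsOddRep

/-! ### Actions on the skew-polynomial algebra -/

namespace SkewPoly

variable {n : ℕ}

theorem algHom_ext {A : Type*} [Ring A] [Algebra ℂ A] {f g : SkewPoly n →ₐ[ℂ] A}
    (h : ∀ i, f (gen n i) = g (gen n i)) : f = g := by
  refine AlgHom.ext_of_adjoin_eq_top (adjoin_gen n) ?_
  intro x hx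
  obtain ⟨i, rfl⟩ := hx
  exact h i

variable (n) in
/-- The parity automorphism. -/
def parity : SkewPoly n →ₐ[ℂ] SkewPoly n :=
  lift (fun i => -gen n i) fun i j h =>
    (neg_mul_neg (gen n i) (gen n j)).trans
      ((gen_anticomm h).trans (congrArg Neg.neg (neg_mul_neg (gen n j) (gen n i)).symm))

@[simp]
theorem parity_gen (i : Fin n) : parity n (gen n i) = -gen n i := lift_gen _ _ i

theorem parity_parity (p : SkewPoly n) : parity n (parity n p) = p := by
  have h : (parity n).comp (parity n) = AlgHom.id ℂ _ := algHom_ext fun i => by simp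
  exact DFunLike.congr_fun h p

/-- The automorphism permuting the generators. -/
def perm (π : Equiv.Perm (Fin n)) : SkewPoly n →ₐ[ℂ] SkewPoly n :=
  lift (fun i => gen n (π i)) fun _ _ h => gen_anticomm (π.injective.ne h)

@[simp]
theorem perm_gen (π : Equiv.Perm (Fin n)) (i : Fin n) : perm π (gen n i) = gen n (π i) :=
  lift_gen _ _ i

theorem perm_one (p : SkewPoly n) : perm 1 p = p := by
  have h : perm (1 : Equiv.Perm (Fin n)) = AlgHom.id ℂ _ := algHom_ext fun i => by simp
  exact DFunLike.congr_fun h p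

theorem perm_mul (π ρ : Equiv.Perm (Fin n)) (p : SkewPoly n) :
    perm (π * ρ) p = perm π (perm ρ p) := by
  have h : perm (π * ρ) = (perm π).comp (perm ρ) := algHom_ext fun i => by simp
  exact DFunLike.congr_fun h p

theorem perm_parity (π : Equiv.Perm (Fin n)) (p : SkewPoly n) :
    perm π (parity n p) = parity n (perm π p) := by
  have h : (perm π).comp (parity n) = (parity n).comp (perm π) := algHom_ext fun i => by simp
  exact DFunLike.congr_fun h p

end SkewPoly

theorem Cliff.commute_of_gen {n : ℕ} {E : Type*} [Ring E] [Algebra ℂ E] (C : Cliff n →ₐ[ℂ] E)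
    {y : E} (hy : ∀ i, Commute (C (Cliff.gen n i)) y) (q : Cliff n) : Commute (C q) y := by
  have hq : q ∈ Algebra.adjoin ℂ (Set.range (Cliff.gen n)) := Cliff.adjoin_gen n ▸ Algebra.mem_top
  induction hq using Algebra.adjoin_induction with
  | mem x hx =>
    obtain ⟨i, rfl⟩ := hx
    exact hy i
  | algebraMap r =>
    rw [AlgHom.commutes]
    exact Algebra.commutes r y
  | add x y _ _ hx hy =>
    rw [map_add]
    exact hx.add_left hy
  | mul x y _ _ hx hy =>
    rw [map_mul]
    exact hx.mul_left hy

theorem commute_lift_of {G E : Type*} [Group G] [Ring E] [Algebra ℂ E] {ω : G →* E} {y : E}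
    (hy : ∀ g, Commute y (ω g)) (a : MonoidAlgebra ℂ G) :
    Commute y (MonoidAlgebra.lift ℂ E G ω a) := by
  induction a using MonoidAlgebra.induction_on with
  | of g =>
    rw [MonoidAlgebra.lift_of]
    exact hy g
  | add a b ha hb =>
    rw [map_add]
    exact ha.add_right hb
  | smul r a ha =>
    rw [map_smul]
    exact ha.smul_right r

/-! ### The induced module -/

/-- Actions of the Clifford algebra, the Weyl group and pairwise anticommuting operators `z_i`. -/
structure IsZRep {ty : ClassicalType} {n : ℕ} (hD : ty = .D → 2 ≤ n) {E : Type*}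
    [Ring E] [Algebra ℂ E] (C : Cliff n →ₐ[ℂ] E) (ω : Weyl ty n →* E) (z : Fin n → E) :
    Prop where
  comm : ∀ i g, Commute (C (Cliff.gen n i)) (ω g)
  z_z : ∀ i j, i ≠ j → z i * z j = -(z j * z i)
  c_z : ∀ i j, C (Cliff.gen n i) * z j = -(z j * C (Cliff.gen n i))
  weyl_z : ∀ g i, ω g * z i = z (Weyl.toPerm hD g i) * ω g

namespace Induced

variable {n : ℕ} {N M : Type*} [AddCommGroup N] [Module ℂ N] [AddCommGroup M] [Module ℂ M]
  (τ : (SkewPoly n ⊗[ℂ] N) ≃ₗ[ℂ] M)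

/-- The pure tensor `p ⊗ x`. -/
def mk (p : SkewPoly n) (x : N) : M := τ (p ⊗ₜ x)

/-- The operator `f ⊗ g`. -/
def map (f : SkewPoly n →ₗ[ℂ] SkewPoly n) (g : Module.End ℂ N) : Module.End ℂ M :=
  τ.toLinearMap ∘ₗ TensorProduct.map f g ∘ₗ τ.symm.toLinearMap

@[simp]
theorem map_mk (f : SkewPoly n →ₗ[ℂ] SkewPoly n) (g : Module.End ℂ N) (p : SkewPoly n) (x : N) :
    map τ f g (mk τ p x) = mk τ (f p) (g x) := by
  simp [map, mk]

theorem ext {V : Type*} [AddCommGroup V] [Module ℂ V] {f g : M →ₗ[ℂ] V}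
    (h : ∀ p x, f (mk τ p x) = g (mk τ p x)) : f = g := by
  have h2 : f ∘ₗ τ.toLinearMap = g ∘ₗ τ.toLinearMap := TensorProduct.ext' h
  ext m
  simpa using LinearMap.congr_fun h2 (τ.symm m)

/-- The action of `η_i`. -/
def eta (i : Fin n) : Module.End ℂ M :=
  map τ (LinearMap.mulLeft ℂ (SkewPoly.gen n i)) LinearMap.id

@[simp]
theorem eta_mk (i : Fin n) (p : SkewPoly n) (x : N) :
    eta τ i (mk τ p x) = mk τ (SkewPoly.gen n i * p) x := by
  simp [eta]

/-- The vectors `1 ⊗ x` generate the module under the `η_i`. A relation is thus checked on them and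
then shown to persist under each `η_i`, where the cross relation can be used. -/
theorem ext_gen {V : Type*} [AddCommGroup V] [Module ℂ V] {f g : M →ₗ[ℂ] V}
    (h1 : ∀ x, f (mk τ 1 x) = g (mk τ 1 x))
    (h2 : ∀ i m, f m = g m → f (eta τ i m) = g (eta τ i m)) : f = g := by
  refine ext τ fun p x => ?_
  let e : SkewPoly n →ₗ[ℂ] M := τ.toLinearMap ∘ₗ (TensorProduct.mk ℂ (SkewPoly n) N).flip x
  refine mem_of_adjoin_eq_top (SkewPoly.adjoin_gen n)
    ((LinearMap.eqLocus f g).comap e) ?_ ?_ p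
  · exact h1 x
  · intro i p hp
    have := h2 i (mk τ p x) hp
    rwa [eta_mk] at this

theorem mk_neg (p : SkewPoly n) (x : N) : mk τ (-p) x = -mk τ p x :=
  map_neg (τ.toLinearMap ∘ₗ (TensorProduct.mk ℂ (SkewPoly n) N).flip x) p

theorem mk_neg_right (p : SkewPoly n) (x : N) : mk τ p (-x) = -mk τ p x :=
  map_neg (τ.toLinearMap ∘ₗ TensorProduct.mk ℂ (SkewPoly n) N p) x

theorem mk_neg_mul (p q : SkewPoly n) (x : N) : mk τ (-p * q) x = -mk τ (p * q) x :=
  (congrArg (mk τ · x) (neg_mul p q)).trans (mk_neg τ _ x)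

theorem eta_eta (i j : Fin n) (h : i ≠ j) : eta τ i * eta τ j = -(eta τ j * eta τ i) := by
  refine ext τ fun p x => ?_
  simp only [Module.End.mul_apply, LinearMap.neg_apply, eta_mk]
  rw [← mul_assoc, SkewPoly.gen_anticomm h, mk_neg_mul, mul_assoc]

/-! ### Operators on the induced module -/

section actions

variable {ty : ClassicalType} {hD : ty = .D → 2 ≤ n} {C : Cliff n →ₐ[ℂ] Module.End ℂ N}
  {ω : Weyl ty n →* Module.End ℂ N} {z : Fin n → Module.End ℂ N} (a u v : ℂ)

variable (C) in
/-- The action of `c_i`. -/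
def cliffGen (i : Fin n) : Module.End ℂ M :=
  map τ (SkewPoly.parity n).toLinearMap (C (Cliff.gen n i))

@[simp]
theorem cliffGen_mk (i : Fin n) (p : SkewPoly n) (x : N) :
    cliffGen τ C i (mk τ p x) = mk τ (SkewPoly.parity n p) (C (Cliff.gen n i) x) := by
  simp [cliffGen]

variable (C) in
/-- The action of the Clifford algebra. -/
def cliff : Cliff n →ₐ[ℂ] Module.End ℂ M :=
  Cliff.lift (cliffGen τ C)
    (fun i => ext τ fun p x => by
      simp only [Module.End.mul_apply, cliffGen_mk, SkewPoly.parity_parity, Module.End.one_apply]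
      rw [← Module.End.mul_apply, ← map_mul, Cliff.gen_sq, map_one, Module.End.one_apply])
    (fun i j h => ext τ fun p x => by
      simp only [Module.End.mul_apply, cliffGen_mk, SkewPoly.parity_parity, LinearMap.neg_apply]
      rw [← Module.End.mul_apply, ← map_mul, Cliff.gen_anticomm h, map_neg, map_mul,
        LinearMap.neg_apply, mk_neg_right, Module.End.mul_apply])

@[simp]
theorem cliff_gen_mk (i : Fin n) (p : SkewPoly n) (x : N) :
    cliff τ C (Cliff.gen n i) (mk τ p x)
      = mk τ (SkewPoly.parity n p) (C (Cliff.gen n i) x) := by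
  simp [cliff]

variable (hD ω) in
/-- The action of the Weyl group. -/
def weyl : Weyl ty n →* Module.End ℂ M where
  toFun g := map τ (SkewPoly.perm (Weyl.toPerm hD g)).toLinearMap (ω g)
  map_one' := ext τ fun p x => by simp [SkewPoly.perm_one]
  map_mul' g h := ext τ fun p x => by simp [SkewPoly.perm_mul]

@[simp]
theorem weyl_mk (g : Weyl ty n) (p : SkewPoly n) (x : N) :
    weyl τ hD ω g (mk τ p x) = mk τ (SkewPoly.perm (Weyl.toPerm hD g) p) (ω g x) := by
  simp [weyl]

theorem weyl_eta (g : Weyl ty n) (i : Fin n) :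
    weyl τ hD ω g * eta τ i = eta τ (Weyl.toPerm hD g i) * weyl τ hD ω g :=
  ext τ fun p x => by simp

theorem cliff_eta (i j : Fin n) :
    cliff τ C (Cliff.gen n i) * eta τ j = -(eta τ j * cliff τ C (Cliff.gen n i)) :=
  ext τ fun p x => by simp [mk_neg_mul]

theorem cliff_weyl (hN : IsZRep hD C ω z) (q : Cliff n) (g : Weyl ty n) :
    Commute (cliff τ C q) (weyl τ hD ω g) := by
  refine Cliff.commute_of_gen _ (fun i => ext τ fun p x => ?_) q
  simp only [Module.End.mul_apply, cliff_gen_mk, weyl_mk, SkewPoly.perm_parity]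
  rw [← Module.End.mul_apply, (hN.comm i g).eq, Module.End.mul_apply]

variable (hD ω) in
/-- The operator by which `-[η_i, z_j]₊` acts. -/
def const (i j : Fin n) : Module.End ℂ M :=
  MonoidAlgebra.lift ℂ _ _ (weyl τ hD ω) (Weyl.structureConst ty n a u v i j)

theorem const_comm (i j : Fin n) : const τ hD ω a u v i j = const τ hD ω a u v j i := by
  rw [const, const, Weyl.structureConst_comm]

theorem weyl_const (g : Weyl ty n) (i j : Fin n) :
    weyl τ hD ω g * const τ hD ω a u v i j
      = const τ hD ω a u v (Weyl.toPerm hD g i) (Weyl.toPerm hD g j) * weyl τ hD ω g := by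
  have h := congrArg (MonoidAlgebra.lift ℂ (Module.End ℂ M) _ (weyl τ hD ω))
    (Weyl.structureConst_equivariant hD a u v g i j)
  rwa [map_mul, map_mul, MonoidAlgebra.lift_of] at h

theorem const_jacobi {y : Fin n → Module.End ℂ M}
    (hy : ∀ g i, weyl τ hD ω g * y i = y (Weyl.toPerm hD g i) * weyl τ hD ω g)
    {i k : Fin n} (j : Fin n) (hik : i ≠ k) :
    const τ hD ω a u v i j * y k + const τ hD ω a u v k j * y i
      = y k * const τ hD ω a u v i j + y i * const τ hD ω a u v k j := by
  refine Weyl.jacobi (MonoidAlgebra.lift ℂ (Module.End ℂ M) _ (weyl τ hD ω)) hD ?_ a u v j hik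
  intro g i
  rw [MonoidAlgebra.lift_of, hy]

/-- The matrices `[[-η_i, -K_{ij}], [0, η_i]]`. -/
def etaMatrix (hD : ty = .D → 2 ≤ n) (ω : Weyl ty n →* Module.End ℂ N) (j i : Fin n) :
    Matrix (Fin 2) (Fin 2) (Module.End ℂ M) :=
  !![-eta τ i, -const τ hD ω a u v i j; 0, eta τ i]

/-- The diagonal entries express the anticommutation of the `η_i`, and the corner entry is the
Jacobi identity with `y = η`. Hence the matrices define a homomorphism from the skew polynomials,
whose first row gives the action of `z_j`. -/
theorem etaMatrix_anticomm (j i k : Fin n) (hik : i ≠ k) :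
    etaMatrix τ a u v hD ω j i * etaMatrix τ a u v hD ω j k
      = -(etaMatrix τ a u v hD ω j k * etaMatrix τ a u v hD ω j i) := by
  have h1 := eta_eta τ i k hik
  have h2 := const_jacobi τ a u v (weyl_eta τ (hD := hD) (ω := ω)) j hik
  have h3 : eta τ i * const τ hD ω a u v k j - const τ hD ω a u v i j * eta τ k
      = -(eta τ k * const τ hD ω a u v i j - const τ hD ω a u v k j * eta τ i) := by
    rw [← sub_eq_zero] at h2 ⊢
    rw [← neg_eq_zero, ← h2]
    abel
  refine Matrix.ext fun r s => ?_
  fin_cases r <;> fin_cases s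
  · simp [etaMatrix, Matrix.mul_apply, Fin.sum_univ_two, h1]
  · simpa [etaMatrix, Matrix.mul_apply, Fin.sum_univ_two, sub_eq_add_neg] using h3
  · simp [etaMatrix, Matrix.mul_apply, Fin.sum_univ_two]
  · simp [etaMatrix, Matrix.mul_apply, Fin.sum_univ_two, h1]

/-- The twisted derivation that describes the action of `z_j` on skew polynomials. -/
def twist (hD : ty = .D → 2 ≤ n) (ω : Weyl ty n →* Module.End ℂ N) (j : Fin n) :
    SkewPoly n →ₐ[ℂ] Matrix (Fin 2) (Fin 2) (Module.End ℂ M) :=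
  SkewPoly.lift (etaMatrix τ a u v hD ω j) (etaMatrix_anticomm τ a u v j)

theorem twist_gen_mul (j i : Fin n) (p : SkewPoly n) :
    twist τ a u v hD ω j (SkewPoly.gen n i * p)
      = etaMatrix τ a u v hD ω j i * twist τ a u v hD ω j p := by
  rw [map_mul, twist, SkewPoly.lift_gen]

/-- The matrices are upper triangular, and the lower right entry is left multiplication by `p`. This
is what turns the matrix recursion in the first row into the cross relation for `z_j`. -/
theorem twist_lower (j : Fin n) (p : SkewPoly n) (x : N) :
    twist τ a u v hD ω j p 1 0 = 0 ∧ twist τ a u v hD ω j p 1 1 (mk τ 1 x) = mk τ p x := by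
  let f : SkewPoly n →ₗ[ℂ] Module.End ℂ M :=
    (LinearMap.proj 0 ∘ₗ LinearMap.proj 1) ∘ₗ (twist τ a u v hD ω j).toLinearMap
  let g : SkewPoly n →ₗ[ℂ] M :=
    LinearMap.applyₗ (mk τ 1 x) ∘ₗ
      (LinearMap.proj 1 ∘ₗ LinearMap.proj 1) ∘ₗ (twist τ a u v hD ω j).toLinearMap
  let e : SkewPoly n →ₗ[ℂ] M := τ.toLinearMap ∘ₗ (TensorProduct.mk ℂ (SkewPoly n) N).flip x
  have h := mem_of_adjoin_eq_top (SkewPoly.adjoin_gen n)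
    (LinearMap.eqLocus f 0 ⊓ LinearMap.eqLocus g e) ?_ ?_ p
  · exact h
  · constructor
    · change twist τ a u v hD ω j 1 1 0 = 0
      rw [map_one]
      rfl
    · change twist τ a u v hD ω j 1 1 1 (mk τ 1 x) = mk τ 1 x
      rw [map_one]
      rfl
  · rintro i p ⟨h1, h2⟩
    change twist τ a u v hD ω j p 1 0 = 0 at h1
    change twist τ a u v hD ω j p 1 1 (mk τ 1 x) = mk τ p x at h2
    constructor
    · change twist τ a u v hD ω j (SkewPoly.gen n i * p) 1 0 = 0
      rw [twist_gen_mul, Matrix.mul_apply, Fin.sum_univ_two, h1]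
      simp [etaMatrix]
    · change twist τ a u v hD ω j (SkewPoly.gen n i * p) 1 1 (mk τ 1 x) = mk τ _ x
      rw [twist_gen_mul, Matrix.mul_apply, Fin.sum_univ_two, LinearMap.add_apply,
        Module.End.mul_apply, Module.End.mul_apply, h2]
      simp [etaMatrix]

/-- The action of `z_j`. -/
def zOp (hD : ty = .D → 2 ≤ n) (ω : Weyl ty n →* Module.End ℂ N) (z : Fin n → Module.End ℂ N)
    (j : Fin n) : Module.End ℂ M :=
  TensorProduct.lift (LinearMap.mk₂ ℂ
    (fun p x => twist τ a u v hD ω j p 0 0 (mk τ 1 (z j x)) + twist τ a u v hD ω j p 0 1 (mk τ 1 x))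
    (fun p q x => by
      simp only [map_add, Matrix.add_apply, LinearMap.add_apply]
      abel)
    (fun r p x => by simp only [map_smul, Matrix.smul_apply, LinearMap.smul_apply, smul_add])
    (fun p x y => by
      simp only [map_add, mk, TensorProduct.tmul_add]
      abel)
    (fun r p x => by
      simp only [map_smul, mk, TensorProduct.tmul_smul, smul_add])) ∘ₗ τ.symm.toLinearMap

theorem zOp_mk (j : Fin n) (p : SkewPoly n) (x : N) :
    zOp τ a u v hD ω z j (mk τ p x)
      = twist τ a u v hD ω j p 0 0 (mk τ 1 (z j x)) +
        twist τ a u v hD ω j p 0 1 (mk τ 1 x) := by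
  simp [zOp, mk]

@[simp]
theorem zOp_mk_one (j : Fin n) (x : N) :
    zOp τ a u v hD ω z j (mk τ 1 x) = mk τ 1 (z j x) := by
  rw [zOp_mk, map_one]
  simp

/-- Read off the first row of the matrix product: the entry `-η_i` moves `η_i` past `z_j`, and the
corner entry, meeting the lower right block, contributes `-K_ij`. -/
theorem zOp_mul_eta (j i : Fin n) :
    zOp τ a u v hD ω z j * eta τ i
      = -(eta τ i * zOp τ a u v hD ω z j) - const τ hD ω a u v i j := by
  refine ext τ fun p x => ?_
  obtain ⟨h1, h2⟩ := twist_lower τ a u v (hD := hD) (ω := ω) j p x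
  simp only [Module.End.mul_apply, LinearMap.sub_apply, LinearMap.neg_apply, eta_mk, zOp_mk,
    twist_gen_mul, Matrix.mul_apply, Fin.sum_univ_two, LinearMap.add_apply, h1, h2, map_add]
  simp [etaMatrix]
  abel

theorem zOp_eta_apply (j i : Fin n) (m : M) :
    zOp τ a u v hD ω z j (eta τ i m)
      = -eta τ i (zOp τ a u v hD ω z j m) - const τ hD ω a u v i j m :=
  LinearMap.congr_fun (zOp_mul_eta τ a u v j i) m

theorem weyl_zOp (hN : IsZRep hD C ω z) (g : Weyl ty n) (j : Fin n) :
    weyl τ hD ω g * zOp τ a u v hD ω z j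
      = zOp τ a u v hD ω z (Weyl.toPerm hD g j) * weyl τ hD ω g := by
  refine ext_gen τ (fun x => ?_) fun i m h => ?_
  · simp only [Module.End.mul_apply, zOp_mk_one, weyl_mk, map_one]
    rw [← Module.End.mul_apply, hN.weyl_z, Module.End.mul_apply]
  · have h1 := LinearMap.congr_fun (weyl_eta τ (hD := hD) (ω := ω) g i)
    have h2 := LinearMap.congr_fun (weyl_const τ (hD := hD) (ω := ω) a u v g i j)
    simp only [Module.End.mul_apply] at h h1 h2 ⊢
    rw [zOp_eta_apply, map_sub, map_neg, h1, h, h2, h1, zOp_eta_apply]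

theorem cliff_zOp (hN : IsZRep hD C ω z) (k j : Fin n) :
    cliff τ C (Cliff.gen n k) * zOp τ a u v hD ω z j
      = -(zOp τ a u v hD ω z j * cliff τ C (Cliff.gen n k)) := by
  refine ext_gen τ (fun x => ?_) fun i m h => ?_
  · simp only [Module.End.mul_apply, zOp_mk_one, cliff_gen_mk, map_one, LinearMap.neg_apply]
    rw [← Module.End.mul_apply, hN.c_z, LinearMap.neg_apply, mk_neg_right, Module.End.mul_apply]
  · have h1 := LinearMap.congr_fun (cliff_eta τ (C := C) k i)
    have h2 := LinearMap.congr_fun (commute_lift_of (cliff_weyl τ hN (Cliff.gen n k))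
      (Weyl.structureConst ty n a u v i j)).eq m
    simp only [Module.End.mul_apply, LinearMap.neg_apply] at h h1 h2 ⊢
    rw [zOp_eta_apply, map_sub, map_neg, h1, h, h1, map_neg (zOp τ a u v hD ω z j),
      zOp_eta_apply, map_neg (eta τ i), const, h2]
    abel

/-- Moving both operators past `η_i` leaves the error terms of the Jacobi identity with `y = z`,
once the symmetry of `K` has brought its indices into the same order. -/
theorem zOp_zOp (hN : IsZRep hD C ω z) (j k : Fin n) (hjk : j ≠ k) :
    zOp τ a u v hD ω z j * zOp τ a u v hD ω z k
      = -(zOp τ a u v hD ω z k * zOp τ a u v hD ω z j) := by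
  refine ext_gen τ (fun x => ?_) fun i m h => ?_
  · simp only [Module.End.mul_apply, zOp_mk_one, LinearMap.neg_apply]
    rw [← Module.End.mul_apply, hN.z_z j k hjk, LinearMap.neg_apply, mk_neg_right,
      Module.End.mul_apply]
  · have h1 := LinearMap.congr_fun (const_jacobi τ a u v (weyl_zOp τ a u v hN) i hjk) m
    simp only [Module.End.mul_apply, LinearMap.neg_apply, LinearMap.add_apply] at h h1 ⊢
    rw [const_comm τ a u v j, const_comm τ a u v k] at h1
    simp only [zOp_eta_apply, map_sub, map_neg, h]
    rw [← sub_eq_zero] at h1 ⊢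
    rw [← h1]
    abel

/-- The induced module carries the decoupled relations. -/
theorem isOddRep (hN : IsZRep hD C ω z) :
    IsOddRep hD a u v (cliff τ C) (weyl τ hD ω) (eta τ) (zOp τ a u v hD ω z) where
  comm := cliff_weyl τ hN
  eta_eta := eta_eta τ
  z_z := zOp_zOp τ a u v hN
  c_eta := cliff_eta τ
  c_z := cliff_zOp τ a u v hN
  weyl_eta := weyl_eta τ
  weyl_z := weyl_zOp τ a u v hN
  eta_z i j := by
    rw [zOp_mul_eta, const]
    abel

end actions

end Induced

/-! ### The fibre -/

/-- The space `𝒞 ⊗ 𝒞 ⊗ ℂW⁻ ⊗ ℂ[x_1, …, x_n]`. -/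
def Fiber (ty : ClassicalType) (n : ℕ) : Type :=
  Cliff n ⊗[ℂ] (Cliff n ⊗[ℂ] (SpinWeyl ty n ⊗[ℂ] MvPolynomial (Fin n) ℂ))

namespace Fiber

variable {ty : ClassicalType} {n : ℕ}

instance : AddCommGroup (Fiber ty n) :=
  inferInstanceAs (AddCommGroup
    (Cliff n ⊗[ℂ] (Cliff n ⊗[ℂ] (SpinWeyl ty n ⊗[ℂ] MvPolynomial (Fin n) ℂ))))

instance : Module ℂ (Fiber ty n) :=
  inferInstanceAs (Module ℂ
    (Cliff n ⊗[ℂ] (Cliff n ⊗[ℂ] (SpinWeyl ty n ⊗[ℂ] MvPolynomial (Fin n) ℂ))))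

/-- The pure tensors. -/
def mk (q r : Cliff n) (s : SpinWeyl ty n) (p : MvPolynomial (Fin n) ℂ) : Fiber ty n :=
  q ⊗ₜ[ℂ] (r ⊗ₜ[ℂ] (s ⊗ₜ[ℂ] p))

theorem ext {V : Type*} [AddCommGroup V] [Module ℂ V] {f g : Fiber ty n →ₗ[ℂ] V}
    (h : ∀ q r s p, f (mk q r s p) = g (mk q r s p)) : f = g := by
  refine TensorProduct.ext' fun q w => ?_
  induction w using TensorProduct.induction_on with
  | zero =>
    rw [TensorProduct.tmul_zero]
    exact (map_zero f).trans (map_zero g).symm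
  | add x y hx hy =>
    rw [TensorProduct.tmul_add]
    exact (map_add f _ _).trans ((congrArg₂ (· + ·) hx hy).trans (map_add g _ _).symm)
  | tmul r w =>
    induction w using TensorProduct.induction_on with
    | zero =>
      rw [TensorProduct.tmul_zero, TensorProduct.tmul_zero]
      exact (map_zero f).trans (map_zero g).symm
    | add x y hx hy =>
      rw [TensorProduct.tmul_add, TensorProduct.tmul_add]
      exact (map_add f _ _).trans ((congrArg₂ (· + ·) hx hy).trans (map_add g _ _).symm)
    | tmul s p => exact h q r s p

/-- Pure tensors as a linear function of the first factor. -/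
def mkₗ (r : Cliff n) (s : SpinWeyl ty n) (p : MvPolynomial (Fin n) ℂ) :
    Cliff n →ₗ[ℂ] Fiber ty n :=
  (TensorProduct.mk ℂ (Cliff n)
    (Cliff n ⊗[ℂ] (SpinWeyl ty n ⊗[ℂ] MvPolynomial (Fin n) ℂ))).flip (r ⊗ₜ[ℂ] (s ⊗ₜ[ℂ] p))

theorem mk_neg (q r : Cliff n) (s : SpinWeyl ty n) (p : MvPolynomial (Fin n) ℂ) :
    mk (-q) r s p = -mk q r s p := map_neg (mkₗ r s p) q

theorem mk_neg_neg (q r : Cliff n) (s : SpinWeyl ty n) (p : MvPolynomial (Fin n) ℂ) :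
    mk q (-r) (-s) p = mk q r s p := by
  have h : (-r) ⊗ₜ[ℂ] ((-s) ⊗ₜ[ℂ] p) = r ⊗ₜ[ℂ] (s ⊗ₜ[ℂ] p) := by
    have h1 : (-s) ⊗ₜ[ℂ] p = -(s ⊗ₜ[ℂ] p) := TensorProduct.neg_tmul s p
    have h2 : -r = (-1 : ℂ) • r := (neg_one_smul ℂ r).symm
    have h3 : (-s) ⊗ₜ[ℂ] p = (-1 : ℂ) • (s ⊗ₜ[ℂ] p) := h1.trans (neg_one_smul ℂ (s ⊗ₜ[ℂ] p)).symm
    rw [h2, h3, TensorProduct.smul_tmul_smul]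
    norm_num
  exact congrArg (q ⊗ₜ[ℂ] ·) h

/-- The tensor product of four operators. -/
def op (f g : Cliff n →ₗ[ℂ] Cliff n) (h : SpinWeyl ty n →ₗ[ℂ] SpinWeyl ty n)
    (k : MvPolynomial (Fin n) ℂ →ₗ[ℂ] MvPolynomial (Fin n) ℂ) : Module.End ℂ (Fiber ty n) :=
  TensorProduct.map f (TensorProduct.map g (TensorProduct.map h k))

@[simp]
theorem op_mk (f g : Cliff n →ₗ[ℂ] Cliff n) (h : SpinWeyl ty n →ₗ[ℂ] SpinWeyl ty n)
    (k : MvPolynomial (Fin n) ℂ →ₗ[ℂ] MvPolynomial (Fin n) ℂ) (q r : Cliff n)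
    (s : SpinWeyl ty n) (p : MvPolynomial (Fin n) ℂ) :
    op f g h k (mk q r s p) = mk (f q) (g r) (h s) (k p) := rfl

variable (ty n) in
/-- Left multiplication on the first factor. -/
def cliff : Cliff n →ₐ[ℂ] Module.End ℂ (Fiber ty n) :=
  AlgHom.ofLinearMap
    { toFun := fun q => op (LinearMap.mulLeft ℂ q) LinearMap.id LinearMap.id LinearMap.id
      map_add' := fun q q' => ext fun r _ _ _ => by
        simp only [op_mk, LinearMap.add_apply, LinearMap.mulLeft_apply, add_mul]
        exact map_add (mkₗ _ _ _) _ _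
      map_smul' := fun a q => ext fun r _ _ _ => by
        simp only [op_mk, LinearMap.smul_apply, LinearMap.mulLeft_apply, smul_mul_assoc]
        exact map_smul (mkₗ _ _ _) _ _ }
    (ext fun _ _ _ _ => by simp)
    (fun q q' => ext fun _ _ _ _ => by simp)

@[simp]
theorem cliff_mk (a q r : Cliff n) (s : SpinWeyl ty n) (p : MvPolynomial (Fin n) ℂ) :
    cliff ty n a (mk q r s p) = mk (a * q) r s p := rfl

variable (ty n) in
/-- The action of a simple reflection. -/
def refl (k : ℕ) : Module.End ℂ (Fiber ty n) :=
  op LinearMap.id (LinearMap.mulRight ℂ (Cliff.root ty n k))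
    (LinearMap.mulLeft ℂ (label (SpinWeyl.gen ty n) k)) LinearMap.id

@[simp]
theorem refl_mk (k : ℕ) (q r : Cliff n) (s : SpinWeyl ty n) (p : MvPolynomial (Fin n) ℂ) :
    refl ty n k (mk q r s p)
      = mk q (r * Cliff.root ty n k) (label (SpinWeyl.gen ty n) k * s) p := rfl

/-- The roots act on their factor from the right, so their product appears in the opposite order. -/
theorem refl_mul_pow_mk (i j m : ℕ) (q r : Cliff n) (s : SpinWeyl ty n)
    (p : MvPolynomial (Fin n) ℂ) :
    ((refl ty n i * refl ty n j) ^ m) (mk q r s p)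
      = mk q (r * (Cliff.root ty n j * Cliff.root ty n i) ^ m)
          ((label (SpinWeyl.gen ty n) i * label (SpinWeyl.gen ty n) j) ^ m * s) p := by
  induction m with
  | zero => simp
  | succ m ih =>
    rw [pow_succ', Module.End.mul_apply, ih, Module.End.mul_apply, refl_mk, refl_mk,
      pow_succ (Cliff.root ty n j * _), pow_succ' (label _ i * _)]
    simp only [mul_assoc]

/-- Roots and spin generators satisfy the same relation, with the same sign `(-1) ^ (m + 1)`. Acting
on two tensor factors at once, the two signs cancel and an honest Coxeter relation results. -/
theorem refl_rel (hD : ty = .D → 2 ≤ n) {i j : ℕ} (hi : 1 ≤ i) (hir : i ≤ rank ty n)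
    (hj : 1 ≤ j) (hjr : j ≤ rank ty n) :
    (refl ty n i * refl ty n j) ^ coxeterExp ty n i j = 1 := by
  refine ext fun q r s p => ?_
  have h1 := Cliff.root_rel hD hj hjr hi hir
  have h2 : (label (SpinWeyl.gen ty n) i * label (SpinWeyl.gen ty n) j) ^ coxeterExp ty n i j
      = (-1) ^ (coxeterExp ty n i j + 1) := by
    have := SpinWeyl.gen_rel (ty := ty) (n := n) ⟨i - 1, by omega⟩ ⟨j - 1, by omega⟩
    simp only [Nat.sub_add_cancel hi, Nat.sub_add_cancel hj] at this
    rwa [label, dif_pos ⟨hi, hir⟩, label, dif_pos ⟨hj, hjr⟩]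
  rw [Cliff.coxeterExp_comm] at h1
  rw [refl_mul_pow_mk, h1, Module.End.one_apply]
  obtain hm | hm := Nat.even_or_odd (coxeterExp ty n i j + 1)
  · rw [h2.trans (hm.neg_one_pow (α := SpinWeyl ty n)), hm.neg_one_pow, mul_one, one_mul]
  · have h3 := congrArg (· * s) (h2.trans (hm.neg_one_pow (α := SpinWeyl ty n)))
    rw [hm.neg_one_pow, mul_neg_one, h3.trans (neg_one_mul s), mk_neg_neg]

theorem refl_sq (hn : 1 ≤ n) (hD : ty = .D → 2 ≤ n) (k : ℕ) :
    refl ty n k * refl ty n k = 1 := by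
  by_cases hk : 1 ≤ k ∧ k ≤ rank ty n
  · have h := refl_rel hD hk.1 hk.2 hk.1 hk.2
    rwa [show coxeterExp ty n k k = 1 from if_pos rfl, pow_one] at h
  · refine ext fun q r s p => ?_
    simp [Cliff.root_eq_one hn hk, label, dif_neg hk]

/-- The action of a simple reflection, as an invertible operator. -/
def reflUnit (hn : 1 ≤ n) (hD : ty = .D → 2 ≤ n) (k : ℕ) : (Module.End ℂ (Fiber ty n))ˣ :=
  ⟨refl ty n k, refl ty n k, refl_sq hn hD k, refl_sq hn hD k⟩

/-- The action of the Weyl group. -/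
def weyl (hn : 1 ≤ n) (hD : ty = .D → 2 ≤ n) : Weyl ty n →* Module.End ℂ (Fiber ty n) :=
  (Units.coeHom _).comp (Weyl.lift (reflUnit hn hD) fun i j hi hir hj hjr => by
    ext1
    simpa [reflUnit] using refl_rel hD hi hir hj hjr)

theorem weyl_refl (hn : 1 ≤ n) (hD : ty = .D → 2 ≤ n) {k : ℕ} (hk : 1 ≤ k)
    (hkr : k ≤ rank ty n) : weyl hn hD (Weyl.refl ty n k) = refl ty n k := by
  rw [weyl, MonoidHom.comp_apply, Weyl.lift_refl _ _ hk hkr]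
  rfl

variable (ty n) in
/-- The action of the anticommuting variables. -/
def z (i : Fin n) : Module.End ℂ (Fiber ty n) :=
  op (LinearMap.mulRight ℂ (Cliff.gen n i) ∘ₗ CliffordAlgebra.involute.toLinearMap)
    LinearMap.id LinearMap.id (LinearMap.mulLeft ℂ (MvPolynomial.X i))

@[simp]
theorem z_mk (i : Fin n) (q r : Cliff n) (s : SpinWeyl ty n) (p : MvPolynomial (Fin n) ℂ) :
    z ty n i (mk q r s p)
      = mk (CliffordAlgebra.involute q * Cliff.gen n i) r s (MvPolynomial.X i * p) := rfl

theorem _root_.SpinDaHCa.Cliff.involute_gen (i : Fin n) :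
    CliffordAlgebra.involute (Cliff.gen n i) = -Cliff.gen n i :=
  CliffordAlgebra.involute_ι _

/-- The polynomial factors commute, and the involution contributes the same sign in both orders. The
anticommutation is that of right multiplication by the `c i`. -/
theorem z_z (i j : Fin n) (hij : i ≠ j) : z ty n i * z ty n j = -(z ty n j * z ty n i) := by
  refine ext fun q r s p => ?_
  simp only [Module.End.mul_apply, z_mk, LinearMap.neg_apply, map_mul, Cliff.involute_gen,
    CliffordAlgebra.involute_involute]
  rw [← mk_neg, mul_left_comm (MvPolynomial.X i), mul_assoc q, mul_assoc q, neg_mul, neg_mul,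
    Cliff.gen_anticomm hij, neg_neg, mul_neg]

theorem cliff_z (i j : Fin n) :
    cliff ty n (Cliff.gen n i) * z ty n j = -(z ty n j * cliff ty n (Cliff.gen n i)) := by
  refine ext fun q r s p => ?_
  simp only [Module.End.mul_apply, z_mk, cliff_mk, LinearMap.neg_apply, map_mul,
    Cliff.involute_gen]
  rw [← mk_neg, neg_mul, neg_mul, neg_neg, mul_assoc]

theorem cliff_weyl (hn : 1 ≤ n) (hD : ty = .D → 2 ≤ n) (q : Cliff n) (g : Weyl ty n) :
    Commute (cliff ty n q) (weyl hn hD g) := by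
  induction g using Weyl.induction with
  | h1 => rw [map_one]; exact Commute.one_right _
  | hmul k hk hkr g hg =>
    rw [map_mul, weyl_refl hn hD hk hkr]
    exact Commute.mul_right (ext fun _ _ _ _ => by simp) hg

theorem weyl_z (hn : 1 ≤ n) (hD : ty = .D → 2 ≤ n) (g : Weyl ty n) (i : Fin n) :
    Commute (weyl hn hD g) (z ty n i) := by
  induction g using Weyl.induction with
  | h1 => rw [map_one]; exact Commute.one_left _
  | hmul k hk hkr g hg =>
    rw [map_mul, weyl_refl hn hD hk hkr]
    exact Commute.mul_left (ext fun _ _ _ _ => by simp) hg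

end Fiber

/-! ### Functions on the symmetric group with values in the fibre -/

namespace Coinduced

variable {ty : ClassicalType} {n : ℕ} {V : Type*} [AddCommGroup V] [Module ℂ V]
  (hD : ty = .D → 2 ≤ n) (C : Cliff n →ₐ[ℂ] Module.End ℂ V) (ω : Weyl ty n →* Module.End ℂ V)
  (z : Fin n → Module.End ℂ V)

/-- The pointwise action of the Clifford algebra. -/
def cliff : Cliff n →ₐ[ℂ] Module.End ℂ (Equiv.Perm (Fin n) → V) where
  toFun q := (C q).compLeft (Equiv.Perm (Fin n))
  map_one' := by
    ext
    simp
  map_mul' q r := by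
    ext
    simp
  map_zero' := by
    ext
    simp
  map_add' q r := by
    ext
    simp
  commutes' r := by
    ext
    simp

@[simp]
theorem cliff_apply (q : Cliff n) (F : Equiv.Perm (Fin n) → V) (π : Equiv.Perm (Fin n)) :
    cliff C q F π = C q (F π) := rfl

/-- The action of the Weyl group, twisted by translations. -/
def weyl : Weyl ty n →* Module.End ℂ (Equiv.Perm (Fin n) → V) where
  toFun g := (ω g).compLeft (Equiv.Perm (Fin n)) ∘ₗ
    LinearMap.funLeft ℂ V fun π => (Weyl.toPerm hD g)⁻¹ * π
  map_one' := by
    ext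
    simp [LinearMap.funLeft_apply]
  map_mul' g h := by
    refine LinearMap.ext fun F => funext fun π => ?_
    simp [LinearMap.funLeft_apply, mul_assoc]

@[simp]
theorem weyl_apply (g : Weyl ty n) (F : Equiv.Perm (Fin n) → V) (π : Equiv.Perm (Fin n)) :
    weyl hD ω g F π = ω g (F ((Weyl.toPerm hD g)⁻¹ * π)) := rfl

/-- The twisted action of the variables. -/
def zOp (j : Fin n) : Module.End ℂ (Equiv.Perm (Fin n) → V) :=
  LinearMap.pi fun π => z (π⁻¹ j) ∘ₗ LinearMap.proj π

@[simp]
theorem zOp_apply (j : Fin n) (F : Equiv.Perm (Fin n) → V) (π : Equiv.Perm (Fin n)) :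
    zOp z j F π = z (π⁻¹ j) (F π) := rfl

/-- The Weyl group acts on the fibre without moving the `z_i`. Since `z_j` acts at `π` by the
variable of index `π⁻¹ j`, the translation of the argument supplies the permutation of the indices.
-/
theorem isZRep (hCω : ∀ q g, Commute (C q) (ω g))
    (hzz : ∀ i j, i ≠ j → z i * z j = -(z j * z i))
    (hcz : ∀ i j, C (Cliff.gen n i) * z j = -(z j * C (Cliff.gen n i)))
    (hωz : ∀ g i, Commute (ω g) (z i)) :
    IsZRep hD (cliff C) (weyl hD ω) (zOp z) where
  comm i g := LinearMap.ext fun F => funext fun π => LinearMap.congr_fun (hCω _ g).eq _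
  z_z i j hij := LinearMap.ext fun F => funext fun π =>
    LinearMap.congr_fun (hzz _ _ ((π⁻¹).injective.ne hij)) _
  c_z i j := LinearMap.ext fun F => funext fun π => LinearMap.congr_fun (hcz _ _) _
  weyl_z g i := LinearMap.ext fun F => funext fun π => by
    have h := LinearMap.congr_fun (hωz g (π⁻¹ (Weyl.toPerm hD g i)))
      (F ((Weyl.toPerm hD g)⁻¹ * π))
    simpa using h

end Coinduced

/-! ### Linear independence -/

namespace Induced

variable {n : ℕ} {N M : Type*} [AddCommGroup N] [Module ℂ N] [AddCommGroup M] [Module ℂ M]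
  (τ : (SkewPoly n ⊗[ℂ] N) ≃ₗ[ℂ] M)

/-- Pure tensors as a linear function of the second factor. -/
def mkₗ (p : SkewPoly n) : N →ₗ[ℂ] M :=
  τ.toLinearMap ∘ₗ TensorProduct.mk ℂ (SkewPoly n) N p

theorem cliff_mk_one (C : Cliff n →ₐ[ℂ] Module.End ℂ N) (q : Cliff n) (x : N) :
    cliff τ C q (mk τ 1 x) = mk τ 1 (C q x) := by
  let f : Cliff n →ₗ[ℂ] M := LinearMap.applyₗ (mk τ 1 x) ∘ₗ (cliff τ C).toLinearMap
  let g : Cliff n →ₗ[ℂ] M := mkₗ τ 1 ∘ₗ LinearMap.applyₗ x ∘ₗ C.toLinearMap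
  refine mem_of_adjoin_eq_top (Cliff.adjoin_gen n) (LinearMap.eqLocus f g) ?_ ?_ q
  · change cliff τ C 1 (mk τ 1 x) = mk τ 1 (C 1 x)
    rw [map_one, map_one]
    rfl
  · intro i q hq
    change cliff τ C q (mk τ 1 x) = mk τ 1 (C q x) at hq
    change cliff τ C (Cliff.gen n i * q) (mk τ 1 x) = mk τ 1 (C (Cliff.gen n i * q) x)
    rw [map_mul, Module.End.mul_apply, hq, cliff_gen_mk, map_one, map_mul, Module.End.mul_apply]

end Induced

/-! ### The faithful module and its retraction -/

namespace Model

variable {ty : ClassicalType} {n : ℕ}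

variable (ty n) in
/-- The target of the contraction. -/
abbrev Target : Type := Cliff n ⊗[ℂ] (SpinWeyl ty n ⊗[ℂ] MvPolynomial (Fin n) ℂ)

variable (ty n) in
/-- Multiplication of the two Clifford factors. -/
def contract : Fiber ty n →ₗ[ℂ] Target ty n :=
  TensorProduct.map (LinearMap.mul' ℂ (Cliff n)) LinearMap.id ∘ₗ
    (TensorProduct.assoc ℂ (Cliff n) (Cliff n)
      (SpinWeyl ty n ⊗[ℂ] MvPolynomial (Fin n) ℂ)).symm.toLinearMap

theorem contract_mk (q r : Cliff n) (s : SpinWeyl ty n) (p : MvPolynomial (Fin n) ℂ) :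
    contract ty n (Fiber.mk q r s p) = (q * r) ⊗ₜ (s ⊗ₜ p) := rfl

theorem contract_cliff (a : Cliff n) (x : Fiber ty n) :
    contract ty n (Fiber.cliff ty n a x)
      = TensorProduct.map (LinearMap.mulLeft ℂ a) LinearMap.id (contract ty n x) := by
  have h : contract ty n ∘ₗ Fiber.cliff ty n a
      = TensorProduct.map (LinearMap.mulLeft ℂ a) LinearMap.id ∘ₗ contract ty n :=
    Fiber.ext fun q r s p => by
      simp only [LinearMap.comp_apply, Fiber.cliff_mk, contract_mk, TensorProduct.map_tmul,
        LinearMap.mulLeft_apply, LinearMap.id_apply, mul_assoc]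
  exact LinearMap.congr_fun h x

variable (ty n) in
/-- The operator on the target that corresponds to a spin generator. -/
def spinOp (k : ℕ) : Target ty n →ₗ[ℂ] Target ty n :=
  TensorProduct.map (LinearMap.mulLeft ℂ (Cliff.root ty n k) ∘ₗ
      LinearMap.mulRight ℂ (Cliff.root ty n k))
    (TensorProduct.map (LinearMap.mulLeft ℂ (label (SpinWeyl.gen ty n) k)) LinearMap.id)

/-- The root multiplies the first Clifford factor from the left and the second from the right. After
contraction this is conjugation, which is trivial on `1` and leaves only the spin generator. -/
theorem contract_refl (k : ℕ) (x : Fiber ty n) :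
    contract ty n (Fiber.cliff ty n (Cliff.root ty n k) (Fiber.refl ty n k x))
      = spinOp ty n k (contract ty n x) := by
  have h : contract ty n ∘ₗ Fiber.cliff ty n (Cliff.root ty n k) ∘ₗ Fiber.refl ty n k
      = spinOp ty n k ∘ₗ contract ty n :=
    Fiber.ext fun q r s p => by
      simp only [LinearMap.comp_apply, Fiber.cliff_mk, Fiber.refl_mk, contract_mk, spinOp,
        TensorProduct.map_tmul, LinearMap.mulLeft_apply, LinearMap.mulRight_apply,
        LinearMap.id_apply, mul_assoc]
  exact LinearMap.congr_fun h x

variable (ty n) in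
/-- The contraction summed over the symmetric group. -/
def total : (Equiv.Perm (Fin n) → Fiber ty n) →ₗ[ℂ] Target ty n :=
  ∑ π : Equiv.Perm (Fin n), contract ty n ∘ₗ LinearMap.proj π

theorem total_apply (F : Equiv.Perm (Fin n) → Fiber ty n) :
    total ty n F = ∑ π, contract ty n (F π) := by
  simp [total]

theorem total_single (x : Fiber ty n) :
    total ty n (Pi.single 1 x) = contract ty n x := by
  rw [total_apply, Finset.sum_eq_single 1]
  · rw [Pi.single_eq_same]
  · intro π _ hπ
    rw [Pi.single_eq_of_ne hπ, map_zero]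
  · simp

theorem total_cliff (q : Cliff n) (F : Equiv.Perm (Fin n) → Fiber ty n) :
    total ty n (Coinduced.cliff (Fiber.cliff ty n) q F)
      = TensorProduct.map (LinearMap.mulLeft ℂ q) LinearMap.id (total ty n F) := by
  simp only [total_apply, Coinduced.cliff_apply, contract_cliff, map_sum]

variable (hn : 1 ≤ n) (hD : ty = .D → 2 ≤ n) (a u v : ℂ)

/-- The Weyl group also translates the argument in the symmetric group, and the sum over that group
is unaffected by this. -/
theorem total_refl {k : ℕ} (hk : 1 ≤ k) (hkr : k ≤ rank ty n)
    (F : Equiv.Perm (Fin n) → Fiber ty n) :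
    total ty n (Coinduced.cliff (Fiber.cliff ty n) (Cliff.root ty n k)
        (Coinduced.weyl hD (Fiber.weyl hn hD) (Weyl.refl ty n k) F))
      = spinOp ty n k (total ty n F) := by
  simp only [total_apply, Coinduced.cliff_apply, Coinduced.weyl_apply,
    Fiber.weyl_refl hn hD hk hkr, contract_refl, map_sum]
  exact Equiv.sum_comp (Equiv.mulLeft (Weyl.toPerm hD (Weyl.refl ty n k))⁻¹)
    fun π => spinOp ty n k (contract ty n (F π))

variable (ty n) in
/-- The faithful module. -/
def Space : Type := SkewPoly n ⊗[ℂ] (Equiv.Perm (Fin n) → Fiber ty n)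

instance : AddCommGroup (Space ty n) :=
  inferInstanceAs (AddCommGroup (SkewPoly n ⊗[ℂ] (Equiv.Perm (Fin n) → Fiber ty n)))

instance : Module ℂ (Space ty n) :=
  inferInstanceAs (Module ℂ (SkewPoly n ⊗[ℂ] (Equiv.Perm (Fin n) → Fiber ty n)))

variable (ty n) in
/-- The defining identification of the module with a tensor product. -/
def toSpace : (SkewPoly n ⊗[ℂ] (Equiv.Perm (Fin n) → Fiber ty n)) ≃ₗ[ℂ] Space ty n :=
  LinearEquiv.refl ℂ _

theorem isOddRep : IsOddRep hD a u v
    (Induced.cliff (toSpace ty n) (Coinduced.cliff (Fiber.cliff ty n)))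
    (Induced.weyl (toSpace ty n) hD (Coinduced.weyl hD (Fiber.weyl hn hD)))
    (Induced.eta (toSpace ty n))
    (Induced.zOp (toSpace ty n) a u v hD (Coinduced.weyl hD (Fiber.weyl hn hD))
      (Coinduced.zOp (Fiber.z ty n))) :=
  Induced.isOddRep _ a u v (Coinduced.isZRep hD _ _ _ (Fiber.cliff_weyl hn hD) Fiber.z_z
    Fiber.cliff_z (Fiber.weyl_z hn hD))

/-- The action of the spin double affine Hecke-Clifford algebra. -/
def action : SH ty n a u v →ₐ[ℂ] Module.End ℂ (Space ty n) :=
  (isOddRep hn hD a u v).toAlgHom hn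

variable (ty n) in
/-- The pure tensors. -/
def mk (p : SkewPoly n) (F : Equiv.Perm (Fin n) → Fiber ty n) : Space ty n :=
  Induced.mk (toSpace ty n) p F

theorem action_eta (i : Fin n) (p : SkewPoly n) (F : Equiv.Perm (Fin n) → Fiber ty n) :
    action hn hD a u v (SH.eta ty n a u v i) (mk ty n p F)
      = mk ty n (SkewPoly.gen n i * p) F :=
  (LinearMap.congr_fun ((isOddRep hn hD a u v).toAlgHom_mk hn (.eta i)) _).trans
    (Induced.eta_mk _ i p F)

theorem action_cliff (q : Cliff n) (F : Equiv.Perm (Fin n) → Fiber ty n) :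
    action hn hD a u v (SH.ofCliff ty n a u v q) (mk ty n 1 F)
      = mk ty n 1 (Coinduced.cliff (Fiber.cliff ty n) q F) := by
  have h : (action hn hD a u v).comp (SH.ofCliff ty n a u v)
      = Induced.cliff (toSpace ty n) (Coinduced.cliff (Fiber.cliff ty n)) :=
    Cliff.algHom_ext fun i => by
      rw [AlgHom.comp_apply, SH.ofCliff_gen]
      exact (isOddRep hn hD a u v).toAlgHom_mk hn (.c i)
  exact (LinearMap.congr_fun (DFunLike.congr_fun h q) _).trans (Induced.cliff_mk_one _ _ q F)

theorem action_spin (k : Fin (rank ty n)) (F : Equiv.Perm (Fin n) → Fiber ty n) :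
    action hn hD a u v (SH.t ty n a u v k) (mk ty n 1 F)
      = mk ty n 1 (Coinduced.cliff (Fiber.cliff ty n) (Cliff.root ty n (k + 1))
          (Coinduced.weyl hD (Fiber.weyl hn hD) (Weyl.refl ty n (k + 1)) F)) := by
  refine (LinearMap.congr_fun ((isOddRep hn hD a u v).toAlgHom_mk hn (.t k)) _).trans ?_
  rw [IsOddRep.onGen, IsOddRep.spinGen_eq, Module.End.mul_apply, mk, Induced.weyl_mk, map_one,
    Induced.cliff_mk_one, mk]

/-- The variable `z_i` produces a factor `c_i` in the Clifford algebra, which the `c_i` in `x_i =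
c_i z_i` cancels. At the identity permutation the index is not moved. -/
theorem action_x (i : Fin n) (p : MvPolynomial (Fin n) ℂ) :
    action hn hD a u v (SH.x ty n a u v i) (mk ty n 1 (Pi.single 1 (Fiber.mk 1 1 1 p)))
      = mk ty n 1 (Pi.single 1 (Fiber.mk 1 1 1 (MvPolynomial.X i * p))) := by
  refine (LinearMap.congr_fun ((isOddRep hn hD a u v).toAlgHom_mk hn (.x i)) _).trans ?_
  rw [IsOddRep.onGen, Module.End.mul_apply, mk, Induced.zOp_mk_one, Induced.cliff_mk_one, mk]
  congr 1
  funext π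
  rw [Coinduced.cliff_apply, Coinduced.zOp_apply]
  by_cases hπ : π = 1
  · subst hπ
    rw [Pi.single_eq_same, Pi.single_eq_same, inv_one, Equiv.Perm.one_apply, Fiber.z_mk,
      Fiber.cliff_mk, map_one, one_mul, Cliff.gen_sq]
  · rw [Pi.single_eq_of_ne hπ, Pi.single_eq_of_ne hπ, map_zero, map_zero]

variable (ty n) in
/-- The cyclic vector. -/
def vac : Space ty n := mk ty n 1 (Pi.single 1 (Fiber.mk 1 1 1 1))

theorem action_poly (p : MvPolynomial (Fin n) ℂ) :
    action hn hD a u v (SH.ofPoly ty n a u v p) (vac ty n)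
      = mk ty n 1 (Pi.single 1 (Fiber.mk 1 1 1 p)) := by
  let e : MvPolynomial (Fin n) ℂ →ₗ[ℂ] Space ty n :=
    Induced.mkₗ (toSpace ty n) 1 ∘ₗ LinearMap.single ℂ _ 1 ∘ₗ
      (TensorProduct.mk ℂ (Cliff n) _ 1 ∘ₗ TensorProduct.mk ℂ (Cliff n) _ 1 ∘ₗ
        TensorProduct.mk ℂ (SpinWeyl ty n) (MvPolynomial (Fin n) ℂ) 1 :
          MvPolynomial (Fin n) ℂ →ₗ[ℂ] Fiber ty n)
  have he : ∀ p, e p = mk ty n 1 (Pi.single 1 (Fiber.mk 1 1 1 p)) := fun _ => rfl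
  rw [← he]
  induction p using MvPolynomial.induction_on with
  | C r =>
    have h1 : (MvPolynomial.C r : MvPolynomial (Fin n) ℂ) = r • 1 := by
      rw [MvPolynomial.smul_eq_C_mul, mul_one]
    rw [h1, map_smul, map_smul, map_smul, map_one, map_one, he]
    rfl
  | add p q hp hq => rw [map_add, map_add, LinearMap.add_apply, hp, hq, map_add]
  | mul_X p i hp =>
    rw [mul_comm, map_mul, SH.ofPoly_X, map_mul, Module.End.mul_apply, hp, he, he, action_x]

theorem action_skew (p : SkewPoly n) (F : Equiv.Perm (Fin n) → Fiber ty n) :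
    action hn hD a u v (SH.ofSkew ty n a u v p) (mk ty n 1 F) = mk ty n p F := by
  let f : SkewPoly n →ₗ[ℂ] Space ty n := LinearMap.applyₗ (mk ty n 1 F) ∘ₗ
    (action hn hD a u v).toLinearMap ∘ₗ (SH.ofSkew ty n a u v).toLinearMap
  let g : SkewPoly n →ₗ[ℂ] Space ty n :=
    (toSpace ty n).toLinearMap ∘ₗ (TensorProduct.mk ℂ (SkewPoly n) _).flip F
  refine mem_of_adjoin_eq_top (SkewPoly.adjoin_gen n) (LinearMap.eqLocus f g) ?_ ?_ p
  · change action hn hD a u v (SH.ofSkew ty n a u v 1) (mk ty n 1 F) = mk ty n 1 F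
    rw [map_one, map_one, Module.End.one_apply]
  · intro i p hp
    change action hn hD a u v (SH.ofSkew ty n a u v p) (mk ty n 1 F) = mk ty n p F at hp
    change action hn hD a u v (SH.ofSkew ty n a u v (SkewPoly.gen n i * p)) (mk ty n 1 F)
      = mk ty n (SkewPoly.gen n i * p) F
    rw [map_mul, map_mul, Module.End.mul_apply, hp, SH.ofSkew_gen, action_eta]

variable (ty n) in
/-- The retraction of the module onto the tensor product in the PBW theorem. -/
def retract : Space ty n →ₗ[ℂ] SkewPoly n ⊗[ℂ] Target ty n :=
  TensorProduct.map LinearMap.id (total ty n) ∘ₗ (toSpace ty n).symm.toLinearMap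

theorem retract_mk (p : SkewPoly n) (F : Equiv.Perm (Fin n) → Fiber ty n) :
    retract ty n (mk ty n p F) = p ⊗ₜ total ty n F := rfl

/-- The function `F` is spread over the symmetric group in a way that depends on how `s` is written
as a combination of words. Its total does not, so the existence of some `F` is all that is claimed.
-/
theorem action_ofSpin (s : SpinWeyl ty n) (p : MvPolynomial (Fin n) ℂ) :
    ∃ F, action hn hD a u v (SH.ofSpin ty n a u v s)
        (mk ty n 1 (Pi.single 1 (Fiber.mk 1 1 1 p))) = mk ty n 1 F ∧
      total ty n F = 1 ⊗ₜ (s ⊗ₜ p) := by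
  let A : SpinWeyl ty n →ₗ[ℂ] Space ty n :=
    LinearMap.applyₗ (mk ty n 1 (Pi.single 1 (Fiber.mk 1 1 1 p))) ∘ₗ
      (action hn hD a u v).toLinearMap ∘ₗ (SH.ofSpin ty n a u v).toLinearMap
  let B : SpinWeyl ty n →ₗ[ℂ] Target ty n := TensorProduct.mk ℂ (Cliff n) _ 1 ∘ₗ
    (TensorProduct.mk ℂ (SpinWeyl ty n) (MvPolynomial (Fin n) ℂ)).flip p
  let J : (Equiv.Perm (Fin n) → Fiber ty n) →ₗ[ℂ] Space ty n := Induced.mkₗ (toSpace ty n) 1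
  let S : Submodule ℂ (SpinWeyl ty n) :=
    { carrier := {s | ∃ F, A s = J F ∧ total ty n F = B s}
      zero_mem' := ⟨0, by rw [map_zero, map_zero], by rw [map_zero, map_zero]⟩
      add_mem' := by
        rintro s s' ⟨F, h1, h2⟩ ⟨F', h1', h2'⟩
        exact ⟨F + F', by rw [map_add, map_add, h1, h1'], by rw [map_add, map_add, h2, h2']⟩
      smul_mem' := by
        rintro r s ⟨F, h1, h2⟩
        exact ⟨r • F, by rw [map_smul, map_smul, h1], by rw [map_smul, map_smul, h2]⟩ }
  refine mem_of_adjoin_eq_top (SpinWeyl.adjoin_gen ty n) S ?_ ?_ s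
  · refine ⟨Pi.single 1 (Fiber.mk 1 1 1 p), ?_, ?_⟩
    · change action hn hD a u v (SH.ofSpin ty n a u v 1) _ = _
      rw [map_one, map_one, Module.End.one_apply]
      rfl
    · rw [total_single, contract_mk, mul_one]
      rfl
  · rintro k s ⟨F, h1, h2⟩
    refine ⟨Coinduced.cliff (Fiber.cliff ty n) (Cliff.root ty n (k + 1))
      (Coinduced.weyl hD (Fiber.weyl hn hD) (Weyl.refl ty n (k + 1)) F), ?_, ?_⟩
    · change action hn hD a u v (SH.ofSpin ty n a u v s) _ = mk ty n 1 F at h1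
      change action hn hD a u v (SH.ofSpin ty n a u v (SpinWeyl.gen ty n k * s)) _ = mk ty n 1 _
      rw [map_mul, map_mul, Module.End.mul_apply, h1, SH.ofSpin_gen, action_spin]
    · rw [total_refl hn hD (by omega) (by omega), h2]
      -- The total so far has Clifford part `1`, so the two copies of the root meet and square to
      -- `1`.
      have h3 : Cliff.root ty n (k + 1) * (1 * Cliff.root ty n (k + 1)) = 1 := by
        rw [one_mul, Cliff.root_sq hD (by omega) (by omega)]
      have h4 : label (SpinWeyl.gen ty n) (k + 1) = SpinWeyl.gen ty n k := by
        rw [label, dif_pos (by omega)]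
        rfl
      change (Cliff.root ty n (k + 1) * (1 * Cliff.root ty n (k + 1))) ⊗ₜ
        ((label (SpinWeyl.gen ty n) (k + 1) * s) ⊗ₜ p) = 1 ⊗ₜ ((SpinWeyl.gen ty n k * s) ⊗ₜ p)
      rw [h3, h4]

/-- Applied to the cyclic vector, the four factors of a product act from right to left, and each
fills its own tensor slot. This left inverse gives injectivity. -/
theorem retract_mulMap :
    (retract ty n ∘ₗ LinearMap.applyₗ (vac ty n) ∘ₗ (action hn hD a u v).toLinearMap) ∘ₗ
      SH.mulMap ty n a u v = LinearMap.id := by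
  refine TensorProduct.ext' fun p w => ?_
  have key : ∀ q s f, retract ty n (action hn hD a u v
      (SH.mulMap ty n a u v (p ⊗ₜ (q ⊗ₜ (s ⊗ₜ f)))) (vac ty n)) = p ⊗ₜ (q ⊗ₜ (s ⊗ₜ f)) := by
    intro q s f
    obtain ⟨F, h1, h2⟩ := action_ofSpin hn hD a u v s f
    have h3 : SH.mulMap ty n a u v (p ⊗ₜ (q ⊗ₜ (s ⊗ₜ f)))
        = SH.ofSkew ty n a u v p * (SH.ofCliff ty n a u v q *
          (SH.ofSpin ty n a u v s * SH.ofPoly ty n a u v f)) := rfl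
    rw [h3, map_mul, map_mul, map_mul, Module.End.mul_apply, Module.End.mul_apply,
      Module.End.mul_apply, action_poly, h1, action_cliff, action_skew, retract_mk, total_cliff, h2,
      TensorProduct.map_tmul, LinearMap.mulLeft_apply, mul_one, LinearMap.id_apply]
  let T : (Cliff n ⊗[ℂ] (SpinWeyl ty n ⊗[ℂ] MvPolynomial (Fin n) ℂ)) →ₗ[ℂ]
      SkewPoly n ⊗[ℂ] Target ty n :=
    retract ty n ∘ₗ LinearMap.applyₗ (vac ty n) ∘ₗ (action hn hD a u v).toLinearMap ∘ₗ
      SH.mulMap ty n a u v ∘ₗ TensorProduct.mk ℂ (SkewPoly n) _ p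
  have hT : T = TensorProduct.mk ℂ (SkewPoly n) (Target ty n) p :=
    TensorProduct.ext' fun q w => by
      let T' := T ∘ₗ TensorProduct.mk ℂ (Cliff n) _ q
      have hT' : T' = TensorProduct.mk ℂ (SkewPoly n) (Target ty n) p ∘ₗ
          TensorProduct.mk ℂ (Cliff n) _ q := TensorProduct.ext' fun s f => key q s f
      exact LinearMap.congr_fun hT' w
  exact LinearMap.congr_fun hT w

end Model

/-- The multiplication map is injective. -/
theorem SH.mulMap_injective {ty : ClassicalType} {n : ℕ} (hn : 1 ≤ n) (hD : ty = .D → 2 ≤ n)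
    (a u v : ℂ) : Function.Injective (SH.mulMap ty n a u v) :=
  Function.LeftInverse.injective
    (g := fun y => Model.retract ty n (Model.action hn hD a u v y (Model.vac ty n)))
    (LinearMap.congr_fun (Model.retract_mulMap hn hD a u v))

/-! ### Spanning -/

section subalgebra

variable {A : Type*} [Ring A] [Algebra ℂ A] (S : Subalgebra ℂ A) {ty : ClassicalType} {n : ℕ}
  {c : Fin n → A} {t : ℕ → A} (hc : ∀ i, c i ∈ S) (ht : ∀ k, t k ∈ S)

include hc ht

theorem offDiag_mem (u : ℂ) (i j : Fin n) : offDiag ty n u c t i j ∈ S := by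
  have h := map_offDiag S.val ty n (fun k => ⟨t k, ht k⟩) u (fun k => ⟨c k, hc k⟩) i j
  exact h ▸ Subtype.property _

theorem onDiag_mem (a u v : ℂ) (i : Fin n) : onDiag ty n a u v c t i ∈ S := by
  have h := map_onDiag S.val ty n (fun k => ⟨t k, ht k⟩) a u v (fun k => ⟨c k, hc k⟩) i
  exact h ▸ Subtype.property _

end subalgebra

/-! ### Stability of the span of ordered products -/

namespace SH

variable {ty : ClassicalType} {n : ℕ} {a u v : ℂ}

variable (ty n a u v) in
/-- The product `p q s f`. -/
def word (p : SkewPoly n) (q : Cliff n) (s : SpinWeyl ty n) (f : MvPolynomial (Fin n) ℂ) :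
    SH ty n a u v :=
  mulMap ty n a u v (p ⊗ₜ (q ⊗ₜ (s ⊗ₜ f)))

theorem word_eq (p : SkewPoly n) (q : Cliff n) (s : SpinWeyl ty n)
    (f : MvPolynomial (Fin n) ℂ) : word ty n a u v p q s f
      = ofSkew ty n a u v p * (ofCliff ty n a u v q * (ofSpin ty n a u v s *
        ofPoly ty n a u v f)) := rfl

variable (ty n a u v) in
/-- The span of the products `p q s f`. -/
def words : Submodule ℂ (SH ty n a u v) := LinearMap.range (mulMap ty n a u v)

theorem word_mem (p : SkewPoly n) (q : Cliff n) (s : SpinWeyl ty n)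
    (f : MvPolynomial (Fin n) ℂ) : word ty n a u v p q s f ∈ words ty n a u v := ⟨_, rfl⟩

theorem mul_mem_words {y : SH ty n a u v}
    (h : ∀ p q s f, y * word ty n a u v p q s f ∈ words ty n a u v) {w : SH ty n a u v}
    (hw : w ∈ words ty n a u v) : y * w ∈ words ty n a u v := by
  obtain ⟨w, rfl⟩ := hw
  let T := LinearMap.mulLeft ℂ y ∘ₗ mulMap ty n a u v
  change T w ∈ words ty n a u v
  induction w using TensorProduct.induction_on with
  | zero => rw [map_zero]; exact Submodule.zero_mem _
  | add w w' hw hw' => rw [map_add]; exact Submodule.add_mem _ hw hw'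
  | tmul p w =>
    induction w using TensorProduct.induction_on with
    | zero => rw [TensorProduct.tmul_zero, map_zero]; exact Submodule.zero_mem _
    | add w w' hw hw' =>
      rw [TensorProduct.tmul_add, map_add]
      exact Submodule.add_mem _ hw hw'
    | tmul q w =>
      induction w using TensorProduct.induction_on with
      | zero =>
        rw [TensorProduct.tmul_zero, TensorProduct.tmul_zero, map_zero]
        exact Submodule.zero_mem _
      | add w w' hw hw' =>
        rw [TensorProduct.tmul_add, TensorProduct.tmul_add, map_add]
        exact Submodule.add_mem _ hw hw'
      | tmul s f => exact h p q s f

theorem word_skew (i : Fin n) (p : SkewPoly n) (q : Cliff n) (s : SpinWeyl ty n)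
    (f : MvPolynomial (Fin n) ℂ) : word ty n a u v (SkewPoly.gen n i * p) q s f
      = eta ty n a u v i * word ty n a u v p q s f := by
  rw [word_eq, word_eq, map_mul, ofSkew_gen, mul_assoc]

theorem word_cliff (i : Fin n) (q : Cliff n) (s : SpinWeyl ty n)
    (f : MvPolynomial (Fin n) ℂ) : word ty n a u v 1 (Cliff.gen n i * q) s f
      = c ty n a u v i * word ty n a u v 1 q s f := by
  rw [word_eq, word_eq, map_mul, ofCliff_gen, map_one, one_mul, one_mul, mul_assoc]

theorem word_spin (k : Fin (rank ty n)) (s : SpinWeyl ty n)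
    (f : MvPolynomial (Fin n) ℂ) : word ty n a u v 1 1 (SpinWeyl.gen ty n k * s) f
      = t ty n a u v k * word ty n a u v 1 1 s f := by
  rw [word_eq, word_eq, map_mul, ofSpin_gen, map_one, map_one, one_mul, one_mul, one_mul, one_mul,
    mul_assoc]

/-- Induction on the skew polynomial in `p q s f`. -/
theorem skew_induction {y : SH ty n a u v} (q : Cliff n) (s : SpinWeyl ty n)
    (f : MvPolynomial (Fin n) ℂ) (h1 : y * word ty n a u v 1 q s f ∈ words ty n a u v)
    (h2 : ∀ i p, y * word ty n a u v p q s f ∈ words ty n a u v →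
      y * (eta ty n a u v i * word ty n a u v p q s f) ∈ words ty n a u v) (p : SkewPoly n) :
    y * word ty n a u v p q s f ∈ words ty n a u v := by
  let T := LinearMap.mulLeft ℂ y ∘ₗ mulMap ty n a u v ∘ₗ
    (TensorProduct.mk ℂ (SkewPoly n) _).flip (q ⊗ₜ (s ⊗ₜ f))
  refine mem_of_adjoin_eq_top (SkewPoly.adjoin_gen n) ((words ty n a u v).comap T) h1 ?_ p
  intro i p hp
  have := h2 i p hp
  rwa [← word_skew] at this

/-- Induction on the Clifford element in `q s f`. -/
theorem cliff_induction {y : SH ty n a u v} (s : SpinWeyl ty n)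
    (f : MvPolynomial (Fin n) ℂ) (h1 : y * word ty n a u v 1 1 s f ∈ words ty n a u v)
    (h2 : ∀ i q, y * word ty n a u v 1 q s f ∈ words ty n a u v →
      y * (c ty n a u v i * word ty n a u v 1 q s f) ∈ words ty n a u v) (q : Cliff n) :
    y * word ty n a u v 1 q s f ∈ words ty n a u v := by
  let T := LinearMap.mulLeft ℂ y ∘ₗ mulMap ty n a u v ∘ₗ TensorProduct.mk ℂ (SkewPoly n) _ 1 ∘ₗ
    (TensorProduct.mk ℂ (Cliff n) _).flip (s ⊗ₜ f)
  refine mem_of_adjoin_eq_top (Cliff.adjoin_gen n) ((words ty n a u v).comap T) h1 ?_ q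
  intro i q hq
  have := h2 i q hq
  rwa [← word_cliff] at this

theorem eta_mul_mem (i : Fin n) {w : SH ty n a u v} (hw : w ∈ words ty n a u v) :
    eta ty n a u v i * w ∈ words ty n a u v :=
  mul_mem_words (fun p q s f => by rw [← word_skew]; exact word_mem ..) hw

theorem c_eta (i j : Fin n) : c ty n a u v i * eta ty n a u v j
    = -(eta ty n a u v j * c ty n a u v i) := by
  simpa [c, eta] using mk_rel (Rel.c_e (ty := ty) (a := a) (u := u) (v := v) i j)

theorem c_x (i j : Fin n) : c ty n a u v i * x ty n a u v j
    = (if i = j then (-1 : ℂ) else 1) • (x ty n a u v j * c ty n a u v i) := by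
  simpa only [map_mul, map_smul, c, t, x] using mk_rel (Rel.c_x (ty := ty) (a := a) (u := u) (v := v) i j)

theorem t_c (k : Fin (rank ty n)) (j : Fin n) : t ty n a u v k * c ty n a u v j
    = -(reflSign ty n (k + 1) j • (c ty n a u v (reflPerm ty n (k + 1) j) * t ty n a u v k)) := by
  simpa only [map_mul, map_smul, map_neg, c, t] using
    mk_rel (Rel.t_c (ty := ty) (a := a) (u := u) (v := v) k j)

theorem t_x (k : Fin (rank ty n)) (j : Fin n) : t ty n a u v k * x ty n a u v j
    = reflSign ty n (k + 1) j • (x ty n a u v (reflPerm ty n (k + 1) j) * t ty n a u v k) := by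
  simpa only [map_mul, map_smul, c, t, x] using mk_rel (Rel.t_x (ty := ty) (a := a) (u := u) (v := v) k j)

theorem t_eta (k : Fin (rank ty n)) (j : Fin n) : t ty n a u v k * eta ty n a u v j
    = -(eta ty n a u v (reflPerm ty n (k + 1) j) * t ty n a u v k) := by
  simpa only [map_mul, map_neg, eta, t] using mk_rel (Rel.t_e (ty := ty) (a := a) (u := u) (v := v) k j)

theorem neg_mul_mem {y w : SH ty n a u v} (h : y * w ∈ words ty n a u v) :
    -y * w ∈ words ty n a u v :=
  (congrArg (· ∈ words ty n a u v) (neg_mul y w)).mpr (Submodule.neg_mem _ h)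

theorem c_mul_mem (i : Fin n) {w : SH ty n a u v} (hw : w ∈ words ty n a u v) :
    c ty n a u v i * w ∈ words ty n a u v := by
  refine mul_mem_words (fun p q s f => skew_induction q s f ?_ (fun j p hp => ?_) p) hw
  · rw [← word_cliff]
    exact word_mem ..
  · rw [← mul_assoc, c_eta]
    exact neg_mul_mem (by rw [mul_assoc]; exact eta_mul_mem j hp)

theorem t_mul_mem (k : Fin (rank ty n)) {w : SH ty n a u v} (hw : w ∈ words ty n a u v) :
    t ty n a u v k * w ∈ words ty n a u v := by
  refine mul_mem_words (fun p q s f => skew_induction q s f ?_ (fun j p hp => ?_) p) hw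
  · refine cliff_induction s f ?_ (fun j q hq => ?_) q
    · rw [← word_spin]
      exact word_mem ..
    · rw [← mul_assoc, t_c]
      refine neg_mul_mem ?_
      rw [smul_mul_assoc, mul_assoc]
      exact Submodule.smul_mem _ _ (c_mul_mem _ hq)
  · rw [← mul_assoc, t_eta]
    exact neg_mul_mem (by rw [mul_assoc]; exact eta_mul_mem _ hp)

variable (ty n a u v) in
/-- The subalgebra of all elements whose left multiplication preserves the span of the words. -/
def stabilizer : Subalgebra ℂ (SH ty n a u v) where
  carrier := {y | ∀ w ∈ words ty n a u v, y * w ∈ words ty n a u v}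
  mul_mem' := by
    intro y y' hy hy' w hw
    rw [mul_assoc]
    exact hy _ (hy' _ hw)
  add_mem' := by
    intro y y' hy hy' w hw
    rw [add_mul]
    exact Submodule.add_mem _ (hy _ hw) (hy' _ hw)
  algebraMap_mem' := by
    intro r w hw
    rw [← Algebra.smul_def]
    exact Submodule.smul_mem _ _ hw

/-- The commutator is an expression in the `c i` and `t k`, all of which preserve the span. Which
expression it is plays no role. -/
theorem exists_commutator (i j : Fin n) : ∃ r ∈ stabilizer ty n a u v,
    x ty n a u v j * eta ty n a u v i = eta ty n a u v i * x ty n a u v j - r := by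
  have hc : ∀ i, mk ty n a u v (Gen.fc i) ∈ stabilizer ty n a u v := fun i _ hw => c_mul_mem i hw
  have ht : ∀ k, mk ty n a u v (label Gen.ft k) ∈ stabilizer ty n a u v := by
    intro k
    rw [label]
    split_ifs
    · exact fun _ hw => t_mul_mem _ hw
    · rw [map_one]
      exact Subalgebra.one_mem _
  refine ⟨eta ty n a u v i * x ty n a u v j - x ty n a u v j * eta ty n a u v i, ?_, by abel⟩
  by_cases hij : i = j
  · subst hij
    have h := mk_rel (Rel.e_x_diag (ty := ty) (a := a) (u := u) (v := v) i)
    rw [map_onDiag, map_sub, map_mul, map_mul] at h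
    rw [eta, x, h]
    exact onDiag_mem _ hc ht a u v i
  · have h := mk_rel (Rel.e_x_off (ty := ty) (a := a) (u := u) (v := v) i j hij)
    rw [map_offDiag, map_sub, map_mul, map_mul] at h
    rw [eta, x, h]
    exact offDiag_mem _ hc ht u i j

theorem x_mul_spin_mem (j : Fin n) (s : SpinWeyl ty n) (f : MvPolynomial (Fin n) ℂ) :
    x ty n a u v j * word ty n a u v 1 1 s f ∈ words ty n a u v := by
  let T := fun j => LinearMap.mulLeft ℂ (x ty n a u v j) ∘ₗ mulMap ty n a u v ∘ₗ
    TensorProduct.mk ℂ (SkewPoly n) _ 1 ∘ₗ TensorProduct.mk ℂ (Cliff n) _ 1 ∘ₗ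
    (TensorProduct.mk ℂ (SpinWeyl ty n) (MvPolynomial (Fin n) ℂ)).flip f
  -- All indices `j` are treated at once, because moving `x_j` past a spin generator changes `j`.
  have h := mem_of_adjoin_eq_top (SpinWeyl.adjoin_gen ty n)
    (⨅ j, (words ty n a u v).comap (T j)) ?_ ?_ s
  · exact (Submodule.mem_iInf _).1 h j
  · refine (Submodule.mem_iInf _).2 fun j => ?_
    have h2 : x ty n a u v j * word ty n a u v 1 1 1 f
        = word ty n a u v 1 1 1 (MvPolynomial.X j * f) := by
      simp only [word_eq, map_one, one_mul, map_mul, ofPoly_X]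
    change x ty n a u v j * word ty n a u v 1 1 1 f ∈ words ty n a u v
    rw [h2]
    exact word_mem ..
  · intro k s hs
    refine (Submodule.mem_iInf _).2 fun j => ?_
    have h1 : x ty n a u v (reflPerm ty n (k + 1) j) * word ty n a u v 1 1 s f
        ∈ words ty n a u v := (Submodule.mem_iInf _).1 hs _
    have h2 := t_mul_mem k h1
    have h3 : reflPerm ty n (k + 1) (reflPerm ty n (k + 1) j) = j := by
      rw [← Equiv.Perm.mul_apply, reflPerm_sq, Equiv.Perm.one_apply]
    -- The relation is used backwards: `t_k` times a known element of the span equals a nonzero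
    -- multiple of `x_j t_k` applied to the word, and the scalar can be divided out.
    rw [← mul_assoc, t_x, h3, smul_mul_assoc, mul_assoc, ← word_spin, Submodule.smul_mem_iff] at h2
    · exact h2
    · rw [reflSign]
      split_ifs <;> norm_num

theorem x_mul_mem (j : Fin n) {w : SH ty n a u v} (hw : w ∈ words ty n a u v) :
    x ty n a u v j * w ∈ words ty n a u v := by
  refine mul_mem_words (fun p q s f => skew_induction q s f ?_ (fun i p hp => ?_) p) hw
  · refine cliff_induction s f (x_mul_spin_mem j s f) (fun i q hq => ?_) q
    have h2 := c_mul_mem i hq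
    rw [← mul_assoc, c_x, smul_mul_assoc, mul_assoc, Submodule.smul_mem_iff] at h2
    · exact h2
    · split_ifs <;> norm_num
  · obtain ⟨r, hr, h⟩ := exists_commutator (ty := ty) (a := a) (u := u) (v := v) i j
    rw [← mul_assoc, h, sub_mul, mul_assoc]
    exact Submodule.sub_mem _ (eta_mul_mem i hp) (hr _ (word_mem ..))

/-- The multiplication map is surjective. -/
theorem mulMap_surjective : Function.Surjective (mulMap ty n a u v) := by
  refine mem_of_adjoin_eq_top (adjoin_ringQuot (Rel ty n a u v)) (words ty n a u v) ?_ ?_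
  · have h : word ty n a u v 1 1 1 1 = 1 := by simp only [word_eq, map_one, one_mul]
    exact h ▸ word_mem ..
  · rintro (i | i | i | k) w hw
    · exact x_mul_mem i hw
    · exact eta_mul_mem i hw
    · exact c_mul_mem i hw
    · exact t_mul_mem k hw

/-! ### The PBW basis -/

theorem ofSkew_basis (α : Fin n → ℕ) :
    ofSkew ty n a u v (SkewPoly.basis n α) = etaPow ty n a u v α := by
  rw [SkewPoly.basis_apply, map_list_prod, List.map_ofFn, etaPow]
  simp only [Function.comp_def, map_pow, ofSkew_gen]

theorem ofCliff_basis (ε : Fin n → ZMod 2) :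
    ofCliff ty n a u v (Cliff.basis n ε) = cPow ty n a u v ε := by
  rw [Cliff.basis_apply, map_list_prod, List.map_ofFn, cPow]
  simp only [Function.comp_def, map_pow, ofCliff_gen]

theorem ofPoly_monomial (γ : Fin n →₀ ℕ) :
    ofPoly ty n a u v (MvPolynomial.monomial γ 1) = xPow ty n a u v γ := by
  have h : (MvPolynomial.monomial γ (1 : ℂ))
      = (List.ofFn fun i => (MvPolynomial.X i : MvPolynomial (Fin n) ℂ) ^ γ i).prod := by
    rw [MvPolynomial.monomial_eq, map_one, one_mul, List.prod_ofFn,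
      Finsupp.prod_fintype _ _ fun _ => pow_zero _]
  rw [h, map_list_prod, List.map_ofFn, xPow]
  simp only [Function.comp_def, map_pow, ofPoly_X]

end SH

end SpinDaHCa

end

/-! ### The PBW theorem -/

theorem mainTheorem5 (ty : SpinDaHCa.ClassicalType) (n : ℕ) (hn : 1 ≤ n)
    (hD : ty = SpinDaHCa.ClassicalType.D → 2 ≤ n) (t u v : ℂ) :
    Function.Bijective (SpinDaHCa.SH.mulMap ty n t u v) ∧
    ∀ (κ : Type*) (σ : Module.Basis κ ℂ (SpinDaHCa.SpinWeyl ty n)),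
      ∃ B : Module.Basis ((Fin n → ℕ) × (Fin n → ZMod 2) × κ × (Fin n → ℕ)) ℂ
          (SpinDaHCa.SH ty n t u v),
        ∀ (α : Fin n → ℕ) (ε : Fin n → ZMod 2) (k : κ) (γ : Fin n → ℕ),
          B (α, ε, k, γ) =
            SpinDaHCa.SH.etaPow ty n t u v α * SpinDaHCa.SH.cPow ty n t u v ε *
              SpinDaHCa.SH.ofSpin ty n t u v (σ k) * SpinDaHCa.SH.xPow ty n t u v γ := by
  have hbij : Function.Bijective (SpinDaHCa.SH.mulMap ty n t u v) :=
    ⟨SpinDaHCa.SH.mulMap_injective hn hD t u v, SpinDaHCa.SH.mulMap_surjective⟩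
  refine ⟨hbij, fun κ σ => ?_⟩
  -- The monomial basis of the polynomial ring is indexed by finitely supported functions; it is
  -- reindexed by all functions on the finite index set.
  let P := (MvPolynomial.basisMonomials (Fin n) ℂ).reindex Finsupp.equivFunOnFinite
  refine ⟨((SpinDaHCa.SkewPoly.basis n).tensorProduct ((SpinDaHCa.Cliff.basis n).tensorProduct
    (σ.tensorProduct P))).map (LinearEquiv.ofBijective _ hbij), fun α ε k γ => ?_⟩
  have hP : SpinDaHCa.SH.ofPoly ty n t u v (P γ) = SpinDaHCa.SH.xPow ty n t u v γ := by
    rw [Module.Basis.reindex_apply, MvPolynomial.coe_basisMonomials,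
      SpinDaHCa.SH.ofPoly_monomial]
    rfl
  rw [Module.Basis.map_apply, Module.Basis.tensorProduct_apply,
    Module.Basis.tensorProduct_apply, Module.Basis.tensorProduct_apply]
  refine (SpinDaHCa.SH.word_eq _ _ _ _).trans ?_
  rw [SpinDaHCa.SH.ofSkew_basis, SpinDaHCa.SH.ofCliff_basis, hP, mul_assoc, mul_assoc]
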